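/- Let $p$ be a prime, and let $A$ and $B$ be free groups (of arbitrary rank). Let $h\in A$ and $k\in B$ be such that $\langle h\rangle$ and $\langle k\rangle$ are maximal cyclic subgroups of $A$ and $B$, respectively (that is, they are not properly contained in another cyclic subgroup). Let $m,n$ be natural numbers, $H=\langle h^m\rangle$, $K=\langle k^n\rangle$, let $\varphi\colon H\to K$ be an isomorphism, and let $G=(A*B;\ H=K,\varphi)$ be the free product of $A$ and $B$ with $H$ and $K$ amalgamated according to $\varphi$. A subgroup $Y$ of a group $X$ is called $p'$-isolated if, for every $g\in X$ and every prime $q\neq p$, $g^q\in Y$ implies $g\in Y$; a subgroup $F$ of $X$ is called $p$-separable if, for every $g\in X\setminus F$, there is a homomorphism $\psi$ of $X$ onto a finite $p$-group such that $\psi(g)\notin\psi(F)$. If $m=1$, or $n=1$, or both $m$ and $n$ are powers of $p$ (with $p^0=1$ allowed), then every $p'$-isolated cyclic subgroup of $G$ is $p$-separable. -/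

import Mathlib

/-- The free product `A * B` with the subgroups `H ≤ A` and `K ≤ B` amalgamated according to the
isomorphism `φ : H ≃* K`: the quotient of the free product of `A` and `B` by the normal subgroup
generated by all the elements `h * (φ h)⁻¹` with `h ∈ H`. -/
def AmalgamatedProduct {A : Type*} {B : Type*} [Group A] [Group B]
    (H : Subgroup A) (K : Subgroup B) (φ : H ≃* K) :=
  Monoid.Coprod A B ⧸ Subgroup.normalClosure (Set.range fun h : H =>
    (Monoid.Coprod.inl (h : A) * (Monoid.Coprod.inr (φ h : B))⁻¹ : Monoid.Coprod A B))

instance AmalgamatedProduct.instGroup {A : Type*} {B : Type*} [Group A] [Group B]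
    (H : Subgroup A) (K : Subgroup B) (φ : H ≃* K) : Group (AmalgamatedProduct H K φ) :=
  inferInstanceAs (Group (Monoid.Coprod A B ⧸ Subgroup.normalClosure (Set.range fun h : H =>
    (Monoid.Coprod.inl (h : A) * (Monoid.Coprod.inr (φ h : B))⁻¹ : Monoid.Coprod A B))))

/-- `C` is a maximal cyclic subgroup: it is cyclic and is not properly contained in a cyclic
subgroup. -/
def IsMaximalCyclicSubgroup {X : Type*} [Group X] (C : Subgroup X) : Prop :=
  Maximal (fun D : Subgroup X => IsCyclic D) C

/-- A subgroup `Y` of `X` is `p'`-isolated if, for every `g ∈ X` and every prime `q ≠ p`,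
`g ^ q ∈ Y` implies `g ∈ Y`. -/
def IsPPrimeIsolated (p : ℕ) {X : Type*} [Group X] (Y : Subgroup X) : Prop :=
  ∀ (g : X) (q : ℕ), q.Prime → q ≠ p → g ^ q ∈ Y → g ∈ Y

/-- A subgroup `F` of `X` is `p`-separable (separable in the class of finite `p`-groups) if for
every `g ∈ X` outside `F` there is a homomorphism `ψ` of `X` onto a finite `p`-group such that
`ψ g ∉ ψ F`. (Every homomorphic image of `X` has an isomorphic copy in the universe of `X`.) -/
def IsPSeparable.{u} (p : ℕ) {X : Type u} [Group X] (F : Subgroup X) : Prop :=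
  ∀ g : X, g ∉ F → ∃ (P : Type u) (_ : Group P) (ψ : X →* P),
    Finite P ∧ IsPGroup p P ∧ Function.Surjective ψ ∧ ψ g ∉ F.map ψ

/-!
Equip every group with its pro-`p` topology. A `p'`-isolated cyclic subgroup `⟨f⟩` of `G` is
`p`-separable if it is closed, and being `p'`-isolated it is closed as soon as every element `g` of
its closure satisfies `g ^ a ∈ ⟨f⟩` for some `a` prime to `p` (`ClosureLeRoots`). The proof
establishes this property of `G` together with residual `p`-finiteness.

The source of the property is `exists_pow_mem_zpowers_of_unitriangular`. An element `g` of the closure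
of `⟨f⟩` behaves like `f ^ z` with a `p`-adic integer `z`. If some homomorphism `θ` to an integral
unitriangular group does not kill `f`, the first nonvanishing superdiagonal of `θ f` is multiplied by
`z`, whence `z` is a fraction `b / a` of integers and `g ^ a = f ^ b`. The homomorphism may be defined on
an open subgroup only. This settles free groups, which are residually groups of integral unitriangular
matrices (`IsFreeGroup.exists_unitriangular_ne_one`).

Let `G` be the amalgam of `A` and `B` along `u = v`, where `A` and `B` are residually `p`, and `⟨u⟩`,
`⟨v⟩` are closed and infinite, or trivial. Higman's amalgamation theorem for finite `p`-groups
(`hasCommonAction_of_orderOf_eq`) gives compatible actions of `A` and `B` on a finite set `Ω`, with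
arbitrarily small stabilizers (`exists_common_action`). Twisting the action of `B` by the coboundary
of a function `τ` on the orbits of `u` yields homomorphisms of `G` to the group of twisted permutations
with values in an integral unitriangular group. The twist of a reduced product is a word in the values
of `τ` without consecutive equal letters, hence nontrivial for a suitable `τ`
(`IsAmalgam.exists_separating`). It follows that `G` is residually `p`, that the factors are
closed, and, applied to a power of a cyclically reduced product, that the property of closures passes
from `A` and `B` to `G` (`IsAmalgam.closureLeRoots`).

If `m` and `n` are powers of `p`, this applies to `A` and `B` directly, since the subgroups of
`p`-power index in a maximal cyclic subgroup of a free group are closed. If `m = 1`, write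
`n = p ^ s * n'` with `n'` prime to `p`. Then `G` is the amalgam of `B` and the group `RootExtension h n'`
obtained from `A` by adjoining an `n'`-th root of `h`, the root being identified with `k ^ p ^ s`. It remains
to see that `RootExtension h n'` is residually a group of integral unitriangular matrices, and that
the root generates a closed subgroup. For the former, a finite `p`-quotient of the root extension lifts
to integral unitriangular matrices (`exists_unitriangular_lift`), because integral unitriangular
matrices close to `1` have `n'`-th roots. Hence residual `p`-finiteness suffices; it is obtained
in `RootExtension.exists_isPOpen_of_isCyclicallyReduced` from actions of the free group which are
twisted along the edges with a given label. The closure of the group generated by the root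
centralizes the root, and nontriviality of reduced products shows that it is not larger than
that group.
-/

set_option autoImplicit false

/-! ### The pro-`p` topology of a group -/

/-- The basic open normal subgroups of the pro-`p` topology: normal subgroups of finite index whose
quotient is a `p`-group, the latter expressed by a uniform exponent. -/
structure IsPOpen (p : ℕ) {G : Type*} [Group G] (N : Subgroup G) : Prop where
  normal : N.Normal
  finiteIndex : N.FiniteIndex
  exists_pow_mem : ∃ k : ℕ, ∀ g : G, g ^ p ^ k ∈ N

/-- `g` lies in the closure of the cyclic subgroup `⟨f⟩` in the pro-`p` topology. -/
def InPClosure (p : ℕ) {G : Type*} [Group G] (f g : G) : Prop :=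
  ∀ N : Subgroup G, IsPOpen p N → ∃ j : ℤ, g⁻¹ * f ^ j ∈ N

/-- `G` is residually a finite `p`-group. -/
def IsResiduallyP (p : ℕ) (G : Type*) [Group G] : Prop :=
  ∀ g : G, g ≠ 1 → ∃ N : Subgroup G, IsPOpen p N ∧ g ∉ N

/-- The pro-`p` closure of every cyclic subgroup of `G` is contained in the set of its roots of
degree prime to `p`. -/
def ClosureLeRoots (p : ℕ) (G : Type*) [Group G] : Prop :=
  ∀ f g : G, InPClosure p f g → ∃ a : ℕ, ¬ p ∣ a ∧ g ^ a ∈ Subgroup.zpowers f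

/-- The cyclic subgroup `⟨u⟩` is closed in the pro-`p` topology. -/
def IsPClosedZPowers (p : ℕ) {G : Type*} [Group G] (u : G) : Prop :=
  ∀ g : G, InPClosure p u g → g ∈ Subgroup.zpowers u

section POpen

variable {p : ℕ} {G H : Type*} [Group G] [Group H]

theorem isPOpen_top : IsPOpen p (⊤ : Subgroup G) :=
  ⟨inferInstance, inferInstance, 0, fun _ => trivial⟩

theorem IsPOpen.pow_mem_of_le {N : Subgroup G} {k l : ℕ} (hk : ∀ g : G, g ^ p ^ k ∈ N)
    (hkl : k ≤ l) (g : G) : g ^ p ^ l ∈ N := by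
  obtain ⟨d, rfl⟩ := Nat.exists_eq_add_of_le hkl
  rw [pow_add, pow_mul]
  exact N.pow_mem (hk g) _

theorem IsPOpen.inf {M N : Subgroup G} (hM : IsPOpen p M) (hN : IsPOpen p N) :
    IsPOpen p (M ⊓ N) := by
  obtain ⟨hM1, hM2, k, hk⟩ := hM
  obtain ⟨hN1, hN2, l, hl⟩ := hN
  exact ⟨inferInstance, inferInstance, max k l, fun g =>
    ⟨IsPOpen.pow_mem_of_le hk (le_max_left _ _) g, IsPOpen.pow_mem_of_le hl (le_max_right _ _) g⟩⟩

theorem IsPOpen.comap {N : Subgroup H} (hN : IsPOpen p N) (ψ : G →* H) : IsPOpen p (N.comap ψ) := by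
  obtain ⟨h1, h2, k, hk⟩ := hN
  refine ⟨inferInstance, ?_, k, fun g => by simpa using hk (ψ g)⟩
  constructor
  rw [Subgroup.index_comap]
  have : N.IsFiniteRelIndex ψ.range := Subgroup.isFiniteRelIndex_of_finiteIndex
  exact Subgroup.IsFiniteRelIndex.relIndex_ne_zero

theorem IsPGroup.exists_uniform_pow (hp : p.Prime) [Finite H] (hH : IsPGroup p H) :
    ∃ k : ℕ, ∀ g : H, g ^ p ^ k = 1 := by
  have := Fact.mk hp
  obtain ⟨k, hk⟩ := IsPGroup.iff_card.1 hH
  exact ⟨k, fun g => by rw [← hk]; exact pow_card_eq_one'⟩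

theorem isPOpen_bot (hp : p.Prime) [Finite H] (hH : IsPGroup p H) : IsPOpen p (⊥ : Subgroup H) := by
  obtain ⟨k, hk⟩ := hH.exists_uniform_pow hp
  exact ⟨inferInstance, inferInstance, k, fun g => by simpa using hk g⟩

theorem isPOpen_ker (hp : p.Prime) [Finite H] (hH : IsPGroup p H) (ψ : G →* H) :
    IsPOpen p ψ.ker := (isPOpen_bot hp hH).comap ψ

theorem IsPOpen.isPGroup_quotient {N : Subgroup G} (hN : IsPOpen p N) [N.Normal] :
    IsPGroup p (G ⧸ N) := by
  obtain ⟨-, -, k, hk⟩ := hN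
  intro g
  induction g using QuotientGroup.induction_on with
  | H g => exact ⟨k, by rw [← QuotientGroup.mk_pow]; exact (QuotientGroup.eq_one_iff _).2 (hk g)⟩

/-- Finitely many properties inherited by smaller subgroups are satisfied by a common open subgroup. -/
theorem exists_isPOpen_forall {ι : Type*} (l : List ι) (S : ι → Subgroup G → Prop)
    (hmono : ∀ i M N, M ≤ N → S i N → S i M) (h : ∀ i ∈ l, ∃ N, IsPOpen p N ∧ S i N) :
    ∃ N, IsPOpen p N ∧ ∀ i ∈ l, S i N := by
  induction l with
  | nil => exact ⟨⊤, isPOpen_top, by simp⟩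
  | cons a l ih =>
    obtain ⟨N, hN, hN'⟩ := ih fun i hi => h i (List.mem_cons_of_mem _ hi)
    obtain ⟨M, hM, hM'⟩ := h a List.mem_cons_self
    refine ⟨M ⊓ N, hM.inf hN, fun i hi => ?_⟩
    rcases List.mem_cons.1 hi with rfl | hi
    · exact hmono _ _ _ inf_le_left hM'
    · exact hmono _ _ _ inf_le_right (hN' i hi)

theorem InPClosure.map {f g : G} (h : InPClosure p f g) (ψ : G →* H) :
    InPClosure p (ψ f) (ψ g) := by
  intro N hN
  obtain ⟨j, hj⟩ := h _ (hN.comap ψ)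
  exact ⟨j, by simpa using hj⟩

theorem InPClosure.conj {f g : G} (h : InPClosure p f g) (c : G) :
    InPClosure p (c * f * c⁻¹) (c * g * c⁻¹) := by
  simpa using h.map (MulAut.conj c).toMonoidHom

/-- In a residually `p` group the closure of `⟨f⟩` centralizes `f`. -/
theorem InPClosure.commute (hG : IsResiduallyP p G) {f g : G} (h : InPClosure p f g) :
    Commute g f := by
  by_contra hne
  have h1 : g * f * g⁻¹ * f⁻¹ ≠ 1 := by
    intro h1
    apply hne
    show g * f = f * g
    rwa [mul_inv_eq_one, mul_inv_eq_iff_eq_mul] at h1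
  obtain ⟨N, hN, hgN⟩ := hG _ h1
  obtain ⟨j, hj⟩ := h N hN
  have := hN.normal
  apply hgN
  have hq : (g : G ⧸ N) = (f : G ⧸ N) ^ j := by
    rw [← QuotientGroup.mk_zpow]; exact QuotientGroup.eq.2 hj
  rw [← QuotientGroup.eq_one_iff]
  rw [QuotientGroup.mk_mul, QuotientGroup.mk_mul, QuotientGroup.mk_mul, QuotientGroup.mk_inv,
    QuotientGroup.mk_inv, hq]
  group

theorem ClosureLeRoots.conj_iff {f g c : G} :
    (∃ a : ℕ, ¬ p ∣ a ∧ (c * g * c⁻¹) ^ a ∈ Subgroup.zpowers (c * f * c⁻¹)) ↔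
      ∃ a : ℕ, ¬ p ∣ a ∧ g ^ a ∈ Subgroup.zpowers f := by
  simp only [conj_pow, Subgroup.mem_zpowers_iff, conj_zpow]
  simp

theorem IsResiduallyP.of_conj {g c : G} (h : ∃ N : Subgroup G, IsPOpen p N ∧ c * g * c⁻¹ ∉ N) :
    ∃ N : Subgroup G, IsPOpen p N ∧ g ∉ N := by
  obtain ⟨N, hN, h⟩ := h
  exact ⟨N, hN, fun hg => h (hN.normal.conj_mem _ hg _)⟩

theorem exists_isPOpen_of_not_inPClosure {u g : G} (hu : IsPClosedZPowers p u)
    (hg : g ∉ Subgroup.zpowers u) : ∃ N, IsPOpen p N ∧ ∀ j : ℤ, g⁻¹ * u ^ j ∉ N := by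
  by_contra hcon
  push Not at hcon
  exact hg (hu g hcon)

end POpen

/-! ### Unitriangular groups -/

section Unitriangular

/-- The group of upper unitriangular `d × d` matrices over `R`. -/
def Unitriangular (d : ℕ) (R : Type*) [CommRing R] : Subgroup (Matrix (Fin d) (Fin d) R)ˣ where
  carrier := {M | ∀ i j, j ≤ i → (M : Matrix (Fin d) (Fin d) R) i j =
    (1 : Matrix (Fin d) (Fin d) R) i j}
  one_mem' := fun _ _ _ => rfl
  mul_mem' := by
    intro M N hM hN i j hij
    rw [Units.val_mul, Matrix.mul_apply]
    rw [Finset.sum_eq_single i]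
    · rw [hM i i le_rfl, hN i j hij]; simp
    · intro k _ hk
      rcases lt_or_gt_of_ne hk with hk | hk
      · rw [hM i k hk.le, Matrix.one_apply_ne hk.ne', zero_mul]
      · rw [hN k j (hij.trans hk.le), Matrix.one_apply_ne (hij.trans_lt hk).ne', mul_zero]
    · simp
  inv_mem' := by
    intro M hM i j hij
    have hM' : (M : Matrix (Fin d) (Fin d) R).BlockTriangular id := by
      intro a b hab
      have hab' : b < a := hab
      rw [hM a b hab'.le, Matrix.one_apply_ne hab'.ne']
    have : Invertible (M : Matrix (Fin d) (Fin d) R) := M.invertible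
    have hN : ((M⁻¹ : (Matrix (Fin d) (Fin d) R)ˣ) : Matrix (Fin d) (Fin d) R).BlockTriangular id := by
      rw [Matrix.coe_units_inv]
      exact Matrix.blockTriangular_inv_of_blockTriangular hM'
    rcases hij.eq_or_lt with rfl | hij
    · have h1 := congrFun (congrFun M.mul_inv j) j
      rw [Matrix.mul_apply, Finset.sum_eq_single j] at h1
      · rwa [hM j j le_rfl, Matrix.one_apply_eq, one_mul, ← Matrix.one_apply_eq j] at h1
      · intro k _ hk
        rcases lt_or_gt_of_ne hk with hk | hk
        · rw [hM j k hk.le, Matrix.one_apply_ne hk.ne', zero_mul]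
        · rw [hN hk, mul_zero]
      · simp
    · rw [hN hij, Matrix.one_apply_ne hij.ne']

namespace Unitriangular

variable {d : ℕ} {R S : Type*} [CommRing R] [CommRing S]

/-- The underlying matrix of an element of the unitriangular group. -/
def mat (g : Unitriangular d R) : Matrix (Fin d) (Fin d) R :=
  ((g : (Matrix (Fin d) (Fin d) R)ˣ) : Matrix (Fin d) (Fin d) R)

theorem mat_injective : Function.Injective (mat : Unitriangular d R → _) := fun _ _ h =>
  Subtype.ext (Units.ext h)

@[simp] theorem mat_one : mat (1 : Unitriangular d R) = 1 := rfl

@[simp] theorem mat_mul (g h : Unitriangular d R) : mat (g * h) = mat g * mat h := rfl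

@[simp] theorem mat_pow (g : Unitriangular d R) (n : ℕ) : mat (g ^ n) = mat g ^ n := rfl

theorem mat_of_le (g : Unitriangular d R) {i j : Fin d} (h : j ≤ i) :
    mat g i j = (1 : Matrix (Fin d) (Fin d) R) i j := g.2 i j h

/-- Strictly upper triangular matrices. -/
def IsStrict (X : Matrix (Fin d) (Fin d) R) : Prop := ∀ i j, j ≤ i → X i j = 0

/-- The element `1 + X` for a strictly upper triangular matrix `X`. -/
noncomputable def ofStrict (X : Matrix (Fin d) (Fin d) R) (hX : IsStrict X) : Unitriangular d R :=
  ⟨Matrix.GeneralLinearGroup.mk'' (1 + X) (by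
    rw [Matrix.det_of_isUpperTriangular]
    · simp [hX _ _ le_rfl]
    · intro i j hij
      have hij' : j < i := hij
      rw [Matrix.add_apply, hX i j hij'.le, Matrix.one_apply_ne hij'.ne', add_zero]),
    fun i j hij => by
      show (1 + X) i j = _
      rw [Matrix.add_apply, hX i j hij, add_zero]⟩

@[simp] theorem mat_ofStrict (X : Matrix (Fin d) (Fin d) R) (hX : IsStrict X) :
    mat (ofStrict X hX) = 1 + X := rfl

theorem isStrict_mat_sub_one (g : Unitriangular d R) : IsStrict (mat g - 1) := by
  intro i j h
  rw [Matrix.sub_apply, mat_of_le g h, sub_self]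

/-- Reduction of coefficients along a ring homomorphism. -/
def map (φ : R →+* S) : Unitriangular d R →* Unitriangular d S :=
  ((Units.map (φ.mapMatrix : Matrix (Fin d) (Fin d) R →+* Matrix (Fin d) (Fin d) S).toMonoidHom).comp
    (Unitriangular d R).subtype).codRestrict _ (by
      intro g i j h
      show φ (mat g i j) = _
      rw [mat_of_le g h, Matrix.one_apply, Matrix.one_apply]
      split_ifs <;> simp)

@[simp] theorem mat_map (φ : R →+* S) (g : Unitriangular d R) (i j : Fin d) :
    mat (map φ g) i j = φ (mat g i j) := rfl

/-- The terms of the lower central filtration: the first `r - 1` superdiagonals vanish. -/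
def InLayer (r : ℕ) (g : Unitriangular d R) : Prop :=
  ∀ i j : Fin d, i < j → (j : ℕ) < i + r → mat g i j = 0

theorem inLayer_one_left (g : Unitriangular d R) : InLayer 1 g := by
  intro i j h h'
  have : (i : ℕ) < j := h
  omega

theorem mat_mul_apply_of_inLayer {r : ℕ} {g h : Unitriangular d R} (hg : InLayer r g)
    {i j : Fin d} (hij : i < j) (hr : (j : ℕ) ≤ i + r) :
    mat (g * h) i j = mat g i j + mat h i j := by
  have hij' : (i : ℕ) < j := hij
  rw [mat_mul, Matrix.mul_apply, Finset.sum_eq_add i j hij.ne]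
  · rw [mat_of_le g le_rfl, mat_of_le h le_rfl]
    simp [add_comm]
  · rintro k - ⟨hki, hkj⟩
    rcases lt_or_gt_of_ne hki with hk | hk
    · rw [mat_of_le g hk.le, Matrix.one_apply_ne hk.ne', zero_mul]
    rcases lt_or_gt_of_ne hkj with hk' | hk'
    · have hk'' : (k : ℕ) < j := hk'
      rw [hg i k hk (by omega), zero_mul]
    · rw [mat_of_le h hk'.le, Matrix.one_apply_ne hk'.ne', mul_zero]
  · simp
  · simp

theorem InLayer.mul {r : ℕ} {g h : Unitriangular d R} (hg : InLayer r g) (hh : InLayer r h) :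
    InLayer r (g * h) := by
  intro i j hij hr
  rw [mat_mul_apply_of_inLayer hg hij hr.le, hg i j hij hr, hh i j hij hr, add_zero]

theorem inLayer_one (r : ℕ) : InLayer r (1 : Unitriangular d R) := by
  intro i j hij _
  rw [mat_one, Matrix.one_apply_ne hij.ne]

theorem InLayer.pow {r : ℕ} {g : Unitriangular d R} (hg : InLayer r g) (n : ℕ) :
    InLayer r (g ^ n) := by
  induction n with
  | zero => simpa using inLayer_one r
  | succ n ih => rw [pow_succ]; exact ih.mul hg

theorem mat_pow_apply_of_inLayer {r : ℕ} {g : Unitriangular d R} (hg : InLayer r g)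
    {i j : Fin d} (hij : i < j) (hr : (j : ℕ) ≤ i + r) (n : ℕ) :
    mat (g ^ n) i j = n * mat g i j := by
  induction n with
  | zero => simp [Matrix.one_apply_ne hij.ne]
  | succ n ih =>
    rw [pow_succ, mat_mul_apply_of_inLayer (hg.pow n) hij hr, ih]
    push_cast; ring

theorem InLayer.inv {r : ℕ} {g : Unitriangular d R} (hg : InLayer r g) : InLayer r g⁻¹ := by
  induction r with
  | zero => intro i j hij h; have : (i : ℕ) < j := hij; omega
  | succ r ih =>
    have hgr : InLayer r g := fun i j hij h => hg i j hij (by omega)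
    intro i j hij h
    have h1 := mat_mul_apply_of_inLayer (h := g⁻¹) hgr hij (by omega)
    rw [mul_inv_cancel, mat_one, Matrix.one_apply_ne hij.ne, hg i j hij h, zero_add] at h1
    exact h1.symm

theorem InLayer.zpow {r : ℕ} {g : Unitriangular d R} (hg : InLayer r g) (n : ℤ) :
    InLayer r (g ^ n) := by
  rcases n.eq_nat_or_neg with ⟨n, rfl | rfl⟩
  · rw [zpow_natCast]; exact hg.pow n
  · rw [zpow_neg, zpow_natCast]; exact (hg.pow n).inv

theorem mat_zpow_apply_of_inLayer {r : ℕ} {g : Unitriangular d R} (hg : InLayer r g)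
    {i j : Fin d} (hij : i < j) (hr : (j : ℕ) ≤ i + r) (n : ℤ) :
    mat (g ^ n) i j = n * mat g i j := by
  rcases n.eq_nat_or_neg with ⟨n, rfl | rfl⟩
  · rw [zpow_natCast, mat_pow_apply_of_inLayer hg hij hr, Int.cast_natCast]
  · have h1 := mat_mul_apply_of_inLayer (h := (g ^ n)⁻¹) (hg.pow n) hij hr
    rw [mul_inv_cancel, mat_one, Matrix.one_apply_ne hij.ne,
      mat_pow_apply_of_inLayer hg hij hr] at h1
    rw [zpow_neg, zpow_natCast]
    push_cast
    linear_combination -h1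

theorem eq_one_of_inLayer {r : ℕ} (hr : d ≤ r) {g : Unitriangular d R} (hg : InLayer r g) :
    g = 1 := by
  apply mat_injective
  ext i j
  rcases lt_or_ge i j with hij | hij
  · rw [hg i j hij (by omega), mat_one, Matrix.one_apply_ne hij.ne]
  · exact mat_of_le g hij

/-- A nontrivial element has a first nonvanishing superdiagonal. -/
theorem exists_inLayer_of_ne_one {g : Unitriangular d R} (hg : g ≠ 1) :
    ∃ (r : ℕ) (i j : Fin d), 0 < r ∧ i < j ∧ (j : ℕ) ≤ i + r ∧ InLayer r g ∧ mat g i j ≠ 0 := by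
  classical
  by_contra hcon
  push Not at hcon
  have hall : ∀ r, InLayer (r + 1) g := by
    intro r
    induction r with
    | zero => exact inLayer_one_left g
    | succ r ih =>
      intro i j hij h
      exact hcon (r + 1) i j (by omega) hij (by omega) ih
  exact hg (eq_one_of_inLayer (Nat.le_succ d) (hall d))

/-- In the first layer an element meets, conjugation acts trivially. -/
theorem mat_conj_apply_of_inLayer {r : ℕ} {g : Unitriangular d R} (hg : InLayer r g)
    (c : Unitriangular d R) {i j : Fin d} (hr : (j : ℕ) ≤ i + r) :
    mat (c * g * c⁻¹) i j = mat g i j := by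
  have hX : ∀ a b : Fin d, (b : ℕ) < a + r → (mat g - 1) a b = 0 := by
    intro a b hab
    rcases lt_or_ge a b with h | h
    · rw [Matrix.sub_apply, hg a b h hab, Matrix.one_apply_ne h.ne, sub_zero]
    · exact isStrict_mat_sub_one g a b h
  have hL : ∀ a b : Fin d, (b : ℕ) ≤ a + r → (mat c * (mat g - 1)) a b = (mat g - 1) a b := by
    intro a b hab
    rw [Matrix.mul_apply, Finset.sum_eq_single a]
    · rw [mat_of_le c le_rfl, Matrix.one_apply_eq, one_mul]
    · intro k _ hk
      rcases lt_or_gt_of_ne hk with h | h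
      · rw [mat_of_le c h.le, Matrix.one_apply_ne h.ne', zero_mul]
      · have h' : (a : ℕ) < k := h
        rw [hX k b (by omega), mul_zero]
    · simp
  have hR : (mat c * (mat g - 1) * mat c⁻¹) i j = (mat c * (mat g - 1)) i j := by
    rw [Matrix.mul_apply, Finset.sum_eq_single j]
    · rw [mat_of_le c⁻¹ le_rfl, Matrix.one_apply_eq, mul_one]
    · intro k _ hk
      rcases lt_or_gt_of_ne hk with h | h
      · have h' : (k : ℕ) < j := h
        rw [hL i k (by omega), hX i k (by omega), zero_mul]
      · rw [mat_of_le c⁻¹ h.le, Matrix.one_apply_ne h.ne', mul_zero]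
    · simp
  have hc : mat c * mat c⁻¹ = 1 := by rw [← mat_mul, mul_inv_cancel, mat_one]
  have h1 : mat (c * g * c⁻¹) = 1 + mat c * (mat g - 1) * mat c⁻¹ := by
    rw [mat_mul, mat_mul, mul_sub, sub_mul, mul_one, hc]; abel
  rw [h1, Matrix.add_apply, hR, hL i j hr, Matrix.sub_apply, add_sub_cancel]

section ZModPow

variable {p : ℕ}

theorem isPGroup_zmod_pow (p M : ℕ) : IsPGroup p (Unitriangular d (ZMod (p ^ M))) := by
  have key : ∀ r (g : Unitriangular d (ZMod (p ^ M))), InLayer (r + 1) (g ^ p ^ (M * r)) := by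
    intro r g
    induction r with
    | zero => exact inLayer_one_left _
    | succ r ih =>
      rw [Nat.mul_succ, pow_add, pow_mul]
      intro i j hij h
      rw [mat_pow_apply_of_inLayer ih hij (by omega), ZMod.natCast_self, zero_mul]
  intro g
  exact ⟨M * d, eq_one_of_inLayer (Nat.le_succ d) (key d g)⟩

end ZModPow

end Unitriangular

end Unitriangular

/-! ### Closures of cyclic subgroups in groups with unitriangular representations -/

section RootsFromUnitriangular

variable {p : ℕ} {G : Type*} [Group G]

theorem Int.exists_mul_eq_mul_of_dvd {β γ : ℤ} {ν : ℕ} {β' : ℤ}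
    (hβ : β = p ^ ν * β') (hβ' : ¬ (p : ℤ) ∣ β') (h : ∃ n : ℤ, (p : ℤ) ^ ν ∣ γ - n * β) :
    ∃ (a : ℕ) (b : ℤ), ¬ p ∣ a ∧ a * γ = b * β := by
  obtain ⟨n, m, hm⟩ := h
  refine ⟨β'.natAbs, β'.sign * (m + n * β'), fun h => hβ' (Int.natCast_dvd.2 h), ?_⟩
  rw [Int.natCast_natAbs, ← Int.sign_mul_self_eq_abs, hβ]
  rw [hβ] at hm
  linear_combination β'.sign * β' * hm

/-- If a power of `f` has nontrivial image under a `p`-adically continuous homomorphism from an open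
subgroup to an integral unitriangular group, then the closure of `⟨f⟩` consists of roots of elements
of `⟨f⟩`. An element `g` of the closure behaves like `f ^ z` for a `p`-adic integer `z`; the first
nonzero superdiagonal of the image of `f` shows that `z` is a quotient of two integers. -/
theorem exists_pow_mem_zpowers_of_unitriangular (hp : p.Prime) (hG : IsResiduallyP p G) {d : ℕ}
    (L : Subgroup G) (θ : L →* Unitriangular d ℤ) (e : ℕ) (hL : ∀ g : G, g ^ p ^ e ∈ L)
    (hcont : ∀ M : ℕ, ∃ N : Subgroup G, IsPOpen p N ∧ ∀ x : L, (x : G) ∈ N →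
      Unitriangular.map (Int.castRingHom (ZMod (p ^ M))) (θ x) = 1)
    {f g : G} (hf : θ ⟨f ^ p ^ e, hL f⟩ ≠ 1) (h : InPClosure p f g) :
    ∃ a : ℕ, ¬ p ∣ a ∧ g ^ a ∈ Subgroup.zpowers f := by
  have hpZ : Prime (p : ℤ) := Nat.prime_iff_prime_int.1 hp
  obtain ⟨r, i, j, -, hij, hjr, hlay, hne⟩ := Unitriangular.exists_inLayer_of_ne_one hf
  set F := θ ⟨f ^ p ^ e, hL f⟩ with hF
  set E := θ ⟨g ^ p ^ e, hL g⟩ with hE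
  set β := Unitriangular.mat F i j with hβ
  set γ := Unitriangular.mat E i j with hγ
  -- The entry of the image of `f ^ n` at the place `(i, j)` is `n * β`.
  have key : ∀ (M : ℕ) (N : Subgroup G), IsPOpen p N →
      ∃ n : ℤ, g⁻¹ * f ^ n ∈ N ∧ (p : ℤ) ^ M ∣ γ - n * β := by
    intro M N hN
    obtain ⟨N', hN', hN'θ⟩ := hcont M
    obtain ⟨n, hn⟩ := h (N ⊓ N') (hN.inf hN')
    refine ⟨n, hn.1, ?_⟩
    have := hN'.normal
    have hq : ((g : G) : G ⧸ N') = (f : G ⧸ N') ^ n := by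
      rw [← QuotientGroup.mk_zpow]; exact QuotientGroup.eq.2 hn.2
    have hmem : (g ^ p ^ e)⁻¹ * (f ^ p ^ e) ^ n ∈ N' := by
      rw [← QuotientGroup.eq, QuotientGroup.mk_pow, QuotientGroup.mk_zpow, QuotientGroup.mk_pow, hq,
        ← zpow_natCast, ← zpow_natCast, ← zpow_mul, ← zpow_mul, mul_comm]
    have h1 := hN'θ ((⟨g ^ p ^ e, hL g⟩ : L)⁻¹ * (⟨f ^ p ^ e, hL f⟩ : L) ^ n) (by simpa using hmem)
    rw [map_mul, map_inv, map_zpow, map_mul, map_inv, inv_mul_eq_one] at h1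
    have h2 := congrFun (congrFun (congrArg Unitriangular.mat h1) i) j
    rw [Unitriangular.mat_map, Unitriangular.mat_map,
      Unitriangular.mat_zpow_apply_of_inLayer hlay hij hjr] at h2
    have h3 := (ZMod.intCast_eq_intCast_iff_dvd_sub _ _ _).1 h2.symm
    exact_mod_cast h3
  obtain ⟨β', hββ', hβ'⟩ :=
    (Int.finiteMultiplicity_iff.2 ⟨by simpa using hp.ne_one, hne⟩ :
      FiniteMultiplicity (p : ℤ) β).exists_eq_pow_mul_and_not_dvd
  set ν := multiplicity (p : ℤ) β
  -- Hence `γ / β` has no `p` in the denominator, and `g ^ a = f ^ b` with `a` its denominator.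
  obtain ⟨n₀, -, hn₀⟩ := key ν ⊤ isPOpen_top
  obtain ⟨a, b, ha, hab⟩ := Int.exists_mul_eq_mul_of_dvd hββ' hβ' ⟨n₀, hn₀⟩
  refine ⟨a, ha, b, ?_⟩
  by_contra hcon
  obtain ⟨N, hN, hmem⟩ := hG ((f ^ b)⁻¹ * g ^ a) (fun h => hcon (inv_mul_eq_one.1 h))
  obtain ⟨k, hk⟩ := hN.exists_pow_mem
  obtain ⟨n, hn, m, hm⟩ := key (ν + k) N hN
  have hdvd : (p : ℤ) ^ k ∣ b - a * n := by
    have h1 : (b - a * n) * β' = p ^ k * (a * m) := by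
      have h0 : (p : ℤ) ^ ν ≠ 0 := pow_ne_zero _ hpZ.ne_zero
      apply mul_left_cancel₀ h0
      rw [pow_add] at hm
      rw [hββ'] at hm hab
      linear_combination (a : ℤ) * hm - hab
    exact (hpZ.pow_dvd_of_dvd_mul_right k hβ' ⟨_, h1⟩)
  apply hmem
  have := hN.normal
  have hq : ((g : G) : G ⧸ N) = (f : G ⧸ N) ^ n := by
    rw [← QuotientGroup.mk_zpow]; exact QuotientGroup.eq.2 hn
  have hfk : (f : G ⧸ N) ^ (p ^ k : ℕ) = 1 := by
    rw [← QuotientGroup.mk_pow]; exact (QuotientGroup.eq_one_iff _).2 (hk f)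
  obtain ⟨t, ht⟩ := hdvd
  rw [← QuotientGroup.eq, QuotientGroup.mk_zpow, QuotientGroup.mk_pow, hq, ← zpow_natCast,
    ← zpow_mul, show b = n * a + ((p ^ k : ℕ) : ℤ) * t by push_cast; linear_combination ht, zpow_add,
    zpow_mul _ ((p ^ k : ℕ) : ℤ), zpow_natCast, hfk, one_zpow, mul_one]

end RootsFromUnitriangular

/-! ### Words in unitriangular groups and free groups -/

section Words

/-- If no two consecutive letters of the word `c 0, …, c (l - 1)` agree, then there are
unitriangular matrices `τ` such that the corner entry of `∏ τ (c i) ^ k i` is `∏ k i`, whatever the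
exponents. -/
theorem Unitriangular.exists_corner_eq_prod {I : Type*} (l : ℕ) (c : ℕ → I)
    (hc : ∀ i, i + 1 < l → c i ≠ c (i + 1)) :
    ∃ τ : I → Unitriangular (l + 1) ℤ, ∀ k : ℕ → ℤ,
      Unitriangular.mat ((List.range l).map fun i => τ (c i) ^ k i).prod 0 (Fin.last l) =
        ∏ i ∈ Finset.range l, k i := by
  classical
  let X : I → Matrix (Fin (l + 1)) (Fin (l + 1)) ℤ := fun a i j =>
    if (j : ℕ) = i + 1 ∧ c i = a then 1 else 0
  -- `X a` has its entries just above the diagonal, in the rows `i` with `c i = a`; no two of these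
  -- rows are consecutive, whence `X a * X a = 0` and `(1 + X a) ^ k = 1 + k • X a`.
  have hX : ∀ a (k : ℤ), IsStrict (k • X a) := by
    intro a k i j hij
    have hij' : (j : ℕ) ≤ i := hij
    rw [Matrix.smul_apply]
    simp only [X]
    rw [if_neg (by omega), smul_zero]
  have hXX : ∀ a, X a * X a = 0 := by
    intro a
    ext i j
    rw [Matrix.mul_apply, Matrix.zero_apply]
    apply Finset.sum_eq_zero
    intro k _
    simp only [X]
    by_contra hne
    obtain ⟨h1, h2⟩ := mul_ne_zero_iff.1 hne
    obtain ⟨h1, h1'⟩ := (ite_ne_right_iff.1 h1).1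
    obtain ⟨h2, h2'⟩ := (ite_ne_right_iff.1 h2).1
    have := hc i (by omega)
    rw [← h1] at this
    exact this (h1'.trans h2'.symm)
  let φ : I → Multiplicative ℤ →* Unitriangular (l + 1) ℤ := fun a => MonoidHom.mk'
    (fun k => ofStrict (k.toAdd • X a) (hX a _)) (by
      intro k k'
      apply mat_injective
      rw [mat_mul, mat_ofStrict, mat_ofStrict, mat_ofStrict, toAdd_mul, mul_add, add_mul, add_mul,
        mul_one, one_mul, mul_one, smul_mul_smul_comm, hXX, smul_zero, add_smul]
      abel)
  have hφ : ∀ a (k : ℤ), mat (φ a (Multiplicative.ofAdd 1) ^ k) = 1 + k • X a := by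
    intro a k
    rw [← map_zpow, ← ofAdd_zsmul, smul_eq_mul, mul_one]
    rfl
  refine ⟨fun a => φ a (Multiplicative.ofAdd 1), fun k => ?_⟩
  have key : ∀ m ≤ l, ∀ j : Fin (l + 1), m ≤ (j : ℕ) →
      mat ((List.range m).map fun i => φ (c i) (Multiplicative.ofAdd 1) ^ k i).prod 0 j =
        if (j : ℕ) = m then ∏ i ∈ Finset.range m, k i else 0 := by
    intro m
    induction m with
    | zero =>
      intro _ j _
      simp only [List.range_zero, List.map_nil, List.prod_nil, mat_one, Finset.range_zero,
        Finset.prod_empty, Matrix.one_apply]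
      congr 1
      rw [Fin.ext_iff]
      simp [eq_comm]
    | succ m ih =>
      intro hm j hj
      rw [List.range_succ, List.map_append, List.prod_append, List.map_singleton,
        List.prod_singleton, mat_mul, hφ, mul_add, mul_one, Matrix.add_apply,
        ih (by omega) j (by omega), if_neg (by omega), zero_add, Matrix.mul_apply,
        Finset.sum_eq_single (⟨j - 1, by omega⟩ : Fin (l + 1))]
      · rw [ih (by omega) _ (by simp; omega), Finset.prod_range_succ, Matrix.smul_apply]
        simp only [X]
        by_cases h : (j : ℕ) = m + 1
        · rw [if_pos (by omega), if_pos h, if_pos ⟨by omega, by congr 1; omega⟩]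
          simp
        · rw [if_neg (by omega), if_neg h, zero_mul]
      · intro b _ hb
        rw [Matrix.smul_apply]
        simp only [X]
        rw [if_neg, smul_zero, mul_zero]
        rintro ⟨h, -⟩
        exact hb (Fin.ext (by simp; omega))
      · simp
  rw [key l le_rfl _ (by simp)]
  simp

/-- A word with nonzero exponents in which no two consecutive letters agree can be evaluated to a
nontrivial integral unitriangular matrix. -/
theorem Unitriangular.exists_prod_ne_one {I : Type*} (L : List (I × ℤ)) (hL : L ≠ [])
    (hc : L.IsChain fun x y => x.1 ≠ y.1) (h0 : ∀ x ∈ L, x.2 ≠ 0) :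
    ∃ (d : ℕ) (τ : I → Unitriangular d ℤ), (L.map fun x => τ x.1 ^ x.2).prod ≠ 1 := by
  obtain ⟨τ, hτ⟩ := Unitriangular.exists_corner_eq_prod L.length
    (fun i => (L.getD i (L.head hL)).1) (fun i hi => by
      rw [List.isChain_iff_getElem] at hc
      have := hc i hi
      rwa [List.getD_eq_getElem _ _ hi, List.getD_eq_getElem _ _ (Nat.lt_of_succ_lt hi)])
  refine ⟨_, τ, fun h => ?_⟩
  have h1 := hτ fun i => (L.getD i (L.head hL)).2
  have h2 : ((List.range L.length).map fun i =>
      τ (L.getD i (L.head hL)).1 ^ (L.getD i (L.head hL)).2) = L.map fun x => τ x.1 ^ x.2 := by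
    apply List.ext_getElem
    · simp
    · intro i hi hi'
      simp only [List.length_map] at hi'
      rw [List.getElem_map, List.getElem_map, List.getElem_range, List.getD_eq_getElem _ _ hi']
  rw [h2, h, Unitriangular.mat_one, Matrix.one_apply_ne] at h1
  · refine Finset.prod_ne_zero_iff.2 (fun i hi => ?_) h1.symm
    rw [List.getD_eq_getElem _ _ (Finset.mem_range.1 hi)]
    exact h0 _ (List.getElem_mem _)
  · rw [Ne, Fin.ext_iff]
    simpa [eq_comm] using List.length_pos_iff.2 hL |>.ne'

theorem FreeGroup.exists_syllables {S : Type*} (w : FreeGroup S) :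
    ∃ L : List (S × ℤ), (L.IsChain fun x y => x.1 ≠ y.1) ∧ (∀ x ∈ L, x.2 ≠ 0) ∧
      w = (L.map fun x => FreeGroup.of x.1 ^ x.2).prod := by
  classical
  have step : ∀ (s : S) (ε : ℤ), ε ≠ 0 → ∀ w : FreeGroup S,
      (∃ L : List (S × ℤ), (L.IsChain fun x y => x.1 ≠ y.1) ∧ (∀ x ∈ L, x.2 ≠ 0) ∧
        w = (L.map fun x => FreeGroup.of x.1 ^ x.2).prod) →
      ∃ L : List (S × ℤ), (L.IsChain fun x y => x.1 ≠ y.1) ∧ (∀ x ∈ L, x.2 ≠ 0) ∧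
        FreeGroup.of s ^ ε * w = (L.map fun x => FreeGroup.of x.1 ^ x.2).prod := by
    rintro s ε hε w ⟨L, hc, h0, rfl⟩
    rcases L with _ | ⟨⟨t, k⟩, L⟩
    · exact ⟨[(s, ε)], by simp, by simpa using hε, by simp⟩
    by_cases hst : s = t
    · subst hst
      by_cases hk : ε + k = 0
      · refine ⟨L, hc.tail, fun x hx => h0 x (List.mem_cons_of_mem _ hx), ?_⟩
        rw [List.map_cons, List.prod_cons, ← mul_assoc, ← zpow_add, hk, zpow_zero, one_mul]
      · refine ⟨(s, ε + k) :: L, ?_, ?_, ?_⟩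
        · cases L with
          | nil => simp
          | cons y L => simpa using hc
        · intro x hx
          rcases List.mem_cons.1 hx with rfl | hx
          · exact hk
          · exact h0 x (List.mem_cons_of_mem _ hx)
        · rw [List.map_cons, List.prod_cons, List.map_cons, List.prod_cons, ← mul_assoc, ← zpow_add]
    · refine ⟨(s, ε) :: (t, k) :: L, List.IsChain.cons_cons hst hc, ?_, by simp⟩
      intro x hx
      rcases List.mem_cons.1 hx with rfl | hx
      · exact hε
      · exact h0 x hx
  induction w using FreeGroup.induction_on with
  | C1 => exact ⟨[], by simp, by simp, by simp⟩
  | of s => simpa using step s 1 one_ne_zero 1 ⟨[], by simp, by simp, by simp⟩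
  | inv_of s _ => simpa using step s (-1) (by simp) 1 ⟨[], by simp, by simp, by simp⟩
  | mul x y hx hy =>
    obtain ⟨L, -, h0, rfl⟩ := hx
    induction L with
    | nil => simpa using hy
    | cons a L ih =>
      rw [List.map_cons, List.prod_cons, mul_assoc]
      exact step _ _ (h0 a List.mem_cons_self) _ (ih fun x hx => h0 x (List.mem_cons_of_mem _ hx))

/-- Free groups are residually torsion-free nilpotent, through integral unitriangular matrices. -/
theorem IsFreeGroup.exists_unitriangular_ne_one {A : Type*} [Group A] [IsFreeGroup A] {w : A}
    (hw : w ≠ 1) : ∃ (d : ℕ) (θ : A →* Unitriangular d ℤ), θ w ≠ 1 := by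
  obtain ⟨L, hc, h0, hL⟩ := FreeGroup.exists_syllables (IsFreeGroup.toFreeGroup A w)
  have hne : L ≠ [] := by
    rintro rfl
    exact hw ((IsFreeGroup.toFreeGroup A).injective (by simpa using hL))
  obtain ⟨d, τ, hτ⟩ := Unitriangular.exists_prod_ne_one L hne hc h0
  refine ⟨d, (FreeGroup.lift τ).comp (IsFreeGroup.toFreeGroup A).toMonoidHom, ?_⟩
  intro h
  apply hτ
  rw [← h]
  show _ = FreeGroup.lift τ (IsFreeGroup.toFreeGroup A w)
  rw [hL, map_list_prod, List.map_map]
  congr 1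
  apply List.map_congr_left
  intro x _
  simp

end Words

/-! ### Residually unitriangular groups -/

section ResiduallyUnitriangular

variable {p : ℕ} {G : Type*} [Group G]

theorem Unitriangular.isPOpen_ker_map (hp : p.Prime) {d : ℕ} (θ : G →* Unitriangular d ℤ) (M : ℕ) :
    IsPOpen p ((Unitriangular.map (Int.castRingHom (ZMod (p ^ M)))).comp θ).ker := by
  have : NeZero (p ^ M) := ⟨pow_ne_zero _ hp.ne_zero⟩
  exact isPOpen_ker hp (Unitriangular.isPGroup_zmod_pow p M) _

theorem Unitriangular.exists_map_ne_one (hp : p.Prime) {d : ℕ} {g : Unitriangular d ℤ} (hg : g ≠ 1) :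
    ∃ M : ℕ, Unitriangular.map (Int.castRingHom (ZMod (p ^ M))) g ≠ 1 := by
  by_contra hcon
  push Not at hcon
  apply hg
  apply Unitriangular.mat_injective
  ext i j
  rw [← sub_eq_zero]
  by_contra hne
  obtain ⟨M, hM⟩ := (Int.finiteMultiplicity_iff.2 ⟨by simpa using hp.ne_one, hne⟩ :
      FiniteMultiplicity (p : ℤ) _)
  apply hM
  have h1 := congrFun (congrFun (congrArg Unitriangular.mat (hcon (M + 1))) i) j
  rw [← map_one (Unitriangular.map (Int.castRingHom (ZMod (p ^ (M + 1))))), Unitriangular.mat_map,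
    Unitriangular.mat_map] at h1
  have h2 := (ZMod.intCast_eq_intCast_iff_dvd_sub _ _ _).1 h1.symm
  exact_mod_cast h2

theorem isResiduallyP_of_unitriangular (hp : p.Prime)
    (h : ∀ g : G, g ≠ 1 → ∃ (d : ℕ) (θ : G →* Unitriangular d ℤ), θ g ≠ 1) :
    IsResiduallyP p G := by
  intro g hg
  obtain ⟨d, θ, hθ⟩ := h g hg
  obtain ⟨M, hM⟩ := Unitriangular.exists_map_ne_one hp hθ
  exact ⟨_, Unitriangular.isPOpen_ker_map hp θ M, hM⟩

/-- In a residually unitriangular group, the closure of a cyclic subgroup consists of roots of its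
elements. -/
theorem closureLeRoots_of_unitriangular (hp : p.Prime)
    (h : ∀ g : G, g ≠ 1 → ∃ (d : ℕ) (θ : G →* Unitriangular d ℤ), θ g ≠ 1) :
    ClosureLeRoots p G := by
  have hG := isResiduallyP_of_unitriangular hp h
  intro f g hfg
  by_cases hf : f = 1
  · refine ⟨1, hp.one_lt.not_ge ∘ Nat.le_of_dvd one_pos, ?_⟩
    rw [hf, Subgroup.zpowers_one_eq_bot, Subgroup.mem_bot, pow_one]
    by_contra hg
    obtain ⟨N, hN, hgN⟩ := hG g hg
    obtain ⟨j, hj⟩ := hfg N hN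
    rw [hf, one_zpow, mul_one, inv_mem_iff] at hj
    exact hgN hj
  · obtain ⟨d, θ, hθ⟩ := h f hf
    refine exists_pow_mem_zpowers_of_unitriangular hp hG ⊤ (θ.comp (⊤ : Subgroup G).subtype) 0
      (fun _ => trivial) (fun M => ⟨_, Unitriangular.isPOpen_ker_map hp θ M, ?_⟩) (by simpa using hθ)
      hfg
    intro x hx
    exact hx

theorem pow_ne_one_of_unitriangular
    (h : ∀ g : G, g ≠ 1 → ∃ (d : ℕ) (θ : G →* Unitriangular d ℤ), θ g ≠ 1) {g : G} (hg : g ≠ 1)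
    {n : ℕ} (hn : n ≠ 0) : g ^ n ≠ 1 := by
  obtain ⟨d, θ, hθ⟩ := h g hg
  obtain ⟨r, i, j, -, hij, hjr, hlay, hne⟩ := Unitriangular.exists_inLayer_of_ne_one hθ
  intro h1
  have h2 := Unitriangular.mat_pow_apply_of_inLayer hlay hij hjr n
  rw [← map_pow, h1, map_one, Unitriangular.mat_one, Matrix.one_apply_ne hij.ne] at h2
  exact mul_ne_zero (by exact_mod_cast hn) hne h2.symm

end ResiduallyUnitriangular

/-! ### Cyclic subgroups of free groups -/

section FreeGroupCyclic

variable {A : Type*} [Group A] [IsFreeGroup A]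

theorem IsFreeGroup.pow_ne_one {a : A} (ha : a ≠ 1) {n : ℕ} (hn : n ≠ 0) : a ^ n ≠ 1 :=
  pow_ne_one_of_unitriangular (fun _ h => IsFreeGroup.exists_unitriangular_ne_one h) ha hn

theorem IsFreeGroup.zpow_ne_one {a : A} (ha : a ≠ 1) {n : ℤ} (hn : n ≠ 0) : a ^ n ≠ 1 := by
  rcases n.eq_nat_or_neg with ⟨n, rfl | rfl⟩
  · rw [zpow_natCast]
    exact IsFreeGroup.pow_ne_one ha (by exact_mod_cast hn)
  · rw [zpow_neg, zpow_natCast, Ne, inv_eq_one]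
    exact IsFreeGroup.pow_ne_one ha (by simpa using hn)

theorem IsFreeGroup.zpow_injective {a : A} (ha : a ≠ 1) : Function.Injective fun n : ℤ => a ^ n := by
  intro m n hmn
  by_contra hne
  apply IsFreeGroup.zpow_ne_one ha (sub_ne_zero.2 hne)
  rw [zpow_sub, mul_inv_eq_one]
  exact hmn

theorem IsFreeGroup.exists_generator_of_subsingleton [Subsingleton (IsFreeGroup.Generators A)] :
    ∃ c : A, ∀ x : A, x ∈ Subgroup.zpowers c := by
  have key : ∀ c : A, (∀ i, IsFreeGroup.of i = c) → ∀ x : A, x ∈ Subgroup.zpowers c := by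
    intro c hc x
    have h := IsFreeGroup.ext_hom (G := A) (f := QuotientGroup.mk' (Subgroup.normalClosure {c}))
      (g := 1) (fun i => by
        rw [MonoidHom.one_apply, QuotientGroup.mk'_apply, QuotientGroup.eq_one_iff, hc]
        exact Subgroup.subset_normalClosure rfl)
    obtain ⟨y, rfl⟩ := (IsFreeGroup.mulEquiv A).surjective x
    induction y using FreeGroup.induction_on with
    | C1 => rw [map_one]; exact one_mem _
    | of i =>
      rw [show IsFreeGroup.mulEquiv A (FreeGroup.of i) = IsFreeGroup.of i from rfl, hc]
      exact Subgroup.mem_zpowers c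
    | inv_of i h => rw [map_inv]; exact inv_mem h
    | mul x y hx hy => rw [map_mul]; exact mul_mem hx hy
  by_cases hne : Nonempty (IsFreeGroup.Generators A)
  · obtain ⟨i⟩ := hne
    exact ⟨IsFreeGroup.of i, key _ fun j => by rw [Subsingleton.elim j i]⟩
  · exact ⟨1, key _ fun j => (hne ⟨j⟩).elim⟩

/-- Two elements of a free group which do not lie in a common cyclic subgroup generate a free group
having at least two free generators. -/
theorem IsFreeGroup.exists_mem_zpowers_of_subsingleton (a b : A)
    (h : ∀ i j : IsFreeGroup.Generators (Subgroup.closure {a, b}), i = j) :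
    ∃ c : A, a ∈ Subgroup.zpowers c ∧ b ∈ Subgroup.zpowers c := by
  have : Subsingleton (IsFreeGroup.Generators (Subgroup.closure {a, b})) := ⟨h⟩
  obtain ⟨c, hc⟩ := IsFreeGroup.exists_generator_of_subsingleton (A := Subgroup.closure {a, b})
  have key : ∀ x ∈ Subgroup.closure {a, b}, x ∈ Subgroup.zpowers (c : A) := by
    intro x hx
    obtain ⟨n, hn⟩ := hc ⟨x, hx⟩
    exact ⟨n, by simpa using congrArg Subtype.val hn⟩
  exact ⟨c, key a (Subgroup.subset_closure (by simp)), key b (Subgroup.subset_closure (by simp))⟩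

/-- Elements of a free group with a common nontrivial power lie in a common cyclic subgroup: in the
abelianization of a free group of rank at least two, two generating elements are independent. -/
theorem IsFreeGroup.exists_mem_zpowers_of_zpow_eq {a b : A} {r s : ℤ} (hrs : r ≠ 0 ∨ s ≠ 0)
    (hab : a ^ r = b ^ s) : ∃ c : A, a ∈ Subgroup.zpowers c ∧ b ∈ Subgroup.zpowers c := by
  classical
  apply IsFreeGroup.exists_mem_zpowers_of_subsingleton
  set K := Subgroup.closure {a, b}
  intro i j
  by_contra hij
  let a' : K := ⟨a, Subgroup.subset_closure (by simp)⟩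
  let b' : K := ⟨b, Subgroup.subset_closure (by simp)⟩
  let χ : IsFreeGroup.Generators K → K →* Multiplicative ℤ := fun i =>
    IsFreeGroup.lift fun j => Multiplicative.ofAdd (if j = i then 1 else 0)
  have hχ : ∀ i j, (χ i (IsFreeGroup.of j)).toAdd = if j = i then 1 else 0 := by
    intro i j
    simp only [χ]
    rw [IsFreeGroup.lift_of]
    rfl
  have hgen : ∀ ψ : K →* Multiplicative ℤ, ψ a' = 1 → ψ b' = 1 → ψ = 1 := by
    intro ψ h1 h2
    have : ∀ x (hx : x ∈ K), ψ ⟨x, hx⟩ = 1 := by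
      intro x hx
      induction hx using Subgroup.closure_induction with
      | mem x hx =>
        rcases hx with rfl | hx
        · exact h1
        · rw [Set.mem_singleton_iff] at hx
          subst hx
          exact h2
      | one => exact map_one ψ
      | mul x y hx hy h h' =>
        have := map_mul ψ ⟨x, hx⟩ ⟨y, hy⟩
        rw [h, h', one_mul] at this
        exact this
      | inv x hx h =>
        have := map_inv ψ ⟨x, hx⟩
        rw [h, inv_one] at this
        exact this
    ext ⟨x, hx⟩
    simpa using congrArg Multiplicative.toAdd (this x hx)
  -- A linear combination of the coordinates `i` and `j` on the abelianization which vanishes at `a` and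
  -- `b` vanishes identically, so that its coefficients are zero.
  have hlin : ∀ m n : ℤ, m * (χ i a').toAdd + n * (χ j a').toAdd = 0 →
      m * (χ i b').toAdd + n * (χ j b').toAdd = 0 → m = 0 ∧ n = 0 := by
    intro m n h1 h2
    have h := hgen (χ i ^ m * χ j ^ n)
      (Multiplicative.toAdd.injective (by simpa using h1))
      (Multiplicative.toAdd.injective (by simpa using h2))
    have hi := congrArg Multiplicative.toAdd (DFunLike.congr_fun h (IsFreeGroup.of i))
    have hj := congrArg Multiplicative.toAdd (DFunLike.congr_fun h (IsFreeGroup.of j))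
    have e1 : (χ j (IsFreeGroup.of i)).toAdd = 0 := by rw [hχ, if_neg hij]
    have e2 : (χ i (IsFreeGroup.of j)).toAdd = 0 := by rw [hχ, if_neg (Ne.symm hij)]
    simp [hχ i i, e1] at hi
    simp [hχ j j, e2] at hj
    exact ⟨hi, hj⟩
  have hpow : a' ^ r = b' ^ s := Subtype.ext (by simpa using hab)
  have hi : r * (χ i a').toAdd = s * (χ i b').toAdd := by
    simpa using congrArg (fun x => (χ i x).toAdd) hpow
  have hj : r * (χ j a').toAdd = s * (χ j b').toAdd := by
    simpa using congrArg (fun x => (χ j x).toAdd) hpow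
  have hdet : (χ i a').toAdd * (χ j b').toAdd - (χ j a').toAdd * (χ i b').toAdd = 0 := by
    rcases hrs with h | h
    · apply (mul_eq_zero.1 _).resolve_left h
      linear_combination (χ j b').toAdd * hi - (χ i b').toAdd * hj
    · apply (mul_eq_zero.1 _).resolve_left h
      linear_combination (χ j a').toAdd * hi - (χ i a').toAdd * hj
  obtain ⟨h1, h2⟩ := hlin (-(χ j a').toAdd) (χ i a').toAdd (by ring) (by linear_combination hdet)
  obtain ⟨h3, h4⟩ := hlin (-(χ j b').toAdd) (χ i b').toAdd (by linear_combination -hdet) (by ring)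
  have h5 := hlin 1 0 (by rw [h2]; ring) (by rw [h4]; ring)
  exact one_ne_zero h5.1

/-- Commuting elements of a free group lie in a common cyclic subgroup, as two distinct free generators
can be mapped to transpositions which do not commute. -/
theorem IsFreeGroup.exists_mem_zpowers_of_commute {a b : A} (hab : Commute a b) :
    ∃ c : A, a ∈ Subgroup.zpowers c ∧ b ∈ Subgroup.zpowers c := by
  classical
  apply IsFreeGroup.exists_mem_zpowers_of_subsingleton
  intro i j
  by_contra hij
  have hcomm : ∀ x y : Subgroup.closure {a, b}, x * y = y * x := by
    have := Subgroup.isMulCommutative_closure (k := {a, b}) (by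
      rintro x (rfl | rfl) y (rfl | rfl)
      · rfl
      · exact hab
      · exact hab.symm
      · rfl)
    intro x y
    exact mul_comm' x y
  let ψ : Subgroup.closure {a, b} →* Equiv.Perm (Fin 3) :=
    IsFreeGroup.lift fun k => if k = i then Equiv.swap 0 1 else Equiv.swap 1 2
  have h := congrArg ψ (hcomm (IsFreeGroup.of i) (IsFreeGroup.of j))
  simp only [ψ, map_mul] at h
  rw [IsFreeGroup.lift_of, IsFreeGroup.lift_of, if_pos rfl, if_neg (Ne.symm hij)] at h
  revert h
  decide

variable {h : A}

theorem IsMaximalCyclicSubgroup.mem_of_mem_zpowers {X : Type*} [Group X] {h c b : X}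
    (hh : IsMaximalCyclicSubgroup (Subgroup.zpowers h)) (hc : h ∈ Subgroup.zpowers c)
    (hb : b ∈ Subgroup.zpowers c) : b ∈ Subgroup.zpowers h :=
  hh.2 (show IsCyclic (Subgroup.zpowers c) from inferInstance) (by simpa using hc) hb

theorem IsMaximalCyclicSubgroup.subsingleton_of_eq_one {X : Type*} [Group X]
    (hh : IsMaximalCyclicSubgroup (Subgroup.zpowers (1 : X))) (b : X) : b = 1 := by
  have := hh.mem_of_mem_zpowers (one_mem _) (Subgroup.mem_zpowers b)
  simpa using this

theorem IsMaximalCyclicSubgroup.mem_of_zpow_mem (hh : IsMaximalCyclicSubgroup (Subgroup.zpowers h))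
    {b : A} {n : ℤ} (hn : n ≠ 0) (hb : b ^ n ∈ Subgroup.zpowers h) : b ∈ Subgroup.zpowers h := by
  obtain ⟨s, hs⟩ := hb
  obtain ⟨c, hc1, hc2⟩ := IsFreeGroup.exists_mem_zpowers_of_zpow_eq (Or.inl hn) hs.symm
  exact hh.mem_of_mem_zpowers hc2 hc1

theorem IsMaximalCyclicSubgroup.mem_of_commute (hh : IsMaximalCyclicSubgroup (Subgroup.zpowers h))
    {b : A} {n : ℤ} (hn : n ≠ 0) (hb : Commute b (h ^ n)) : b ∈ Subgroup.zpowers h := by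
  by_cases h1 : h = 1
  · subst h1
    rw [hh.subsingleton_of_eq_one b]
    exact one_mem _
  obtain ⟨c, hc1, r, hr⟩ := IsFreeGroup.exists_mem_zpowers_of_commute hb
  obtain ⟨c', hc', hh'⟩ := IsFreeGroup.exists_mem_zpowers_of_zpow_eq (Or.inr hn) hr
  refine hh.mem_of_mem_zpowers hh' (Subgroup.zpowers_le.2 hc' hc1)

/-- A maximal cyclic subgroup of a free group is malnormal. -/
theorem IsMaximalCyclicSubgroup.mem_of_conj (hh : IsMaximalCyclicSubgroup (Subgroup.zpowers h))
    {b : A} {n : ℤ} (hn : n ≠ 0) (hb : b * h ^ n * b⁻¹ ∈ Subgroup.zpowers h) :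
    b ∈ Subgroup.zpowers h := by
  by_cases h1 : h = 1
  · subst h1
    rw [hh.subsingleton_of_eq_one b]
    exact one_mem _
  obtain ⟨k, hk⟩ := hb
  obtain ⟨d, θ, hθ⟩ := IsFreeGroup.exists_unitriangular_ne_one h1
  obtain ⟨r, i, j, -, hij, hjr, hlay, hne⟩ := Unitriangular.exists_inLayer_of_ne_one hθ
  have h2 := congrArg (fun x => Unitriangular.mat (θ x) i j) hk
  simp only [map_zpow, map_mul, map_inv] at h2
  rw [Unitriangular.mat_conj_apply_of_inLayer (hlay.zpow n) _ hjr,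
    Unitriangular.mat_zpow_apply_of_inLayer hlay hij hjr,
    Unitriangular.mat_zpow_apply_of_inLayer hlay hij hjr] at h2
  have hkn : k = n := by simpa using mul_right_cancel₀ hne h2
  subst hkn
  refine hh.mem_of_commute hn ?_
  show b * h ^ k = h ^ k * b
  exact mul_inv_eq_iff_eq_mul.1 hk.symm

/-- The subgroups of `p`-power index in a maximal cyclic subgroup of a free group are closed. -/
theorem IsMaximalCyclicSubgroup.isPClosedZPowers {p : ℕ} (hp : p.Prime)
    (hh : IsMaximalCyclicSubgroup (Subgroup.zpowers h)) (i : ℕ) : IsPClosedZPowers p (h ^ p ^ i) := by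
  intro g hg
  by_cases h1 : h = 1
  · subst h1
    rw [hh.subsingleton_of_eq_one g]
    exact one_mem _
  obtain ⟨a, ha, t, ht⟩ := closureLeRoots_of_unitriangular hp
    (fun _ h => IsFreeGroup.exists_unitriangular_ne_one h) _ _ hg
  have ha0 : (a : ℤ) ≠ 0 := by
    rintro h0
    exact ha (by rw [Nat.cast_eq_zero.1 h0]; exact dvd_zero p)
  have ht' : h ^ (((p ^ i : ℕ) : ℤ) * t) = g ^ (a : ℤ) := by
    rw [zpow_mul, zpow_natCast, zpow_natCast]; exact ht
  obtain ⟨s, rfl⟩ := hh.mem_of_zpow_mem ha0 ⟨_, ht'⟩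
  have hs : ((p ^ i : ℕ) : ℤ) * t = s * a := IsFreeGroup.zpow_injective h1 (by
    simpa only [zpow_mul] using ht')
  have hd : ((p ^ i : ℕ) : ℤ) ∣ s := by
    have hc : IsCoprime (((p ^ i : ℕ) : ℤ)) (a : ℤ) := by
      rw [Nat.isCoprime_iff_coprime]
      exact Nat.Coprime.pow_left _ ((Nat.Prime.coprime_iff_not_dvd hp).2 ha)
    exact hc.dvd_of_dvd_mul_right ⟨t, hs.symm⟩
  obtain ⟨s', rfl⟩ := hd
  exact ⟨s', by simp only [zpow_mul, zpow_natCast]⟩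

end FreeGroupCyclic

/-! ### Permutations twisted by a group -/

/-- The unrestricted permutational wreath product of `V` by the symmetric group of `Ω`: a permutation
of `Ω` together with an element of `V` for each point. It acts on `Ω × V` by
`(ω, v) ↦ (σ ω, f ω * v)`, so that a homomorphism to it is an action on `Ω` with a cocycle. -/
@[ext]
structure TwistedPerm (Ω V : Type*) where
  perm : Equiv.Perm Ω
  twist : Ω → V

namespace TwistedPerm

variable {Ω V : Type*} [Group V]

instance : Mul (TwistedPerm Ω V) := ⟨fun g h => ⟨g.perm * h.perm, fun ω => g.twist (h.perm ω) * h.twist ω⟩⟩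

instance : One (TwistedPerm Ω V) := ⟨⟨1, fun _ => 1⟩⟩

instance : Inv (TwistedPerm Ω V) := ⟨fun g => ⟨g.perm⁻¹, fun ω => (g.twist (g.perm⁻¹ ω))⁻¹⟩⟩

@[simp] theorem perm_mul (g h : TwistedPerm Ω V) : (g * h).perm = g.perm * h.perm := rfl

@[simp] theorem twist_mul (g h : TwistedPerm Ω V) (ω : Ω) :
    (g * h).twist ω = g.twist (h.perm ω) * h.twist ω := rfl

@[simp] theorem perm_one : (1 : TwistedPerm Ω V).perm = 1 := rfl

@[simp] theorem twist_one (ω : Ω) : (1 : TwistedPerm Ω V).twist ω = 1 := rfl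

@[simp] theorem perm_inv (g : TwistedPerm Ω V) : g⁻¹.perm = g.perm⁻¹ := rfl

@[simp] theorem twist_inv (g : TwistedPerm Ω V) (ω : Ω) :
    g⁻¹.twist ω = (g.twist (g.perm⁻¹ ω))⁻¹ := rfl

instance : Group (TwistedPerm Ω V) := Group.ofLeftAxioms
  (fun a b c => TwistedPerm.ext (mul_assoc _ _ _) (funext fun ω => mul_assoc _ _ _))
  (fun a => TwistedPerm.ext (one_mul _) (funext fun ω => one_mul _))
  (fun a => TwistedPerm.ext (inv_mul_cancel _) (funext fun ω => by simp))

/-- The underlying permutation. -/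
def permHom (Ω V : Type*) [Group V] : TwistedPerm Ω V →* Equiv.Perm Ω where
  toFun := perm
  map_one' := rfl
  map_mul' _ _ := rfl

@[simp] theorem perm_pow (g : TwistedPerm Ω V) (n : ℕ) : (g ^ n).perm = g.perm ^ n :=
  map_pow (permHom Ω V) g n

/-- The action on `Ω × V`. -/
def actHom (Ω V : Type*) [Group V] : TwistedPerm Ω V →* Equiv.Perm (Ω × V) where
  toFun g :=
    { toFun := fun x => (g.perm x.1, g.twist x.1 * x.2)
      invFun := fun x => (g⁻¹.perm x.1, g⁻¹.twist x.1 * x.2)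
      left_inv := fun x => by simp
      right_inv := fun x => by simp }
  map_one' := by ext x <;> simp
  map_mul' g h := by ext x <;> simp [mul_assoc]

/-- Change of coefficients. -/
def mapHom {W : Type*} [Group W] (ψ : V →* W) : TwistedPerm Ω V →* TwistedPerm Ω W where
  toFun g := ⟨g.perm, fun ω => ψ (g.twist ω)⟩
  map_one' := by ext <;> simp
  map_mul' g h := by ext <;> simp

@[simp] theorem mapHom_perm {W : Type*} [Group W] (ψ : V →* W) (g : TwistedPerm Ω V) :
    (mapHom ψ g).perm = g.perm := rfl

@[simp] theorem mapHom_twist {W : Type*} [Group W] (ψ : V →* W) (g : TwistedPerm Ω V) (ω : Ω) :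
    (mapHom ψ g).twist ω = ψ (g.twist ω) := rfl

theorem twist_pow_of_perm_eq_one {g : TwistedPerm Ω V} (hg : g.perm = 1) (n : ℕ) (ω : Ω) :
    (g ^ n).twist ω = g.twist ω ^ n := by
  induction n with
  | zero => simp
  | succ n ih => rw [pow_succ, twist_mul, hg, Equiv.Perm.one_apply, ih, pow_succ]

theorem pow_mul_eq_one {g : TwistedPerm Ω V} {m n : ℕ} (hm : g.perm ^ m = 1)
    (hn : ∀ v : V, v ^ n = 1) : g ^ (m * n) = 1 := by
  ext ω
  · simp [pow_mul, hm]
  · rw [pow_mul, twist_pow_of_perm_eq_one (by simpa using hm), hn, twist_one]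

instance [Finite Ω] [Finite V] : Finite (TwistedPerm Ω V) :=
  Finite.of_injective (fun g => (g.perm, g.twist)) fun _ _ hgh =>
    TwistedPerm.ext (congrArg Prod.fst hgh) (congrArg Prod.snd hgh)

theorem isPGroup_comap {p : ℕ} (hp : p.Prime) [Finite V] (hV : IsPGroup p V)
    {Γ : Subgroup (Equiv.Perm Ω)} (hΓ : IsPGroup p Γ) :
    IsPGroup p (Γ.comap (permHom Ω V)) := by
  obtain ⟨l, hl⟩ := hV.exists_uniform_pow hp
  rintro ⟨g, hg⟩
  obtain ⟨k, hk⟩ := hΓ ⟨g.perm, hg⟩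
  refine ⟨k + l, Subtype.ext ?_⟩
  rw [pow_add]
  exact pow_mul_eq_one (by simpa using congrArg Subtype.val hk) hl

/-- The kernel of a homomorphism to twisted permutations is open as soon as the permutations
lie in a `p`-group and the twists in a finite `p`-group. -/
theorem isPOpen_ker {p : ℕ} (hp : p.Prime) [Finite Ω] [Finite V] (hV : IsPGroup p V)
    {Γ : Subgroup (Equiv.Perm Ω)} (hΓ : IsPGroup p Γ) {G : Type*} [Group G]
    (Φ : G →* TwistedPerm Ω V) (h : ∀ g, (Φ g).perm ∈ Γ) : IsPOpen p Φ.ker := by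
  have h1 : (Φ.codRestrict (Γ.comap (permHom Ω V)) h).ker = Φ.ker := by
    ext g
    rw [MonoidHom.mem_ker, MonoidHom.mem_ker, Subtype.ext_iff]
    rfl
  rw [← h1]
  exact _root_.isPOpen_ker hp (isPGroup_comap hp hV hΓ) _

end TwistedPerm

/-! ### Amalgamating two finite `p`-groups along a cyclic subgroup -/

section Higman

open Equiv

/-- A function on a set on which the cyclic group generated by `σ` acts freely is a coboundary if
its sums over the orbits vanish. -/
theorem exists_coboundary {Ω M : Type*} [AddCommGroup M] (σ : Perm Ω) (q : ℕ)
    (hσ : ∀ (ω : Ω) (j : ℤ), (σ ^ j) ω = ω ↔ (q : ℤ) ∣ j) (hq : 0 < q) (δ : Ω → M)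
    (hδ : ∀ ω, ∑ k ∈ Finset.range q, δ ((σ ^ k) ω) = 0) :
    ∃ b : Ω → M, ∀ ω, b (σ ω) = b ω + δ ω := by
  classical
  -- Sum `δ` along the cycles, starting from a representative `r ω` of each cycle.
  let s : Setoid Ω := Perm.SameCycle.setoid σ
  let r : Ω → Ω := fun ω => (Quotient.mk s ω).out
  have hr : ∀ ω, σ.SameCycle (r ω) ω := fun ω => Quotient.exact (Quotient.out_eq (Quotient.mk s ω))
  have hrσ : ∀ ω, r (σ ω) = r ω := fun ω => by
    have : Quotient.mk s (σ ω) = Quotient.mk s ω :=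
      Quotient.sound (Perm.sameCycle_apply_left.2 (Perm.SameCycle.refl σ ω))
    simp only [r, this]
  have hn : ∀ ω, ∃ n : ℕ, (σ ^ n) (r ω) = ω := by
    intro ω
    obtain ⟨j, hj⟩ := hr ω
    refine ⟨(j % q).toNat, ?_⟩
    have h0 : 0 ≤ j % q := Int.emod_nonneg _ (by omega)
    rw [← zpow_natCast, Int.toNat_of_nonneg h0]
    have h1 : (σ ^ (q * (j / q))) (r ω) = r ω := (hσ _ _).2 (dvd_mul_right _ _)
    conv_rhs => rw [← hj, ← Int.emod_add_mul_ediv j q, zpow_add, Perm.mul_apply, h1]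
  choose n hn using hn
  let S : Ω → ℕ → M := fun ω m => ∑ k ∈ Finset.range m, δ ((σ ^ k) ω)
  have hS : ∀ ω m, S ω (m + q) = S ω m := by
    intro ω m
    simp only [S]
    rw [Finset.sum_range_add, add_eq_left]
    convert hδ ((σ ^ m) ω) using 3 with k
    rw [add_comm, pow_add, Perm.mul_apply]
  have hS' : ∀ ω m t, S ω (m + q * t) = S ω m := by
    intro ω m t
    induction t with
    | zero => simp
    | succ t ih => rw [Nat.mul_succ, ← add_assoc, hS, ih]
  have hS'' : ∀ ω m m', (σ ^ m) ω = (σ ^ m') ω → S ω m = S ω m' := by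
    have aux : ∀ ω m m', m ≤ m' → (σ ^ m) ω = (σ ^ m') ω → S ω m = S ω m' := by
      intro ω m m' hm h
      obtain ⟨t, rfl⟩ := Nat.exists_eq_add_of_le hm
      rw [pow_add, Perm.mul_apply] at h
      have h1 := (hσ ω t).1 (by rw [zpow_natCast]; exact ((σ ^ m).injective h).symm)
      obtain ⟨t', rfl⟩ := Int.natCast_dvd_natCast.1 h1
      rw [hS']
    intro ω m m' h
    rcases le_total m m' with hm | hm
    · exact aux ω m m' hm h
    · exact (aux ω m' m hm h.symm).symm
  refine ⟨fun ω => S (r ω) (n ω), fun ω => ?_⟩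
  have h1 : S (r ω) (n (σ ω)) = S (r ω) (n ω + 1) := by
    apply hS''
    have := hn (σ ω)
    rw [hrσ] at this
    rw [this, pow_succ', Perm.mul_apply, hn]
  simp only [hrσ]
  rw [h1]
  simp only [S]
  rw [Finset.sum_range_succ, hn]

variable {p : ℕ}

/-- A central extension of a group acting freely is described by a cocycle. -/
theorem exists_cocycle {P Ω : Type*} [Group P] (α : P →* Perm Ω) {z : P}
    (hz : z ∈ Subgroup.center P) (hzp : orderOf z = p)
    (hα : ∀ g ω, α g ω = ω ↔ g ∈ Subgroup.zpowers z) :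
    ∃ c : P → Ω → ZMod p, (∀ g g' ω, c (g * g') ω = c g (α g' ω) + c g' ω) ∧
      ∀ (k : ℤ) ω, c (z ^ k) ω = k := by
  classical
  -- `ℓ` is the isomorphism of `⟨z⟩` with `ZMod p`, and `t ω` transports the representative `r ω` of
  -- the orbit to `ω`.
  let ℓ : P → ZMod p := fun g => if h : ∃ k : ℤ, z ^ k = g then (h.choose : ZMod p) else 0
  have hℓ : ∀ k : ℤ, ℓ (z ^ k) = k := by
    intro k
    have h : ∃ k' : ℤ, z ^ k' = z ^ k := ⟨k, rfl⟩
    simp only [ℓ]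
    rw [dif_pos h, ZMod.intCast_eq_intCast_iff, ← hzp]
    exact zpow_eq_zpow_iff_modEq.1 h.choose_spec
  let s : Setoid Ω := ⟨fun ω ω' => ∃ g, α g ω = ω', fun ω => ⟨1, by simp⟩,
    fun {ω ω'} ⟨g, hg⟩ => ⟨g⁻¹, by rw [← hg, ← Perm.mul_apply, ← map_mul]; simp⟩,
    fun {_ _ _} ⟨g, hg⟩ ⟨g', hg'⟩ => ⟨g' * g, by rw [map_mul, Perm.mul_apply, hg, hg']⟩⟩
  let r : Ω → Ω := fun ω => (Quotient.mk s ω).out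
  have hr : ∀ ω, ∃ g, α g (r ω) = ω := fun ω => Quotient.exact (Quotient.out_eq (Quotient.mk s ω))
  have hrα : ∀ g ω, r (α g ω) = r ω := fun g ω => by
    have : Quotient.mk s (α g ω) = Quotient.mk s ω :=
      (Quotient.sound (show ∃ g', α g' ω = α g ω from ⟨g, rfl⟩)).symm
    simp only [r, this]
  choose t ht using hr
  have hmem : ∀ g ω, ∃ k : ℤ, z ^ k = (t (α g ω))⁻¹ * g * t ω := by
    intro g ω
    apply (hα _ (r ω)).1
    rw [map_mul, map_mul, Perm.mul_apply, Perm.mul_apply, ht, map_inv, Perm.inv_eq_iff_eq]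
    conv_rhs => rw [← hrα g ω, ht]
  refine ⟨fun g ω => ℓ ((t (α g ω))⁻¹ * g * t ω), fun g g' ω => ?_, fun k ω => ?_⟩
  · obtain ⟨k, hk⟩ := hmem g (α g' ω)
    obtain ⟨k', hk'⟩ := hmem g' ω
    have h : (t (α (g * g') ω))⁻¹ * (g * g') * t ω = z ^ (k + k') := by
      rw [zpow_add, hk, hk', map_mul, Perm.mul_apply]
      group
    simp only
    rw [h, ← hk, ← hk', hℓ, hℓ, hℓ, Int.cast_add]
  · have h1 : α (z ^ k) ω = ω := (hα _ _).2 ⟨k, rfl⟩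
    have h2 : z ^ k ∈ Subgroup.center P := Subgroup.zpow_mem _ hz k
    simp only
    rw [h1, mul_assoc, ← Subgroup.mem_center_iff.1 h2, inv_mul_cancel_left, hℓ]

/-- The homomorphism to twisted permutations given by an action and an additive cocycle. -/
def TwistedPerm.ofCocycle {P Ω : Type*} [Group P] (α : P →* Perm Ω) (c : P → Ω → ZMod p)
    (hc : ∀ g g' ω, c (g * g') ω = c g (α g' ω) + c g' ω) :
    P →* TwistedPerm Ω (Multiplicative (ZMod p)) :=
  MonoidHom.mk' (fun g => ⟨α g, fun ω => Multiplicative.ofAdd (c g ω)⟩) fun g g' => by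
    ext ω
    · simp
    · show c (g * g') ω = c g (α g' ω) + c g' ω
      exact hc g g' ω

theorem cocycle_pow {P Ω : Type*} [Group P] (α : P →* Perm Ω) (c : P → Ω → ZMod p)
    (hc : ∀ g g' ω, c (g * g') ω = c g (α g' ω) + c g' ω) (u : P) (n : ℕ) (ω : Ω) :
    c (u ^ n) ω = ∑ k ∈ Finset.range n, c u (((α u) ^ k) ω) := by
  induction n with
  | zero =>
    have := hc 1 1 ω
    simp at this
    simpa using this
  | succ n ih => rw [pow_succ', hc, ih, Finset.sum_range_succ, map_pow, add_comm]

/-- Adjusting a cocycle by a coboundary, its value at `u` can be prescribed, provided that the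
sums over the orbits agree. -/
theorem exists_cocycle_eq {P Ω : Type*} [Group P] (α : P →* Perm Ω) {z : P}
    (hz : z ∈ Subgroup.center P) (hzp : orderOf z = p)
    (hα : ∀ g ω, α g ω = ω ↔ g ∈ Subgroup.zpowers z) (u : P) (q : ℕ) (hq : 0 < q)
    (hu : ∀ j : ℤ, u ^ j ∈ Subgroup.zpowers z ↔ (q : ℤ) ∣ j) (k : ℤ) (hk : u ^ q = z ^ k)
    (γ : Ω → ZMod p) (hγ : ∀ ω, ∑ i ∈ Finset.range q, γ (((α u) ^ i) ω) = k) :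
    ∃ c : P → Ω → ZMod p, (∀ g g' ω, c (g * g') ω = c g (α g' ω) + c g' ω) ∧
      (∀ (k : ℤ) ω, c (z ^ k) ω = k) ∧ ∀ ω, c u ω = γ ω := by
  obtain ⟨c, hc, hcz⟩ := exists_cocycle α hz hzp hα
  obtain ⟨b, hb⟩ := exists_coboundary (α u) q (fun ω j => by rw [← map_zpow, hα, hu]) hq
    (fun ω => c u ω - γ ω) (fun ω => by
      rw [Finset.sum_sub_distrib, hγ, ← cocycle_pow α c hc, hk, hcz, sub_self])
  refine ⟨fun g ω => c g ω - b (α g ω) + b ω, fun g g' ω => ?_, fun k ω => ?_, fun ω => ?_⟩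
  · simp only [hc, map_mul, Perm.mul_apply]; ring
  · simp only [hcz, (hα (z ^ k) ω).2 ⟨k, rfl⟩]; ring
  · simp only [hb]; ring

/-- In a nontrivial finite `p`-group, a cyclic subgroup `⟨u⟩` either misses a central subgroup of
order `p`, or its own subgroup of order `p` is central. -/
theorem IsPGroup.central_dichotomy (hp : p.Prime) {P : Type*} [Group P] [Finite P]
    (hP : IsPGroup p P) [Nontrivial P] (u : P) :
    (∃ z ∈ Subgroup.center P, orderOf z = p ∧
      ∀ x ∈ Subgroup.zpowers z, x ∈ Subgroup.zpowers u → x = 1) ∨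
    ∃ q : ℕ, 0 < q ∧ orderOf u = q * p ∧ u ^ q ∈ Subgroup.center P := by
  have := Fact.mk hp
  have := hP.center_nontrivial
  have hdvd : p ∣ Nat.card (Subgroup.center P) :=
    ((hP.to_subgroup _).card_eq_or_dvd).resolve_left Finite.one_lt_card.ne'
  obtain ⟨⟨z, hzc⟩, hz⟩ := exists_prime_orderOf_dvd_card' p hdvd
  rw [Subgroup.orderOf_mk] at hz
  by_cases h : ∀ x ∈ Subgroup.zpowers z, x ∈ Subgroup.zpowers u → x = 1
  · exact Or.inl ⟨z, hzc, hz, h⟩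
  push Not at h
  obtain ⟨x, hxz, hxu, hx1⟩ := h
  right
  have hxc : x ∈ Subgroup.center P := Subgroup.zpowers_le.2 hzc hxz
  have hxp : x ^ p = 1 := by
    obtain ⟨k, rfl⟩ := hxz
    simp only
    rw [← zpow_natCast, ← zpow_mul, mul_comm, zpow_mul, zpow_natCast, ← hz, pow_orderOf_eq_one,
      one_zpow]
  obtain ⟨t, ht⟩ : ∃ t : ℕ, u ^ t = x := by
    have := (mem_powers_iff_mem_zpowers).2 hxu
    exact this
  have hu1 : u ≠ 1 := by
    rintro rfl
    exact hx1 (by rw [← ht, one_pow])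
  obtain ⟨q, hq⟩ := hP.dvd_orderOf hu1
  have hq0 : 0 < q := Nat.pos_of_ne_zero fun h => (orderOf_pos u).ne' (by rw [hq, h, mul_zero])
  refine ⟨q, hq0, by rw [hq, mul_comm], ?_⟩
  have hqt : q ∣ t := by
    have : orderOf u ∣ t * p := orderOf_dvd_of_pow_eq_one (by rw [pow_mul, ht, hxp])
    rw [hq, mul_comm t] at this
    exact Nat.dvd_of_mul_dvd_mul_left hp.pos this
  obtain ⟨s, rfl⟩ := hqt
  rw [pow_mul] at ht
  have hw : (u ^ q) ^ p = 1 := by rw [← pow_mul, mul_comm, ← hq, pow_orderOf_eq_one]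
  have hcop : IsCoprime (s : ℤ) p := by
    rw [Nat.isCoprime_iff_coprime, Nat.coprime_comm, hp.coprime_iff_not_dvd]
    rintro ⟨s', rfl⟩
    exact hx1 (by rw [← ht, pow_mul, hw, one_pow])
  obtain ⟨a, b, hab⟩ := hcop
  have : u ^ q = x ^ a := by
    rw [← ht, ← zpow_natCast (u ^ q) s, ← zpow_mul]
    conv_lhs => rw [← zpow_one (u ^ q), ← hab, zpow_add, mul_comm b, zpow_mul _ (p : ℤ), zpow_natCast, hw,
      one_zpow, mul_one, mul_comm]
  rw [this]
  exact Subgroup.zpow_mem _ hxc a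

end Higman

section CommonAction

open Equiv

/-- The groups `P` and `Q` act freely on a common finite set, inside a `p`-group of permutations,
in such a way that `u` and `v` act in the same way. -/
def HasCommonAction (p : ℕ) {P Q : Type*} [Group P] [Group Q] (u : P) (v : Q) : Prop :=
  ∃ (Ω : Type) (_ : Finite Ω) (_ : Nonempty Ω) (Γ : Subgroup (Perm Ω)) (α : P →* Perm Ω)
    (β : Q →* Perm Ω), IsPGroup p Γ ∧ (∀ g, α g ∈ Γ) ∧ (∀ g, β g ∈ Γ) ∧ α u = β v ∧
      (∀ g ω, α g ω = ω → g = 1) ∧ ∀ g ω, β g ω = ω → g = 1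

variable {p : ℕ} {P Q : Type*} [Group P] [Group Q]

theorem HasCommonAction.symm {u : P} {v : Q} (h : HasCommonAction p u v) :
    HasCommonAction p v u := by
  obtain ⟨Ω, h1, h2, Γ, α, β, hΓ, hα, hβ, huv, hfα, hfβ⟩ := h
  exact ⟨Ω, h1, h2, Γ, β, α, hΓ, hβ, hα, huv.symm, hfβ, hfα⟩

/-- Two actions on `Ω` with additive cocycles give actions on `Ω × ZMod p`. -/
theorem hasCommonAction_of_cocycles (hp : p.Prime) {Ω : Type} [Finite Ω] [Nonempty Ω]
    {Γ : Subgroup (Perm Ω)} (hΓ : IsPGroup p Γ) (α : P →* Perm Ω) (β : Q →* Perm Ω)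
    (hα : ∀ g, α g ∈ Γ) (hβ : ∀ g, β g ∈ Γ) {u : P} {v : Q} (huv : α u = β v)
    (c : P → Ω → ZMod p) (hc : ∀ g g' ω, c (g * g') ω = c g (α g' ω) + c g' ω)
    (c' : Q → Ω → ZMod p) (hc' : ∀ g g' ω, c' (g * g') ω = c' g (β g' ω) + c' g' ω)
    (hcc' : ∀ ω, c u ω = c' v ω) (hf : ∀ g ω, α g ω = ω → c g ω = 0 → g = 1)
    (hf' : ∀ g ω, β g ω = ω → c' g ω = 0 → g = 1) : HasCommonAction p u v := by
  have : NeZero p := ⟨hp.ne_zero⟩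
  have hV : IsPGroup p (Multiplicative (ZMod p)) := fun g => ⟨1, by
    rw [pow_one]
    apply Multiplicative.toAdd.injective
    simp⟩
  have hfin : Finite (Ω × Multiplicative (ZMod p)) :=
    have : Finite (Multiplicative (ZMod p)) := inferInstanceAs (Finite (ZMod p))
    inferInstance
  have : Finite (Multiplicative (ZMod p)) := inferInstanceAs (Finite (ZMod p))
  refine ⟨Ω × Multiplicative (ZMod p), hfin, inferInstance,
    (Γ.comap (TwistedPerm.permHom Ω (Multiplicative (ZMod p)))).map (TwistedPerm.actHom _ _),
    (TwistedPerm.actHom _ _).comp (TwistedPerm.ofCocycle α c hc),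
    (TwistedPerm.actHom _ _).comp (TwistedPerm.ofCocycle β c' hc'),
    (TwistedPerm.isPGroup_comap hp hV hΓ).map _, fun g => ⟨_, hα g, rfl⟩, fun g => ⟨_, hβ g, rfl⟩,
    ?_, ?_, ?_⟩
  · show TwistedPerm.actHom _ _ _ = TwistedPerm.actHom _ _ _
    congr 1
    ext ω
    · exact congrArg (fun σ : Perm Ω => σ ω) huv
    · exact hcc' ω
  · rintro g ⟨ω, x⟩ h
    have h1 := congrArg Prod.fst h
    have h2 := congrArg Prod.snd h
    exact hf g ω h1 (mul_eq_right.1 h2)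
  · rintro g ⟨ω, x⟩ h
    have h1 := congrArg Prod.fst h
    have h2 := congrArg Prod.snd h
    exact hf' g ω h1 (mul_eq_right.1 h2)

theorem orderOf_quotientMk {z u : P} [(Subgroup.zpowers z).Normal] {q : ℕ}
    (hu : ∀ j : ℤ, u ^ j ∈ Subgroup.zpowers z ↔ (q : ℤ) ∣ j) :
    orderOf (u : P ⧸ Subgroup.zpowers z) = q := by
  apply Nat.dvd_antisymm
  · apply orderOf_dvd_of_pow_eq_one
    rw [← QuotientGroup.mk_pow, QuotientGroup.eq_one_iff, ← zpow_natCast]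
    exact (hu _).2 dvd_rfl
  · have := pow_orderOf_eq_one (u : P ⧸ Subgroup.zpowers z)
    rw [← QuotientGroup.mk_pow, QuotientGroup.eq_one_iff, ← zpow_natCast] at this
    exact Int.natCast_dvd_natCast.1 ((hu _).1 this)

theorem normal_zpowers_of_mem_center {z : P} (hz : z ∈ Subgroup.center P) :
    (Subgroup.zpowers z).Normal := by
  constructor
  intro n hn g
  have : n ∈ Subgroup.center P := Subgroup.zpowers_le.2 hz hn
  rwa [Subgroup.mem_center_iff.1 this g, mul_inv_cancel_right]

theorem card_quotient_zpowers_lt [Finite P] {z : P} (hz : 1 < orderOf z) :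
    Nat.card (P ⧸ Subgroup.zpowers z) < Nat.card P := by
  rw [Subgroup.card_eq_card_quotient_mul_card_subgroup (Subgroup.zpowers z), Nat.card_zpowers]
  exact lt_mul_of_one_lt_right Nat.card_pos hz

theorem action_eq_iff_mem_zpowers {Ω : Type*} {z : P} [(Subgroup.zpowers z).Normal]
    {α : P ⧸ Subgroup.zpowers z →* Perm Ω} (hα : ∀ g ω, α g ω = ω → g = 1) (g : P) (ω : Ω) :
    (α.comp (QuotientGroup.mk' _)) g ω = ω ↔ g ∈ Subgroup.zpowers z := by
  constructor
  · intro h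
    exact (QuotientGroup.eq_one_iff g).1 (hα _ ω h)
  · intro h
    show α (g : P ⧸ Subgroup.zpowers z) ω = ω
    rw [(QuotientGroup.eq_one_iff g).2 h, map_one, Perm.one_apply]

theorem eq_one_of_cocycle_eq_zero {Ω : Type*} {z : P} (hzp : orderOf z = p) {c : P → Ω → ZMod p}
    (hcz : ∀ (k : ℤ) ω, c (z ^ k) ω = k) {g : P} {ω : Ω} (hg : g ∈ Subgroup.zpowers z)
    (h : c g ω = 0) : g = 1 := by
  obtain ⟨k, rfl⟩ := hg
  have h1 : (k : ZMod p) = 0 := by rw [← hcz k ω]; exact h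
  rw [ZMod.intCast_zmod_eq_zero_iff_dvd, ← hzp] at h1
  exact orderOf_dvd_iff_zpow_eq_one.1 h1

/-- Extending a common action along a central subgroup of `P` which meets `⟨u⟩` trivially: the
cocycle of the extension can be made to vanish at `u`. -/
theorem HasCommonAction.of_quotient_left (hp : p.Prime) [Finite P] {u : P} {v : Q} {z : P}
    (hz : z ∈ Subgroup.center P) (hzp : orderOf z = p)
    (hzu : ∀ x ∈ Subgroup.zpowers z, x ∈ Subgroup.zpowers u → x = 1)
    [(Subgroup.zpowers z).Normal]
    (h : HasCommonAction p (u : P ⧸ Subgroup.zpowers z) v) : HasCommonAction p u v := by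
  obtain ⟨Ω, h1, h2, Γ, α, β, hΓ, hα, hβ, huv, hfα, hfβ⟩ := h
  have hact := action_eq_iff_mem_zpowers hfα
  obtain ⟨c, hc, hcz, hcu⟩ := exists_cocycle_eq
    (α.comp (QuotientGroup.mk' (Subgroup.zpowers z))) hz hzp hact u (orderOf u) (orderOf_pos u)
    (fun j => by
      rw [orderOf_dvd_iff_zpow_eq_one]
      exact ⟨fun h => hzu _ h ⟨j, rfl⟩, fun h => h ▸ one_mem _⟩) 0
    (by rw [pow_orderOf_eq_one, zpow_zero]) (fun _ => 0) (fun ω => by simp)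
  refine hasCommonAction_of_cocycles hp hΓ (α.comp (QuotientGroup.mk' (Subgroup.zpowers z))) β
    (fun g => hα _) hβ (show (α.comp _) u = β v from huv) c hc (fun _ _ => 0)
    (fun _ _ _ => by simp) hcu (fun g ω h h0 => ?_) (fun g ω h _ => hfβ g ω h)
  exact eq_one_of_cocycle_eq_zero hzp hcz ((hact g ω).1 h) h0

theorem zpow_mem_zpowers_pow_iff [Finite P] {u : P} {q : ℕ} (hq : orderOf u = q * p) (j : ℤ) :
    u ^ j ∈ Subgroup.zpowers (u ^ q) ↔ (q : ℤ) ∣ j := by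
  constructor
  · rintro ⟨t, ht⟩
    have h1 : ((q * p : ℕ) : ℤ) ∣ j - q * t := by
      rw [← hq, orderOf_dvd_iff_zpow_eq_one, zpow_sub, ← ht, zpow_mul, zpow_natCast]
      simp
    have h2 : (q : ℤ) ∣ j - q * t := (Int.natCast_dvd_natCast.2 (dvd_mul_right q p)).trans h1
    exact (dvd_sub_left (dvd_mul_right _ _)).1 h2
  · rintro ⟨t, rfl⟩
    exact ⟨t, by simp [zpow_mul]⟩

/-- Extending a common action along the central subgroups of order `p` of `⟨u⟩` and `⟨v⟩`: the cocycle
at `u` can be made equal to the cocycle at `v`, since the sums of both over the orbits are `1`. -/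
theorem HasCommonAction.of_quotient_quotient (hp : p.Prime) [Finite P] [Finite Q] {u : P} {v : Q}
    {q : ℕ} (hq0 : 0 < q) (hu : orderOf u = q * p) (hv : orderOf v = q * p)
    (hz : u ^ q ∈ Subgroup.center P) (hz' : v ^ q ∈ Subgroup.center Q)
    [(Subgroup.zpowers (u ^ q)).Normal] [(Subgroup.zpowers (v ^ q)).Normal]
    (h : HasCommonAction p (u : P ⧸ Subgroup.zpowers (u ^ q)) (v : Q ⧸ Subgroup.zpowers (v ^ q))) :
    HasCommonAction p u v := by
  obtain ⟨Ω, h1, h2, Γ, α, β, hΓ, hα, hβ, huv, hfα, hfβ⟩ := h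
  have hact := action_eq_iff_mem_zpowers hfα
  have hact' := action_eq_iff_mem_zpowers hfβ
  have hzp : orderOf (u ^ q) = p := by
    rw [orderOf_pow_of_dvd hq0.ne' ⟨p, hu⟩, hu, Nat.mul_div_cancel_left _ hq0]
  have hzp' : orderOf (v ^ q) = p := by
    rw [orderOf_pow_of_dvd hq0.ne' ⟨p, hv⟩, hv, Nat.mul_div_cancel_left _ hq0]
  set α' := α.comp (QuotientGroup.mk' (Subgroup.zpowers (u ^ q)))
  set β' := β.comp (QuotientGroup.mk' (Subgroup.zpowers (v ^ q)))
  have huv' : α' u = β' v := huv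
  obtain ⟨c', hc', hcz'⟩ := exists_cocycle β' hz' hzp' hact'
  obtain ⟨c, hc, hcz, hcu⟩ := exists_cocycle_eq α' hz hzp hact u q hq0
    (zpow_mem_zpowers_pow_iff hu) 1 (zpow_one _).symm (c' v) (fun ω => by
      rw [huv', ← cocycle_pow β' c' hc', ← hcz' 1 ω, zpow_one])
  refine hasCommonAction_of_cocycles hp hΓ α' β' (fun g => hα _) (fun g => hβ _) huv' c hc c' hc' hcu
    (fun g ω h h0 => ?_) (fun g ω h h0 => ?_)
  · exact eq_one_of_cocycle_eq_zero hzp hcz ((hact g ω).1 h) h0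
  · exact eq_one_of_cocycle_eq_zero hzp' hcz' ((hact' g ω).1 h) h0

end CommonAction

/-- Higman's theorem for cyclic subgroups: two finite `p`-groups with cyclic subgroups `⟨u⟩` and
`⟨v⟩` of the same order embed in a common finite `p`-group identifying `u` with `v`. -/
theorem hasCommonAction_of_orderOf_eq.{u₁, u₂} {p : ℕ} (hp : p.Prime) (n : ℕ) :
    ∀ (P : Type u₁) (Q : Type u₂) [Group P] [Group Q] [Finite P] [Finite Q], IsPGroup p P →
      IsPGroup p Q → Nat.card P + Nat.card Q = n → ∀ (u : P) (v : Q), orderOf u = orderOf v →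
      HasCommonAction p u v := by
  induction n using Nat.strong_induction_on with
  | _ n ih =>
  intro P Q _ _ _ _ hP hQ hn u v huv
  rcases subsingleton_or_nontrivial P with hsP | hnP
  · rcases subsingleton_or_nontrivial Q with hsQ | hnQ
    · refine ⟨Unit, inferInstance, inferInstance, ⊥, 1, 1, IsPGroup.of_bot, fun _ => one_mem _,
        fun _ => one_mem _, rfl, fun g _ _ => Subsingleton.elim g 1, fun g _ _ => Subsingleton.elim g 1⟩
    · have hv : v = 1 := by
        rw [← orderOf_eq_one_iff, ← huv, Subsingleton.elim u 1, orderOf_one]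
      have := Fact.mk hp
      rcases hQ.central_dichotomy hp v with ⟨z, hz, hzp, hzu⟩ | ⟨q, hq0, hq, hqc⟩
      · have := normal_zpowers_of_mem_center hz
        have hzv : ∀ j : ℤ, v ^ j ∈ Subgroup.zpowers z ↔ ((orderOf v : ℕ) : ℤ) ∣ j := fun j => by
          rw [orderOf_dvd_iff_zpow_eq_one]
          exact ⟨fun h => hzu _ h ⟨j, rfl⟩, fun h => h ▸ one_mem _⟩
        refine (HasCommonAction.of_quotient_left hp hz hzp hzu
          (ih _ ?_ P _ hP (hQ.to_quotient _) rfl u _ ?_).symm).symm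
        · have := card_quotient_zpowers_lt (hzp ▸ hp.one_lt : 1 < orderOf z)
          omega
        · rw [orderOf_quotientMk hzv, huv]
      · rw [hv, orderOf_one] at hq
        exact absurd (Nat.eq_one_of_mul_eq_one_left hq.symm) hp.ne_one
  · rcases hP.central_dichotomy hp u with ⟨z, hz, hzp, hzu⟩ | ⟨q, hq0, hq, hqc⟩
    · have := normal_zpowers_of_mem_center hz
      have hzv : ∀ j : ℤ, u ^ j ∈ Subgroup.zpowers z ↔ ((orderOf u : ℕ) : ℤ) ∣ j := fun j => by
        rw [orderOf_dvd_iff_zpow_eq_one]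
        exact ⟨fun h => hzu _ h ⟨j, rfl⟩, fun h => h ▸ one_mem _⟩
      refine HasCommonAction.of_quotient_left hp hz hzp hzu
        (ih _ ?_ _ Q (hP.to_quotient _) hQ rfl _ v ?_)
      · have := card_quotient_zpowers_lt (hzp ▸ hp.one_lt : 1 < orderOf z)
        omega
      · rw [orderOf_quotientMk hzv, huv]
    · have hnQ : Nontrivial Q := by
        refine ⟨v, 1, fun h => ?_⟩
        rw [h, orderOf_one] at huv
        rw [huv] at hq
        exact hp.ne_one (Nat.eq_one_of_mul_eq_one_left hq.symm)
      rcases hQ.central_dichotomy hp v with ⟨z, hz, hzp, hzu⟩ | ⟨q', hq0', hq', hqc'⟩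
      · have := normal_zpowers_of_mem_center hz
        have hzv : ∀ j : ℤ, v ^ j ∈ Subgroup.zpowers z ↔ ((orderOf v : ℕ) : ℤ) ∣ j := fun j => by
          rw [orderOf_dvd_iff_zpow_eq_one]
          exact ⟨fun h => hzu _ h ⟨j, rfl⟩, fun h => h ▸ one_mem _⟩
        refine (HasCommonAction.of_quotient_left hp hz hzp hzu
          (ih _ ?_ P _ hP (hQ.to_quotient _) rfl u _ ?_).symm).symm
        · have := card_quotient_zpowers_lt (hzp ▸ hp.one_lt : 1 < orderOf z)
          omega
        · rw [orderOf_quotientMk hzv, huv]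
      · obtain rfl : q = q' := by
          rw [huv, hq'] at hq
          exact (Nat.eq_of_mul_eq_mul_right hp.pos hq).symm
        have := normal_zpowers_of_mem_center hqc
        have := normal_zpowers_of_mem_center hqc'
        refine HasCommonAction.of_quotient_quotient hp hq0 hq hq' hqc hqc'
          (ih _ ?_ _ _ (hP.to_quotient _) (hQ.to_quotient _) rfl _ _ ?_)
        · have h1 : 1 < orderOf (u ^ q) := by
            rw [orderOf_pow_of_dvd hq0.ne' ⟨p, hq⟩, hq, Nat.mul_div_cancel_left _ hq0]
            exact hp.one_lt
          have h2 : 1 < orderOf (v ^ q) := by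
            rw [orderOf_pow_of_dvd hq0.ne' ⟨p, hq'⟩, hq', Nat.mul_div_cancel_left _ hq0]
            exact hp.one_lt
          have := card_quotient_zpowers_lt h1
          have := card_quotient_zpowers_lt h2
          omega
        · rw [orderOf_quotientMk (zpow_mem_zpowers_pow_iff hq),
            orderOf_quotientMk (zpow_mem_zpowers_pow_iff hq')]

/-! ### Common finite actions of two residually `p` groups -/

section OrderMatching

variable {p : ℕ}

theorem IsPGroup.exists_central_mem_normal (hp : p.Prime) {P : Type*} [Group P] [Finite P]
    (hP : IsPGroup p P) (T : Subgroup P) [T.Normal] (hT : T ≠ ⊥) :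
    ∃ z ∈ T, z ∈ Subgroup.center P ∧ orderOf z = p := by
  have := Fact.mk hp
  have hn : Nontrivial T := T.nontrivial_iff_ne_bot.2 hT
  have hdvd : p ∣ Nat.card T := ((hP.to_subgroup T).card_eq_or_dvd).resolve_left Finite.one_lt_card.ne'
  let : MulAction P T := MulAction.compHom T (MulAut.conjNormal : P →* MulAut T)
  have hsmul : ∀ (g : P) (t : T), ((g • t : T) : P) = g * t * g⁻¹ := fun g t =>
    MulAut.conjNormal_apply g t
  obtain ⟨b, hb, hb1⟩ := hP.exists_fixed_point_of_prime_dvd_card_of_fixed_point T hdvd (a := 1)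
    (fun g => Subtype.ext (by rw [hsmul]; simp))
  have hbc : (b : P) ∈ Subgroup.center P := by
    rw [Subgroup.mem_center_iff]
    intro g
    have := congrArg Subtype.val (hb g)
    rw [hsmul] at this
    exact mul_inv_eq_iff_eq_mul.1 this
  obtain ⟨q, hq⟩ := hP.dvd_orderOf (g := (b : P)) (fun h => hb1 (Subtype.ext h.symm))
  refine ⟨(b : P) ^ q, T.pow_mem b.2 q, Subgroup.pow_mem _ hbc q, ?_⟩
  have h0 : q ≠ 0 := by
    rintro rfl
    exact (orderOf_pos (b : P)).ne' (by rw [hq, mul_zero])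
  rw [orderOf_pow_of_dvd h0 ⟨p, by rw [hq, mul_comm]⟩, hq, Nat.mul_div_cancel _ (Nat.pos_of_ne_zero h0)]

/-- A nontrivial element of a normal subgroup of a finite `p`-group can be made to have order
exactly `p` by factoring out a smaller normal subgroup. -/
theorem IsPGroup.exists_normal_pow_mem.{w} (hp : p.Prime) (c : ℕ) :
    ∀ (P : Type w) [Group P] [Finite P], IsPGroup p P → Nat.card P = c → ∀ (T : Subgroup P),
      T.Normal → ∀ w ∈ T, w ≠ 1 → ∃ M : Subgroup P, M.Normal ∧ M ≤ T ∧ w ∉ M ∧ w ^ p ∈ M := by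
  induction c using Nat.strong_induction_on with
  | _ c ih =>
  intro P _ _ hP hc T hT w hw hw1
  obtain ⟨z, hzT, hz, hzp⟩ := hP.exists_central_mem_normal hp T
    (fun h => hw1 (by rw [h] at hw; exact hw))
  by_cases hwz : w ∈ Subgroup.zpowers z
  · refine ⟨⊥, inferInstance, bot_le, hw1, ?_⟩
    obtain ⟨k, rfl⟩ := hwz
    simp only
    rw [Subgroup.mem_bot, ← zpow_natCast, ← zpow_mul, mul_comm, zpow_mul, zpow_natCast, ← hzp,
      pow_orderOf_eq_one, one_zpow]
  · have := normal_zpowers_of_mem_center hz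
    have hlt := card_quotient_zpowers_lt (hzp ▸ hp.one_lt : 1 < orderOf z)
    obtain ⟨M, hM, hMT, hwM, hwpM⟩ := ih _ (hc ▸ hlt) (P ⧸ Subgroup.zpowers z) (hP.to_quotient _) rfl
      (T.map (QuotientGroup.mk' _)) (hT.map _ (QuotientGroup.mk'_surjective _)) (w : _ ⧸ _)
      ⟨w, hw, rfl⟩ (fun h => hwz ((QuotientGroup.eq_one_iff w).1 h))
    refine ⟨M.comap (QuotientGroup.mk' _), inferInstance, fun x hx => ?_, hwM, hwpM⟩
    obtain ⟨t, ht, htx⟩ := hMT hx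
    have h1 : t⁻¹ * x ∈ Subgroup.zpowers z := QuotientGroup.eq.1 htx
    have h2 := T.mul_mem ht (Subgroup.zpowers_le.2 hzT h1)
    rwa [mul_inv_cancel_left] at h2

variable {A B : Type*} [Group A] [Group B]

theorem IsPOpen.exists_pow_mem_pow_not_mem (hp : p.Prime) {N : Subgroup A} (hN : IsPOpen p N)
    (hA : IsResiduallyP p A) {w : A} (hw : w ∈ N) (hw1 : w ≠ 1) :
    ∃ M, IsPOpen p M ∧ M ≤ N ∧ w ∉ M ∧ w ^ p ∈ M := by
  obtain ⟨N', hN', hwN'⟩ := hA w hw1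
  have hL := hN'.inf hN
  set L := N' ⊓ N
  have := hL.normal
  have := hL.finiteIndex
  have := hN.normal
  obtain ⟨M, hM, hMT, hwM, hwpM⟩ := IsPGroup.exists_normal_pow_mem hp _ (A ⧸ L)
    hL.isPGroup_quotient rfl (N.map (QuotientGroup.mk' L))
    (this.map _ (QuotientGroup.mk'_surjective _)) (w : A ⧸ L) ⟨w, hw, rfl⟩
    (fun h => hwN' ((QuotientGroup.eq_one_iff w).1 h).1)
  have hMo : IsPOpen p M := by
    obtain ⟨k, hk⟩ := hL.isPGroup_quotient.exists_uniform_pow hp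
    exact ⟨hM, inferInstance, k, fun g => by rw [hk]; exact one_mem _⟩
  refine ⟨M.comap (QuotientGroup.mk' L), hMo.comap _, fun x hx => ?_, hwM, hwpM⟩
  obtain ⟨t, ht, htx⟩ := hMT hx
  have h1 : t⁻¹ * x ∈ L := QuotientGroup.eq.1 htx
  have h2 := N.mul_mem ht h1.2
  rwa [mul_inv_cancel_left] at h2

theorem zpow_mem_iff_of_pow {M : Subgroup A} {u : A} (hp : p.Prime) {ρ : ℕ} (h : u ^ p ^ (ρ + 1) ∈ M)
    (h' : u ^ p ^ ρ ∉ M) (j : ℤ) : u ^ j ∈ M ↔ ((p ^ (ρ + 1) : ℕ) : ℤ) ∣ j := by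
  constructor
  · intro hj
    have h1 : u ^ (Int.gcd j (p ^ (ρ + 1) : ℕ)) ∈ M := by
      rw [← zpow_natCast, Int.gcd_eq_gcd_ab, zpow_add, zpow_mul, zpow_mul, zpow_natCast]
      exact M.mul_mem (M.zpow_mem hj _) (M.zpow_mem h _)
    obtain ⟨i, hi, hi'⟩ := (Nat.dvd_prime_pow hp).1
      (Int.natCast_dvd_natCast.1 (Int.gcd_dvd_right j ((p ^ (ρ + 1) : ℕ) : ℤ)))
    rw [hi'] at h1
    have h2 : i = ρ + 1 := by
      by_contra hne
      obtain ⟨s, hs⟩ := Nat.exists_eq_add_of_le (show i ≤ ρ by omega)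
      apply h'
      rw [hs, pow_add, pow_mul]
      exact M.pow_mem h1 _
    rw [h2] at hi'
    have h3 := Int.gcd_dvd_left j ((p ^ (ρ + 1) : ℕ) : ℤ)
    rwa [hi'] at h3
  · rintro ⟨t, rfl⟩
    rw [zpow_mul, zpow_natCast]
    exact M.zpow_mem h _

/-- For an element of infinite order in a residually `p` group, all sufficiently large powers of `p`
are orders of its image modulo arbitrarily small open subgroups. -/
theorem IsPOpen.exists_order_eq (hp : p.Prime) (hA : IsResiduallyP p A) {u : A}
    (hu : ∀ n : ℤ, n ≠ 0 → u ^ n ≠ 1) {N : Subgroup A} (hN : IsPOpen p N) :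
    ∃ ρ₀ : ℕ, ∀ ρ ≥ ρ₀, ∃ M, IsPOpen p M ∧ M ≤ N ∧ ∀ j : ℤ, u ^ j ∈ M ↔ ((p ^ ρ : ℕ) : ℤ) ∣ j := by
  obtain ⟨k, hk⟩ := hN.exists_pow_mem
  have hne : ∀ ρ : ℕ, u ^ p ^ ρ ≠ 1 := fun ρ h =>
    hu ((p ^ ρ : ℕ) : ℤ) (by exact_mod_cast (pow_ne_zero _ hp.ne_zero)) (by rwa [zpow_natCast])
  have key : ∀ ρ ≥ k, ∃ M, IsPOpen p M ∧ M ≤ N ∧ u ^ p ^ ρ ∉ M ∧ u ^ p ^ (ρ + 1) ∈ M := by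
    intro ρ hρ
    induction ρ, hρ using Nat.le_induction with
    | base =>
      obtain ⟨M, h1, h2, h3, h4⟩ := hN.exists_pow_mem_pow_not_mem hp hA (hk u) (hne k)
      exact ⟨M, h1, h2, h3, by rwa [pow_succ, pow_mul]⟩
    | succ ρ hρ ih =>
      obtain ⟨M, h1, h2, -, h3⟩ := ih
      obtain ⟨M', h4, h5, h6, h7⟩ := h1.exists_pow_mem_pow_not_mem hp hA h3 (hne _)
      exact ⟨M', h4, h5.trans h2, h6, by rwa [pow_succ p (ρ + 1), pow_mul]⟩
  refine ⟨k + 1, fun ρ hρ => ?_⟩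
  obtain ⟨M, h1, h2, h3, h4⟩ := key (ρ - 1) (by omega)
  rw [show ρ = ρ - 1 + 1 by omega]
  exact ⟨M, h1, h2, zpow_mem_iff_of_pow hp h4 h3⟩

/-- Two elements which are both trivial or both of infinite order. -/
def SameOrder (u : A) (v : B) : Prop :=
  ((∀ n : ℤ, n ≠ 0 → u ^ n ≠ 1) ∧ ∀ n : ℤ, n ≠ 0 → v ^ n ≠ 1) ∨ u = 1 ∧ v = 1

theorem SameOrder.symm {u : A} {v : B} (h : SameOrder u v) : SameOrder v u :=
  h.imp And.symm And.symm

/-- Arbitrarily small open subgroups of `A` and `B` induce the same subgroup of exponents on the powers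
of `u` and `v`. -/
theorem IsPOpen.exists_matching (hp : p.Prime) (hA : IsResiduallyP p A) (hB : IsResiduallyP p B)
    {u : A} {v : B} (huv : SameOrder u v) {N : Subgroup A} (hN : IsPOpen p N) {M : Subgroup B}
    (hM : IsPOpen p M) :
    ∃ N' M', IsPOpen p N' ∧ N' ≤ N ∧ IsPOpen p M' ∧ M' ≤ M ∧ ∀ j : ℤ, u ^ j ∈ N' ↔ v ^ j ∈ M' := by
  rcases huv with ⟨hu, hv⟩ | ⟨rfl, rfl⟩
  · obtain ⟨ρ, hρ⟩ := hN.exists_order_eq hp hA hu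
    obtain ⟨σ, hσ⟩ := hM.exists_order_eq hp hB hv
    obtain ⟨N', h1, h2, h3⟩ := hρ (max ρ σ) (le_max_left _ _)
    obtain ⟨M', h4, h5, h6⟩ := hσ (max ρ σ) (le_max_right _ _)
    exact ⟨N', M', h1, h2, h4, h5, fun j => (h3 j).trans (h6 j).symm⟩
  · exact ⟨N, M, hN, le_rfl, hM, le_rfl, fun j => by simp [one_mem]⟩

open Equiv in
/-- Finite `p`-quotients of `A` and `B` can be made to act compatibly with the identification
of `u` and `v`, with arbitrarily small point stabilizers. -/
theorem exists_common_action (hp : p.Prime) (hA : IsResiduallyP p A) (hB : IsResiduallyP p B)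
    {u : A} {v : B} (huv : SameOrder u v) {N : Subgroup A} (hN : IsPOpen p N) {M : Subgroup B}
    (hM : IsPOpen p M) :
    ∃ (Ω : Type) (_ : Finite Ω) (_ : Nonempty Ω) (Γ : Subgroup (Perm Ω)) (α : A →* Perm Ω)
      (β : B →* Perm Ω), IsPGroup p Γ ∧ (∀ g, α g ∈ Γ) ∧ (∀ g, β g ∈ Γ) ∧ α u = β v ∧
        (∀ g ω, α g ω = ω → g ∈ N) ∧ ∀ g ω, β g ω = ω → g ∈ M := by
  obtain ⟨N', M', hN', hNN', hM', hMM', hj⟩ := IsPOpen.exists_matching hp hA hB huv hN hM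
  have := hN'.normal
  have := hM'.normal
  have := hN'.finiteIndex
  have := hM'.finiteIndex
  have hord : orderOf (u : A ⧸ N') = orderOf (v : B ⧸ M') := by
    apply Nat.dvd_antisymm
    · rw [orderOf_dvd_iff_pow_eq_one, ← QuotientGroup.mk_pow, QuotientGroup.eq_one_iff,
        ← zpow_natCast, hj, zpow_natCast, ← QuotientGroup.eq_one_iff, QuotientGroup.mk_pow,
        pow_orderOf_eq_one]
    · rw [orderOf_dvd_iff_pow_eq_one, ← QuotientGroup.mk_pow, QuotientGroup.eq_one_iff,
        ← zpow_natCast, ← hj, zpow_natCast, ← QuotientGroup.eq_one_iff, QuotientGroup.mk_pow,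
        pow_orderOf_eq_one]
  obtain ⟨Ω, h1, h2, Γ, α, β, hΓ, hα, hβ, huv', hfα, hfβ⟩ := hasCommonAction_of_orderOf_eq hp _
    (A ⧸ N') (B ⧸ M') hN'.isPGroup_quotient hM'.isPGroup_quotient rfl _ _ hord
  exact ⟨Ω, h1, h2, Γ, α.comp (QuotientGroup.mk' N'), β.comp (QuotientGroup.mk' M'), hΓ,
    fun g => hα _, fun g => hβ _, huv', fun g ω h => hNN' ((QuotientGroup.eq_one_iff g).1 (hfα _ ω h)),
    fun g ω h => hMM' ((QuotientGroup.eq_one_iff g).1 (hfβ _ ω h))⟩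

end OrderMatching

/-! ### Amalgams along cyclic subgroups -/

section Amalgam

variable {A B G : Type*} [Group A] [Group B] [Group G]

/-- `G` is generated by images of `A` and `B` in which `u` and `v` are identified, and is universal
with respect to groups in the universe of finite groups: the free product of `A` and `B` with `u` and
`v` amalgamated, as far as its finite quotients are concerned. -/
structure IsAmalgam (iA : A →* G) (iB : B →* G) (u : A) (v : B) : Prop where
  comm : iA u = iB v
  closure_eq_top : Subgroup.closure (Set.range iA ∪ Set.range iB) = ⊤
  exists_lift : ∀ (Q : Type) [Group Q] (α : A →* Q) (β : B →* Q), α u = β v →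
    ∃ Φ : G →* Q, (∀ a, Φ (iA a) = α a) ∧ ∀ b, Φ (iB b) = β b

/-- The product `a₁ b₁ ⋯ aₗ bₗ` in `G`. -/
def altProd (iA : A →* G) (iB : B →* G) (L : List (A × B)) : G :=
  (L.map fun x => iA x.1 * iB x.2).prod

/-- No factor of the alternating product lies in the amalgamated subgroup. -/
def IsReducedList (u : A) (v : B) (L : List (A × B)) : Prop :=
  ∀ x ∈ L, x.1 ∉ Subgroup.zpowers u ∧ x.2 ∉ Subgroup.zpowers v

variable {iA : A →* G} {iB : B →* G} {u : A} {v : B}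

@[simp] theorem altProd_nil : altProd iA iB [] = 1 := rfl

@[simp] theorem altProd_cons (x : A × B) (L : List (A × B)) :
    altProd iA iB (x :: L) = iA x.1 * iB x.2 * altProd iA iB L := by
  simp [altProd]

@[simp] theorem altProd_append (L L' : List (A × B)) :
    altProd iA iB (L ++ L') = altProd iA iB L * altProd iA iB L' := by
  simp [altProd]

theorem IsReducedList.cons {x : A × B} {L : List (A × B)} (hL : IsReducedList u v L)
    (h1 : x.1 ∉ Subgroup.zpowers u) (h2 : x.2 ∉ Subgroup.zpowers v) : IsReducedList u v (x :: L) := by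
  intro y hy
  rcases List.mem_cons.1 hy with rfl | hy
  · exact ⟨h1, h2⟩
  · exact hL y hy

theorem IsReducedList.tail {x : A × B} {L : List (A × B)} (hL : IsReducedList u v (x :: L)) :
    IsReducedList u v L := fun y hy => hL y (List.mem_cons_of_mem _ hy)

theorem IsAmalgam.symm (hG : IsAmalgam iA iB u v) : IsAmalgam iB iA v u where
  comm := hG.comm.symm
  closure_eq_top := by rw [Set.union_comm]; exact hG.closure_eq_top
  exists_lift Q _ α β h := by
    obtain ⟨Φ, h1, h2⟩ := hG.exists_lift Q β α h.symm
    exact ⟨Φ, h2, h1⟩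

theorem IsAmalgam.comm_zpow (hG : IsAmalgam iA iB u v) (j : ℤ) : iA (u ^ j) = iB (v ^ j) := by
  rw [map_zpow, map_zpow, hG.comm]

/-- Every element outside the image of `A` has a reduced expression. -/
theorem IsAmalgam.exists_expression (hG : IsAmalgam iA iB u v) (g : G) :
    (∃ a, g = iA a) ∨ ∃ (a : A) (b : B) (L : List (A × B)) (a' : A), b ∉ Subgroup.zpowers v ∧
      IsReducedList u v L ∧ g = iA a * iB b * altProd iA iB L * iA a' := by
  have hg : g ∈ Subgroup.closure (Set.range iA ∪ Set.range iB) := by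
    rw [hG.closure_eq_top]; trivial
  have hA : ∀ (c : A) (g : G), ((∃ a, g = iA a) ∨ ∃ (a : A) (b : B) (L : List (A × B)) (a' : A),
      b ∉ Subgroup.zpowers v ∧ IsReducedList u v L ∧ g = iA a * iB b * altProd iA iB L * iA a') →
      ((∃ a, iA c * g = iA a) ∨ ∃ (a : A) (b : B) (L : List (A × B)) (a' : A),
      b ∉ Subgroup.zpowers v ∧ IsReducedList u v L ∧
        iA c * g = iA a * iB b * altProd iA iB L * iA a') := by
    rintro c g (⟨a, rfl⟩ | ⟨a, b, L, a', hb, hL, rfl⟩)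
    · exact Or.inl ⟨c * a, (map_mul _ _ _).symm⟩
    · exact Or.inr ⟨c * a, b, L, a', hb, hL, by rw [map_mul]; simp only [mul_assoc]⟩
  have hB : ∀ (c : B) (g : G), ((∃ a, g = iA a) ∨ ∃ (a : A) (b : B) (L : List (A × B)) (a' : A),
      b ∉ Subgroup.zpowers v ∧ IsReducedList u v L ∧ g = iA a * iB b * altProd iA iB L * iA a') →
      ((∃ a, iB c * g = iA a) ∨ ∃ (a : A) (b : B) (L : List (A × B)) (a' : A),
      b ∉ Subgroup.zpowers v ∧ IsReducedList u v L ∧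
        iB c * g = iA a * iB b * altProd iA iB L * iA a') := by
    rintro c g hg
    by_cases hc : c ∈ Subgroup.zpowers v
    · obtain ⟨j, rfl⟩ := hc
      simp only [← hG.comm_zpow]
      exact hA _ _ hg
    rcases hg with ⟨a, rfl⟩ | ⟨a, b, L, a', hb, hL, rfl⟩
    · exact Or.inr ⟨1, c, [], a, hc, by simp [IsReducedList], by simp⟩
    by_cases ha : a ∈ Subgroup.zpowers u
    · obtain ⟨j, rfl⟩ := ha
      have h1 : iB c * (iA (u ^ j) * iB b * altProd iA iB L * iA a') =
          iB (c * v ^ j * b) * altProd iA iB L * iA a' := by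
        rw [hG.comm_zpow, map_mul, map_mul]; simp only [mul_assoc]
      simp only
      rw [h1]
      by_cases hb' : c * v ^ j * b ∈ Subgroup.zpowers v
      · obtain ⟨k, hk⟩ := hb'
        simp only at hk
        rw [← hk, ← hG.comm_zpow]
        rcases L with _ | ⟨x, L⟩
        · exact Or.inl ⟨u ^ k * a', by simp⟩
        · exact Or.inr ⟨u ^ k * x.1, x.2, L, a', (hL x List.mem_cons_self).2, hL.tail, by
            rw [altProd_cons, map_mul]; simp only [mul_assoc]⟩
      · exact Or.inr ⟨1, _, L, a', hb', hL, by simp⟩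
    · exact Or.inr ⟨1, c, (a, b) :: L, a', hc, hL.cons ha hb, by
        rw [altProd_cons]; simp [mul_assoc]⟩
  induction hg using Subgroup.closure_induction_left with
  | one => exact Or.inl ⟨1, (map_one _).symm⟩
  | mul_left x hx y _ ih =>
    rcases hx with ⟨a, rfl⟩ | ⟨b, rfl⟩
    · exact hA _ _ ih
    · exact hB _ _ ih
  | inv_mul_cancel x hx y _ ih =>
    rcases hx with ⟨a, rfl⟩ | ⟨b, rfl⟩
    · rw [← map_inv]; exact hA _ _ ih
    · rw [← map_inv]; exact hB _ _ ih

/-- Every element is conjugate to an element of a factor or to a cyclically reduced product. -/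
theorem IsAmalgam.exists_conj (hG : IsAmalgam iA iB u v) (g : G) :
    ∃ c : G, (∃ a, c * g * c⁻¹ = iA a) ∨ (∃ b, c * g * c⁻¹ = iB b) ∨
      ∃ L : List (A × B), L ≠ [] ∧ IsReducedList u v L ∧ c * g * c⁻¹ = altProd iA iB L := by
  have trans : ∀ g g' d : G, d * g * d⁻¹ = g' → (∃ c : G, (∃ a, c * g' * c⁻¹ = iA a) ∨
      (∃ b, c * g' * c⁻¹ = iB b) ∨
      ∃ L : List (A × B), L ≠ [] ∧ IsReducedList u v L ∧ c * g' * c⁻¹ = altProd iA iB L) →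
      ∃ c : G, (∃ a, c * g * c⁻¹ = iA a) ∨ (∃ b, c * g * c⁻¹ = iB b) ∨
      ∃ L : List (A × B), L ≠ [] ∧ IsReducedList u v L ∧ c * g * c⁻¹ = altProd iA iB L := by
    rintro g _ d rfl ⟨c, hc⟩
    refine ⟨c * d, ?_⟩
    have : c * d * g * (c * d)⁻¹ = c * (d * g * d⁻¹) * c⁻¹ := by group
    rw [this]
    exact hc
  have hAbase : ∀ a, ∃ c : G, (∃ a', c * iA a * c⁻¹ = iA a') ∨ (∃ b, c * iA a * c⁻¹ = iB b) ∨
      ∃ L : List (A × B), L ≠ [] ∧ IsReducedList u v L ∧ c * iA a * c⁻¹ = altProd iA iB L :=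
    fun a => ⟨1, Or.inl ⟨a, by simp⟩⟩
  suffices key : ∀ (n : ℕ) (L : List (A × B)), L.length = n → ∀ (a : A) (b : B) (a' : A),
      b ∉ Subgroup.zpowers v → IsReducedList u v L →
      ∃ c : G, (∃ d, c * (iA a * iB b * altProd iA iB L * iA a') * c⁻¹ = iA d) ∨
        (∃ d, c * (iA a * iB b * altProd iA iB L * iA a') * c⁻¹ = iB d) ∨
        ∃ L' : List (A × B), L' ≠ [] ∧ IsReducedList u v L' ∧
          c * (iA a * iB b * altProd iA iB L * iA a') * c⁻¹ = altProd iA iB L' by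
    rcases hG.exists_expression g with ⟨a, rfl⟩ | ⟨a, b, L, a', hb, hL, rfl⟩
    · exact hAbase a
    · exact key _ L rfl a b a' hb hL
  intro n
  induction n using Nat.strong_induction_on with
  | _ n ih =>
  intro L hn a b a' hb hL
  refine trans _ (iA (a' * a) * iB b * altProd iA iB L) (iA a') (by rw [map_mul]; group) ?_
  by_cases ha : a' * a ∈ Subgroup.zpowers u
  · obtain ⟨j, hj⟩ := ha
    simp only at hj
    rw [← hj, hG.comm_zpow, ← map_mul]
    rcases List.eq_nil_or_concat L with rfl | ⟨L', x, rfl⟩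
    · exact ⟨1, Or.inr (Or.inl ⟨v ^ j * b, by simp⟩)⟩
    rw [List.concat_eq_append] at *
    have hL' : IsReducedList u v L' := fun y hy => hL y (List.mem_append_left _ hy)
    have hlen : L'.length < n := by rw [← hn]; simp
    refine trans _ (iB (x.2 * (v ^ j * b)) * altProd iA iB L' * iA x.1) (iB x.2)
      (by simp; group) ?_
    by_cases hb' : x.2 * (v ^ j * b) ∈ Subgroup.zpowers v
    · obtain ⟨k, hk⟩ := hb'
      simp only at hk
      rw [← hk, ← hG.comm_zpow]
      rcases L' with _ | ⟨y, L'⟩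
      · simpa using hAbase (u ^ k * x.1)
      · have := ih L'.length (by simp at hlen; omega) L' rfl (u ^ k * y.1) y.2 x.1
          (hL' y List.mem_cons_self).2 hL'.tail
        have h1 : iA (u ^ k) * altProd iA iB (y :: L') * iA x.1 =
            iA (u ^ k * y.1) * iB y.2 * altProd iA iB L' * iA x.1 := by
          rw [altProd_cons, map_mul]; simp only [mul_assoc]
        rw [h1]
        exact this
    · have := ih L'.length hlen L' rfl 1 _ x.1 hb' hL'
      simpa using this
  · exact ⟨1, Or.inr (Or.inr ⟨(a' * a, b) :: L, by simp, hL.cons ha hb, by simp⟩)⟩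

theorem altProd_flatten_replicate (L : List (A × B)) (k : ℕ) :
    altProd iA iB (List.replicate k L).flatten = altProd iA iB L ^ k := by
  induction k with
  | zero => simp
  | succ k ih => rw [List.replicate_succ, List.flatten_cons, altProd_append, ih, pow_succ']

end Amalgam

section TwistedAction

open Equiv

variable {p : ℕ} {A B G : Type*} [Group A] [Group B] [Group G] {iA : A →* G} {iB : B →* G} {u : A}
  {v : B}

/-- The cocycle of an action of `B` which is the coboundary of `τ`. -/
def TwistedPerm.coboundary {Ω O V : Type*} [Group V] (β : B →* Perm Ω) (o : Ω → O) (τ : O → V) :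
    B →* TwistedPerm Ω V :=
  MonoidHom.mk' (fun b => ⟨β b, fun ω => τ (o (β b ω)) * (τ (o ω))⁻¹⟩) fun b b' => by
    ext ω
    · simp
    · simp

/-- The trivially twisted action. -/
def TwistedPerm.untwisted {Ω V : Type*} [Group V] (α : A →* Perm Ω) : A →* TwistedPerm Ω V :=
  MonoidHom.mk' (fun a => ⟨α a, fun _ => 1⟩) fun a a' => by
    ext ω
    · simp
    · simp

/-- A common action of `A` and `B`, untwisted on `A` and twisted on `B` by the coboundary of a function
which is constant on the orbits of `u`. -/
theorem IsAmalgam.exists_twistedPerm (hG : IsAmalgam iA iB u v) {Ω O V : Type} [Group V]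
    (α : A →* Perm Ω) (β : B →* Perm Ω) (huv : α u = β v) (o : Ω → O)
    (ho : ∀ ω, o (α u ω) = o ω) (τ : O → V) :
    ∃ Φ : G →* TwistedPerm Ω V, (∀ a, (Φ (iA a)).perm = α a) ∧ (∀ a ω, (Φ (iA a)).twist ω = 1) ∧
      (∀ b, (Φ (iB b)).perm = β b) ∧
      ∀ b ω, (Φ (iB b)).twist ω = τ (o (β b ω)) * (τ (o ω))⁻¹ := by
  obtain ⟨Φ, h1, h2⟩ := hG.exists_lift (TwistedPerm Ω V) (TwistedPerm.untwisted α)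
    (TwistedPerm.coboundary β o τ) (by
      ext ω
      · exact congrArg (fun σ : Perm Ω => σ ω) huv
      · show 1 = τ (o (β v ω)) * (τ (o ω))⁻¹
        rw [← huv, ho, mul_inv_cancel])
  refine ⟨Φ, fun a => ?_, fun a ω => ?_, fun b => ?_, fun b ω => ?_⟩
  · rw [h1]; rfl
  · rw [h1]; rfl
  · rw [h2]; rfl
  · rw [h2]; rfl

theorem IsAmalgam.perm_mem (hG : IsAmalgam iA iB u v) {Ω V : Type} [Group V]
    {Γ : Subgroup (Perm Ω)} {Φ : G →* TwistedPerm Ω V} (hA : ∀ a, (Φ (iA a)).perm ∈ Γ)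
    (hB : ∀ b, (Φ (iB b)).perm ∈ Γ) (g : G) : (Φ g).perm ∈ Γ := by
  have : Subgroup.closure (Set.range iA ∪ Set.range iB) ≤
      Γ.comap ((TwistedPerm.permHom Ω V).comp Φ) := by
    rw [Subgroup.closure_le]
    rintro _ (⟨a, rfl⟩ | ⟨b, rfl⟩)
    · exact hA a
    · exact hB b
  rw [hG.closure_eq_top] at this
  exact this trivial

/-- The word in the values of `τ` which is the twist of an alternating product. -/
def twistWord {Ω O : Type} (α : A →* Perm Ω) (β : B →* Perm Ω) (o : Ω → O) :
    List (A × B) → Ω → List (O × ℤ)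
  | [], _ => []
  | x :: L, ω =>
    let ω' := (L.map fun y => α y.1 * β y.2).prod ω
    (o (β x.2 ω'), 1) :: (o ω', -1) :: twistWord α β o L ω

theorem twist_altProd {Ω O V : Type} [Group V] {α : A →* Perm Ω} {β : B →* Perm Ω} {o : Ω → O}
    {τ : O → V} {Φ : G →* TwistedPerm Ω V} (h1 : ∀ a, (Φ (iA a)).perm = α a)
    (h2 : ∀ a ω, (Φ (iA a)).twist ω = 1) (h3 : ∀ b, (Φ (iB b)).perm = β b)
    (h4 : ∀ b ω, (Φ (iB b)).twist ω = τ (o (β b ω)) * (τ (o ω))⁻¹) (L : List (A × B)) (ω : Ω) :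
    (Φ (altProd iA iB L)).perm = (L.map fun y => α y.1 * β y.2).prod ∧
    (Φ (altProd iA iB L)).twist ω = ((twistWord α β o L ω).map fun x => τ x.1 ^ x.2).prod := by
  induction L with
  | nil => simp [twistWord]
  | cons x L ih =>
    obtain ⟨ih1, ih2⟩ := ih
    constructor
    · simp [ih1, h1, h3]
    · rw [altProd_cons, map_mul, map_mul, TwistedPerm.twist_mul, TwistedPerm.twist_mul, ih1, ih2, h2,
        h4, twistWord]
      simp [mul_assoc]

/-- If no factor maps a point into its own orbit, then consecutive letters of the word are distinct. -/
theorem twistWord_isChain {Ω O : Type} {α : A →* Perm Ω} {β : B →* Perm Ω} {o : Ω → O}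
    (L : List (A × B)) (hα : ∀ x ∈ L, ∀ ω, o (α x.1 ω) ≠ o ω)
    (hβ : ∀ x ∈ L, ∀ ω, o (β x.2 ω) ≠ o ω) (ω : Ω) :
    ((twistWord α β o L ω).IsChain fun x y => x.1 ≠ y.1) ∧
      ∀ y ∈ (twistWord α β o L ω).head?, ∀ x ∈ L.head?,
        y.1 ≠ o ((L.map fun y => α y.1 * β y.2).prod ω) := by
  induction L with
  | nil => simp [twistWord]
  | cons x L ih =>
    obtain ⟨ih1, ih2⟩ := ih (fun y hy => hα y (List.mem_cons_of_mem _ hy))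
      (fun y hy => hβ y (List.mem_cons_of_mem _ hy))
    rw [twistWord]
    constructor
    · refine List.IsChain.cons_cons (hβ x List.mem_cons_self _) ?_
      rw [List.isChain_cons]
      refine ⟨fun y hy => ?_, ih1⟩
      have hL : ∃ z, z ∈ L.head? := by
        cases L with
        | nil => simp [twistWord] at hy
        | cons z L => exact ⟨z, rfl⟩
      obtain ⟨z, hz⟩ := hL
      exact (ih2 y hy z hz).symm
    · intro y hy z _
      simp only [List.head?_cons, Option.mem_def, Option.some.injEq] at hy
      subst hy
      simp only [List.map_cons, List.prod_cons, Perm.mul_apply]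
      exact (hα x List.mem_cons_self _).symm

theorem twistWord_exponent {Ω O : Type} {α : A →* Perm Ω} {β : B →* Perm Ω} {o : Ω → O}
    (L : List (A × B)) (ω : Ω) : ∀ y ∈ twistWord α β o L ω, y.2 ≠ 0 := by
  induction L with
  | nil => simp [twistWord]
  | cons x L ih =>
    rw [twistWord]
    intro y hy
    simp only [List.mem_cons] at hy
    rcases hy with rfl | rfl | hy
    · simp
    · simp
    · exact ih y hy

/-- The orbits of a permutation. -/
abbrev CycleSpace {Ω : Type} (σ : Perm Ω) : Type := Quotient (Perm.SameCycle.setoid σ)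

theorem cycleSpace_mk_eq {Ω : Type} {σ : Perm Ω} {ω ω' : Ω} :
    (Quotient.mk _ ω : CycleSpace σ) = Quotient.mk _ ω' ↔ ∃ j : ℤ, (σ ^ j) ω = ω' :=
  Quotient.eq

/-- Reduced products are detected by homomorphisms to twisted permutations with values in an integral
unitriangular group: let `A` and `B` act compatibly on `Ω`, and twist the action of `B` by the
coboundary of a function `τ` on the orbits of `u`. The permutation group depends only on the
factors which occur, not on the product. -/
theorem IsAmalgam.exists_separating (hp : p.Prime) (hG : IsAmalgam iA iB u v)
    (hA : IsResiduallyP p A) (hB : IsResiduallyP p B) (huv : SameOrder u v)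
    (hu : IsPClosedZPowers p u) (hv : IsPClosedZPowers p v) (lA : List A) (lB : List B)
    (hlA : ∀ a ∈ lA, a ∉ Subgroup.zpowers u) (hlB : ∀ b ∈ lB, b ∉ Subgroup.zpowers v) :
    ∃ (Ω : Type) (_ : Finite Ω) (Γ : Subgroup (Perm Ω)), IsPGroup p Γ ∧
      ∀ (b : B) (L : List (A × B)), b ∈ lB → (∀ x ∈ L, x.1 ∈ lA ∧ x.2 ∈ lB) →
      ∃ (d : ℕ) (Φ : G →* TwistedPerm Ω (Unitriangular d ℤ)) (ω : Ω),
      (∀ g, (Φ g).perm ∈ Γ) ∧ (∀ a ω, (Φ (iA a)).twist ω = 1) ∧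
      (Φ (iB b * altProd iA iB L)).twist ω ≠ 1 := by
  obtain ⟨N, hN, hNL⟩ := exists_isPOpen_forall (p := p) lA
    (fun a N => ∀ j : ℤ, a⁻¹ * u ^ j ∉ N) (fun a M N hMN h j hj => h j (hMN hj))
    (fun a ha => exists_isPOpen_of_not_inPClosure hu (hlA a ha))
  obtain ⟨M, hM, hML⟩ := exists_isPOpen_forall (p := p) lB
    (fun a N => ∀ j : ℤ, a⁻¹ * v ^ j ∉ N) (fun a M N hMN h j hj => h j (hMN hj))
    (fun b hb => exists_isPOpen_of_not_inPClosure hv (hlB b hb))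
  obtain ⟨Ω, h1, ⟨ω⟩, Γ, α, β, hΓ, hαΓ, hβΓ, huv', hα, hβ⟩ :=
    exists_common_action hp hA hB huv hN hM
  refine ⟨Ω, h1, Γ, hΓ, fun b L hb hL => ?_⟩
  let o : Ω → CycleSpace (α u) := Quotient.mk _
  have hoα : ∀ a, (∀ j : ℤ, a⁻¹ * u ^ j ∉ N) → ∀ ω, o (α a ω) ≠ o ω := by
    intro a ha ω h
    obtain ⟨j, hj⟩ := cycleSpace_mk_eq.1 h.symm
    refine ha j (hα _ ω ?_)
    rw [map_mul, Perm.mul_apply, map_zpow, hj, ← Perm.mul_apply, ← map_mul,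
      inv_mul_cancel, map_one, Perm.one_apply]
  have hoβ : ∀ a, (∀ j : ℤ, a⁻¹ * v ^ j ∉ M) → ∀ ω, o (β a ω) ≠ o ω := by
    intro a ha ω h
    obtain ⟨j, hj⟩ := cycleSpace_mk_eq.1 h.symm
    rw [huv'] at hj
    refine ha j (hβ _ ω ?_)
    rw [map_mul, Perm.mul_apply, map_zpow, hj, ← Perm.mul_apply, ← map_mul,
      inv_mul_cancel, map_one, Perm.one_apply]
  -- The twist of the product at `ω` is a word in the values of `τ`, in which consecutive letters are
  -- distinct orbits and all exponents are `±1`.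
  have hαL : ∀ x ∈ L, ∀ ω, o (α x.1 ω) ≠ o ω := fun x hx => hoα _ (hNL _ (hL x hx).1)
  have hβL : ∀ x ∈ L, ∀ ω, o (β x.2 ω) ≠ o ω := fun x hx => hoβ _ (hML _ (hL x hx).2)
  obtain ⟨hc, hc'⟩ := twistWord_isChain L hαL hβL ω
  set ω' := (L.map fun y => α y.1 * β y.2).prod ω with hω'
  obtain ⟨d, τ, hτ⟩ := Unitriangular.exists_prod_ne_one
    ((o (β b ω'), 1) :: (o ω', -1) :: twistWord α β o L ω) (by simp) (by
      refine List.IsChain.cons_cons (hoβ b (hML _ hb) _) ?_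
      rw [List.isChain_cons]
      refine ⟨fun y hy => ?_, hc⟩
      have hL' : ∃ z, z ∈ L.head? := by
        cases L with
        | nil => simp [twistWord] at hy
        | cons z L => exact ⟨z, rfl⟩
      obtain ⟨z, hz⟩ := hL'
      exact (hc' y hy z hz).symm) (by
      intro y hy
      simp only [List.mem_cons] at hy
      rcases hy with rfl | rfl | hy
      · simp
      · simp
      · exact twistWord_exponent L ω y hy)
  obtain ⟨Φ, e1, e2, e3, e4⟩ := hG.exists_twistedPerm α β huv' o
    (fun ω => (cycleSpace_mk_eq.2 ⟨1, by simp⟩ : o ω = o (α u ω)).symm) τ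
  refine ⟨d, Φ, ω, hG.perm_mem (fun a => by rw [e1]; exact hαΓ a)
    (fun b => by rw [e3]; exact hβΓ b), e2, ?_⟩
  obtain ⟨f1, f2⟩ := twist_altProd e1 e2 e3 e4 L ω
  rw [map_mul, TwistedPerm.twist_mul, f1, f2, e4, ← hω']
  simpa [mul_assoc] using hτ

theorem TwistedPerm.isPOpen_ker_map (hp : p.Prime) {Ω : Type} [Finite Ω] {Γ : Subgroup (Perm Ω)}
    (hΓ : IsPGroup p Γ) {d : ℕ} {Φ : G →* TwistedPerm Ω (Unitriangular d ℤ)}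
    (h : ∀ g, (Φ g).perm ∈ Γ) (M : ℕ) :
    IsPOpen p ((TwistedPerm.mapHom (Unitriangular.map (Int.castRingHom (ZMod (p ^ M))))).comp Φ).ker := by
  have : NeZero (p ^ M) := ⟨pow_ne_zero _ hp.ne_zero⟩
  exact TwistedPerm.isPOpen_ker hp (Unitriangular.isPGroup_zmod_pow p M) hΓ _ h

/-- A reduced product is separated from the image of `A`. -/
theorem IsAmalgam.exists_isPOpen_of_reduced (hp : p.Prime) (hG : IsAmalgam iA iB u v)
    (hA : IsResiduallyP p A) (hB : IsResiduallyP p B) (huv : SameOrder u v)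
    (hu : IsPClosedZPowers p u) (hv : IsPClosedZPowers p v) (a : A) (b : B) (L : List (A × B)) (a' : A)
    (hb : b ∉ Subgroup.zpowers v) (hL : IsReducedList u v L) :
    ∃ N, IsPOpen p N ∧ ∀ c : A, (iA a * iB b * altProd iA iB L * iA a')⁻¹ * iA c ∉ N := by
  obtain ⟨Ω, _, Γ, hΓ, hsep⟩ := hG.exists_separating hp hA hB huv hu hv (L.map Prod.fst)
    (b :: L.map Prod.snd) (fun a ha => by
      obtain ⟨x, hx, rfl⟩ := List.mem_map.1 ha
      exact (hL x hx).1) (fun a ha => by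
      rcases List.mem_cons.1 ha with rfl | ha
      · exact hb
      obtain ⟨x, hx, rfl⟩ := List.mem_map.1 ha
      exact (hL x hx).2)
  obtain ⟨d, Φ, ω, hperm, htw, hne⟩ := hsep b L List.mem_cons_self fun x hx =>
    ⟨List.mem_map_of_mem hx, List.mem_cons_of_mem _ (List.mem_map_of_mem hx)⟩
  obtain ⟨M, hM⟩ := Unitriangular.exists_map_ne_one hp hne
  refine ⟨_, TwistedPerm.isPOpen_ker_map hp hΓ hperm M, fun c hc => hM ?_⟩
  rw [MonoidHom.mem_ker, map_mul, map_inv, inv_mul_eq_one] at hc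
  have h1 : (iB b * altProd iA iB L) =
      (iA a)⁻¹ * (iA a * iB b * altProd iA iB L * iA a') * (iA a')⁻¹ := by group
  rw [h1]
  have h2 := congrArg (fun x => TwistedPerm.twist x ω) (congrArg (fun x =>
    (TwistedPerm.mapHom (Unitriangular.map (Int.castRingHom (ZMod (p ^ M))))).comp Φ (iA a)⁻¹ * x *
    (TwistedPerm.mapHom (Unitriangular.map (Int.castRingHom (ZMod (p ^ M))))).comp Φ (iA a')⁻¹) hc)
  simp only [← map_mul] at h2
  rw [MonoidHom.comp_apply, TwistedPerm.mapHom_twist] at h2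
  rw [h2, ← map_inv, ← map_inv, ← map_mul, ← map_mul, MonoidHom.comp_apply, TwistedPerm.mapHom_twist,
    htw, map_one]

/-- The pro-`p` topology of `G` induces that of `A`. -/
theorem IsAmalgam.exists_isPOpen_forall_left (hp : p.Prime) (hG : IsAmalgam iA iB u v)
    (hA : IsResiduallyP p A) (hB : IsResiduallyP p B) (huv : SameOrder u v) {N : Subgroup A}
    (hN : IsPOpen p N) : ∃ M, IsPOpen p M ∧ ∀ a, iA a ∈ M → a ∈ N := by
  obtain ⟨Ω, h1, ⟨ω⟩, Γ, α, β, hΓ, hαΓ, hβΓ, huv', hα, -⟩ :=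
    exists_common_action hp hA hB huv hN (isPOpen_top (G := B))
  obtain ⟨Φ, e1, e2⟩ := hG.exists_lift (Perm Ω) α β huv'
  have hm : ∀ g, Φ g ∈ Γ := by
    have : Subgroup.closure (Set.range iA ∪ Set.range iB) ≤ Γ.comap Φ := by
      rw [Subgroup.closure_le]
      rintro _ (⟨a, rfl⟩ | ⟨b, rfl⟩)
      · show Φ _ ∈ Γ
        rw [e1]; exact hαΓ a
      · show Φ _ ∈ Γ
        rw [e2]; exact hβΓ b
    rw [hG.closure_eq_top] at this
    exact fun g => this trivial
  refine ⟨_, isPOpen_ker hp hΓ (Φ.codRestrict Γ hm), fun a ha => hα a ω ?_⟩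
  have := congrArg Subtype.val (MonoidHom.mem_ker.1 ha)
  have h2 : Φ (iA a) = 1 := this
  rw [← e1, h2, Perm.one_apply]

/-- Amalgamation along closed cyclic subgroups preserves residual `p`-finiteness. -/
theorem IsAmalgam.isResiduallyP (hp : p.Prime) (hG : IsAmalgam iA iB u v)
    (hA : IsResiduallyP p A) (hB : IsResiduallyP p B) (huv : SameOrder u v)
    (hu : IsPClosedZPowers p u) (hv : IsPClosedZPowers p v) : IsResiduallyP p G := by
  intro g hg
  obtain ⟨c, h⟩ := hG.exists_conj g
  apply IsResiduallyP.of_conj (c := c)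
  have hg' : c * g * c⁻¹ ≠ 1 := by
    rw [Ne, conj_eq_one_iff]; exact hg
  rcases h with ⟨a, ha⟩ | ⟨b, hb⟩ | ⟨L, hL0, hL, h⟩
  · rw [ha] at hg' ⊢
    obtain ⟨N, hN, haN⟩ := hA a (by rintro rfl; exact hg' (map_one _))
    obtain ⟨M, hM, h⟩ := hG.exists_isPOpen_forall_left hp hA hB huv hN
    exact ⟨M, hM, fun h' => haN (h a h')⟩
  · rw [hb] at hg' ⊢
    obtain ⟨N, hN, hbN⟩ := hB b (by rintro rfl; exact hg' (map_one _))
    obtain ⟨M, hM, h⟩ := hG.symm.exists_isPOpen_forall_left hp hB hA huv.symm hN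
    exact ⟨M, hM, fun h' => hbN (h b h')⟩
  · rw [h]
    rcases L with _ | ⟨x, L⟩
    · exact absurd rfl hL0
    obtain ⟨N, hN, h'⟩ := hG.exists_isPOpen_of_reduced hp hA hB huv hu hv x.1 x.2 L 1
      (hL x List.mem_cons_self).2 hL.tail
    refine ⟨N, hN, fun hmem => h' 1 ?_⟩
    rw [map_one, mul_one, mul_one, inv_mem_iff]
    rwa [altProd_cons] at hmem

/-- The closure of a cyclic subgroup of `A` is the same in `A` and in `G`, the image of `A` being
closed. -/
theorem IsAmalgam.exists_pow_mem_of_left (hp : p.Prime) (hG : IsAmalgam iA iB u v)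
    (hA : IsResiduallyP p A) (hB : IsResiduallyP p B) (huv : SameOrder u v)
    (hu : IsPClosedZPowers p u) (hv : IsPClosedZPowers p v) (hA' : ClosureLeRoots p A) {a : A} {g : G}
    (h : InPClosure p (iA a) g) : ∃ m : ℕ, ¬ p ∣ m ∧ g ^ m ∈ Subgroup.zpowers (iA a) := by
  rcases hG.exists_expression g with ⟨a', rfl⟩ | ⟨a₁, b, L, a₂, hb, hL, rfl⟩
  · have h' : InPClosure p a a' := by
      intro N hN
      obtain ⟨M, hM, hMN⟩ := hG.exists_isPOpen_forall_left hp hA hB huv hN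
      obtain ⟨j, hj⟩ := h M hM
      exact ⟨j, hMN _ (by simpa using hj)⟩
    obtain ⟨m, hm, k, hk⟩ := hA' a a' h'
    exact ⟨m, hm, k, by simp only at hk; simp only; rw [← map_zpow, hk, map_pow]⟩
  · obtain ⟨N, hN, h'⟩ := hG.exists_isPOpen_of_reduced hp hA hB huv hu hv a₁ b L a₂ hb hL
    obtain ⟨j, hj⟩ := h N hN
    rw [← map_zpow] at hj
    exact absurd hj (h' _)

/-- The main inductive step: amalgamation along closed cyclic subgroups preserves the property that the
closure of a cyclic subgroup consists of roots of its elements. -/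
theorem IsAmalgam.closureLeRoots (hp : p.Prime) (hG : IsAmalgam iA iB u v)
    (hA : IsResiduallyP p A) (hB : IsResiduallyP p B) (huv : SameOrder u v)
    (hu : IsPClosedZPowers p u) (hv : IsPClosedZPowers p v) (hA' : ClosureLeRoots p A)
    (hB' : ClosureLeRoots p B) : ClosureLeRoots p G := by
  intro f g hfg
  obtain ⟨c, h⟩ := hG.exists_conj f
  rw [← ClosureLeRoots.conj_iff (c := c)]
  have hfg' := hfg.conj c
  rcases h with ⟨a, ha⟩ | ⟨b, hb⟩ | ⟨L, hL0, hL, h⟩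
  · rw [ha] at hfg' ⊢
    exact hG.exists_pow_mem_of_left hp hA hB huv hu hv hA' hfg'
  · rw [hb] at hfg' ⊢
    exact hG.symm.exists_pow_mem_of_left hp hB hA huv.symm hv hu hB' hfg'
  · rw [h] at hfg' ⊢
    obtain ⟨Ω, _, Γ, hΓ, hsep⟩ := hG.exists_separating hp hA hB huv hu hv (L.map Prod.fst)
      (L.map Prod.snd) (fun a ha => by
        obtain ⟨x, hx, rfl⟩ := List.mem_map.1 ha
        exact (hL x hx).1) (fun a ha => by
        obtain ⟨x, hx, rfl⟩ := List.mem_map.1 ha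
        exact (hL x hx).2)
    obtain ⟨e, he⟩ := hΓ.exists_uniform_pow hp
    -- A power of `f` fixing all points is again given by a reduced product of the same factors.
    obtain ⟨x, L', hxL⟩ : ∃ x L', (List.replicate (p ^ e) L).flatten = x :: L' := by
      apply List.exists_cons_of_ne_nil
      rw [Ne, List.flatten_eq_nil_iff]
      intro h'
      exact hL0 (h' L (List.mem_replicate.2 ⟨pow_ne_zero _ hp.ne_zero, rfl⟩))
    have hent : ∀ y ∈ x :: L', y ∈ L := by
      intro y hy
      rw [← hxL] at hy
      obtain ⟨l, hl, hy⟩ := List.mem_flatten.1 hy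
      rwa [(List.mem_replicate.1 hl).2] at hy
    obtain ⟨d, Φ, ω, hperm, htw, hne⟩ := hsep x.2 L'
      (List.mem_map_of_mem (hent x List.mem_cons_self)) fun y hy =>
        ⟨List.mem_map_of_mem (hent y (List.mem_cons_of_mem _ hy)),
          List.mem_map_of_mem (hent y (List.mem_cons_of_mem _ hy))⟩
    have hpow : altProd iA iB L ^ p ^ e = iA x.1 * (iB x.2 * altProd iA iB L') := by
      rw [← altProd_flatten_replicate, hxL, altProd_cons, mul_assoc]
    have hLmem : ∀ g : G, g ^ p ^ e ∈ ((TwistedPerm.permHom Ω _).comp Φ).ker := by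
      intro g
      have := congrArg Subtype.val (he ⟨_, hperm g⟩)
      rw [MonoidHom.mem_ker, map_pow]
      exact this
    -- On the stabilizer of all points the twist at `ω` is a homomorphism.
    let θ : ((TwistedPerm.permHom Ω (Unitriangular d ℤ)).comp Φ).ker →* Unitriangular d ℤ :=
      MonoidHom.mk' (fun g => (Φ g).twist ω) fun g g' => by
        have : (Φ (g' : G)).perm = 1 := g'.2
        rw [Subgroup.coe_mul, map_mul, TwistedPerm.twist_mul, this, Perm.one_apply]
    refine exists_pow_mem_zpowers_of_unitriangular hp
      (hG.isResiduallyP hp hA hB huv hu hv) _ θ e hLmem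
      (fun M => ⟨_, TwistedPerm.isPOpen_ker_map hp hΓ hperm M, fun y hy => ?_⟩) ?_ hfg'
    · exact congrArg (fun z => TwistedPerm.twist z ω) (MonoidHom.mem_ker.1 hy)
    · show (Φ (altProd iA iB L ^ p ^ e)).twist ω ≠ 1
      rw [hpow, map_mul, TwistedPerm.twist_mul, htw, one_mul]
      exact hne

end TwistedAction

/-! ### Unitriangular representations of finite `p`-groups -/

section SylowUnitriangular

variable {p : ℕ}

theorem Unitriangular.isPGroup_zmod (p d : ℕ) : IsPGroup p (Unitriangular d (ZMod p)) := by
  have := Unitriangular.isPGroup_zmod_pow (d := d) p 1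
  rwa [pow_one] at this

theorem Unitriangular.card_zmod (p d : ℕ) [NeZero p] :
    Nat.card (Unitriangular d (ZMod p)) = ∏ j : Fin d, p ^ (j : ℕ) := by
  let X : (∀ j : Fin d, Fin j → ZMod p) → Matrix (Fin d) (Fin d) (ZMod p) := fun f i j =>
    if h : (i : ℕ) < j then f j ⟨i, h⟩ else 0
  have hX : ∀ f, Unitriangular.IsStrict (X f) := fun f i j hij => by
    have hij' : (j : ℕ) ≤ i := hij
    simp only [X]
    rw [dif_neg (by omega)]
  let F : Unitriangular d (ZMod p) → ∀ j : Fin d, Fin j → ZMod p := fun g j i =>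
    Unitriangular.mat g ⟨i, i.2.trans j.2⟩ j
  let E : Unitriangular d (ZMod p) ≃ (∀ j : Fin d, Fin j → ZMod p) :=
    { toFun := F
      invFun := fun f => Unitriangular.ofStrict (X f) (hX f)
      left_inv := fun g => by
        apply Unitriangular.mat_injective
        ext i j
        rw [Unitriangular.mat_ofStrict, Matrix.add_apply]
        by_cases h : (i : ℕ) < j
        · rw [Matrix.one_apply_ne (by rintro rfl; omega), zero_add]
          simp only [X]
          rw [dif_pos h]
        · have hij : j ≤ i := not_lt.1 h
          rw [Unitriangular.mat_of_le g hij]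
          refine add_eq_left.2 (hX (F g) i j hij)
      right_inv := fun f => by
        funext j i
        have hi : (i : ℕ) < j := i.2
        show Unitriangular.mat _ _ _ = _
        rw [Unitriangular.mat_ofStrict, Matrix.add_apply, Matrix.one_apply_ne (by
          intro h; rw [Fin.ext_iff] at h; simp only at h; omega), zero_add]
        simp only [X]
        rw [dif_pos hi] }
  rw [Nat.card_congr E, Nat.card_pi]
  simp

/-- The unitriangular group is a Sylow subgroup of the general linear group over `ZMod p`. -/
theorem Unitriangular.not_dvd_index (p d : ℕ) [Fact p.Prime] :
    ¬ p ∣ (Unitriangular d (ZMod p)).index := by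
  have hp : p.Prime := Fact.out
  have h1 := (Unitriangular d (ZMod p)).card_mul_index
  have h2 : Nat.card (Matrix (Fin d) (Fin d) (ZMod p))ˣ =
      (∏ j : Fin d, p ^ (j : ℕ)) * ∏ j : Fin d, (p ^ (d - j) - 1) := by
    rw [← Finset.prod_mul_distrib]
    refine (Matrix.card_GL_field (𝔽 := ZMod p) d).trans (Finset.prod_congr rfl fun j _ => ?_)
    rw [ZMod.card, Nat.mul_sub, mul_one, ← pow_add, Nat.add_sub_cancel' j.2.le]
  rw [h2, Unitriangular.card_zmod] at h1
  have h3 := Nat.eq_of_mul_eq_mul_left (Finset.prod_pos fun j _ => pow_pos hp.pos _) h1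
  rw [h3, hp.prime.dvd_finsetProd_iff]
  rintro ⟨j, -, hj⟩
  have hd : d - (j : ℕ) ≠ 0 := by have := j.2; omega
  have h4 : p ∣ p ^ (d - (j : ℕ)) := dvd_pow_self _ hd
  have h5 := (Nat.dvd_sub_iff_right (Nat.one_le_pow _ _ hp.pos) h4).1 hj
  exact hp.one_lt.not_ge (Nat.le_of_dvd one_pos h5)

theorem exists_injective_generalLinear {Γ : Type*} [Group Γ] [Finite Γ] (R : Type*) [CommRing R]
    [Nontrivial R] :
    ∃ (d : ℕ) (ρ : Γ →* (Matrix (Fin d) (Fin d) R)ˣ), Function.Injective ρ := by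
  classical
  obtain ⟨d, ⟨e⟩⟩ := Finite.exists_equiv_fin Γ
  let m : Γ →* Matrix (Fin d) (Fin d) R :=
    { toFun := fun g => Matrix.of fun i j => if i = e (g * e.symm j) then 1 else 0
      map_one' := by
        ext i j
        simp [Matrix.one_apply]
      map_mul' := fun g g' => by
        ext i j
        rw [Matrix.mul_apply, Finset.sum_eq_single (e (g' * e.symm j))]
        · simp [mul_assoc]
        · intro k _ hk
          simp [hk]
        · simp }
  refine ⟨d, m.toHomUnits, fun g g' h => ?_⟩
  have h1 : m g = m g' := congrArg Units.val h
  have h2 := congrFun (congrFun h1 (e g)) (e 1)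
  simp only [m, MonoidHom.coe_mk, OneHom.coe_mk, Matrix.of_apply, Equiv.symm_apply_apply,
    mul_one, if_true] at h2
  by_contra hne
  rw [if_neg (fun h => hne (e.injective h))] at h2
  exact one_ne_zero h2

/-- Finite `p`-groups are groups of unitriangular matrices over `ZMod p`. -/
theorem IsPGroup.exists_injective_unitriangular (hp : p.Prime) {Γ : Type*} [Group Γ] [Finite Γ]
    (hΓ : IsPGroup p Γ) :
    ∃ (d : ℕ) (ρ : Γ →* Unitriangular d (ZMod p)), Function.Injective ρ := by
  have := Fact.mk hp
  obtain ⟨d, ρ, hρ⟩ := exists_injective_generalLinear (Γ := Γ) (ZMod p)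
  let P := (Unitriangular.isPGroup_zmod p d).toSylow (Unitriangular.not_dvd_index p d)
  obtain ⟨Q, hQ⟩ := (hΓ.of_equiv (MonoidHom.ofInjective hρ)).exists_le_sylow
  obtain ⟨c, hc⟩ := MulAction.exists_smul_eq (Matrix (Fin d) (Fin d) (ZMod p))ˣ Q P
  have hmem : ∀ g, c * ρ g * c⁻¹ ∈ Unitriangular d (ZMod p) := by
    intro g
    have h1 : c * ρ g * c⁻¹ ∈ c • Q := by
      show c * ρ g * c⁻¹ ∈ (c • Q).toSubgroup
      rw [Sylow.coe_subgroup_smul]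
      exact ⟨ρ g, hQ ⟨g, rfl⟩, rfl⟩
    rw [hc] at h1
    exact h1
  refine ⟨d, ((MulAut.conj c).toMonoidHom.comp ρ).codRestrict _ hmem, fun g g' h => hρ ?_⟩
  exact (MulAut.conj c).injective (congrArg Subtype.val h)

end SylowUnitriangular

/-! ### Roots of integral unitriangular matrices -/

section Roots

open Polynomial

/-- Up to a substitution `X ↦ c X`, the `n`-th root of `1 + X` has integral coefficients, to any given
precision. -/
theorem exists_polynomial_root (p n : ℕ) (hp : p.Prime) (hn : ¬ p ∣ n) (d : ℕ) :
    ∃ (c : ℕ) (Q : ℤ[X]), ¬ p ∣ c ∧ X ∣ Q ∧ X ^ (d + 1) ∣ (1 + Q) ^ n - (1 + C (c : ℤ) * X) := by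
  induction d with
  | zero => exact ⟨1, 0, by simpa using hp.ne_one, dvd_zero _, by simp⟩
  | succ d ih =>
    obtain ⟨c, Q, hc, ⟨S, rfl⟩, Z, hZ⟩ := ih
    -- After the substitution `X ↦ n X` the error term is divisible by `n` and can be corrected.
    set σ : ℤ[X] → ℤ[X] := fun P => P.comp (C (n : ℤ) * X) with hσ
    have hZ' : (1 + C (n : ℤ) * X * σ S) ^ n =
        1 + C (c : ℤ) * (C (n : ℤ) * X) + (C (n : ℤ) * X) ^ (d + 1) * σ Z := by
      have := congrArg σ hZ
      simp only [hσ, sub_comp, pow_comp, add_comp, one_comp, mul_comp, X_comp, C_comp] at this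
      linear_combination this
    set E : ℤ[X] := C (n : ℤ) ^ d * X ^ (d + 1) * σ Z with hE
    refine ⟨c * n, C (n : ℤ) * X * σ S - E, ?_, ?_, ?_⟩
    · rw [hp.dvd_mul]; tauto
    · exact dvd_sub (⟨C (n : ℤ) * σ S, by ring⟩) ⟨C (n : ℤ) ^ d * X ^ d * σ Z, by rw [hE]; ring⟩
    · set a : ℤ[X] := 1 + C (n : ℤ) * X * σ S with ha
      have h1 : (X : ℤ[X]) ∣ a ^ (n - 1) - 1 := by
        have : (X : ℤ[X]) ∣ a - 1 := ⟨C (n : ℤ) * σ S, by rw [ha]; ring⟩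
        exact this.trans (by simpa using sub_dvd_pow_sub_pow a 1 (n - 1))
      obtain ⟨W, hW⟩ := h1
      obtain ⟨W', hW'⟩ : E ^ 2 ∣ (a - E) ^ n - a ^ n + n * E * a ^ (n - 1) := by
        obtain ⟨k, hk⟩ := powAddExpansion a (-E) n
        exact ⟨k, by rw [sub_eq_add_neg a E, hk]; ring⟩
      refine ⟨X ^ d * C (n : ℤ) ^ (2 * d) * σ Z ^ 2 * W' - C (n : ℤ) ^ (d + 1) * σ Z * W, ?_⟩
      have h2 : (1 : ℤ[X]) + (C (n : ℤ) * X * σ S - E) = a - E := by rw [ha]; ring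
      have h3 : (n : ℤ[X]) = C (n : ℤ) := by simp
      rw [h2]
      rw [h3] at hW'
      have h4 : C (((c * n : ℕ) : ℤ)) = C (c : ℤ) * C (n : ℤ) := by simp
      rw [h4]
      have h5 : (a - E) ^ n = a ^ n - C (n : ℤ) * E * a ^ (n - 1) + E ^ 2 * W' := by
        linear_combination hW'
      have h6 : a ^ (n - 1) = 1 + X * W := by linear_combination hW
      rw [h5, h6, hZ', hE]
      ring

theorem Unitriangular.isStrict_pow_eq_zero {d : ℕ} {R : Type*} [CommRing R]
    {Y : Matrix (Fin d) (Fin d) R} (hY : Unitriangular.IsStrict Y) : Y ^ d = 0 := by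
  have key : ∀ k, ∀ i j : Fin d, (j : ℕ) < i + k → (Y ^ k) i j = 0 := by
    intro k
    induction k with
    | zero =>
      intro i j h
      rw [pow_zero, Matrix.one_apply_ne (by rintro rfl; omega)]
    | succ k ih =>
      intro i j h
      rw [pow_succ', Matrix.mul_apply]
      refine Finset.sum_eq_zero fun m _ => ?_
      by_cases hm : m ≤ i
      · rw [hY i m hm, zero_mul]
      · have hm' : (i : ℕ) < m := not_le.1 hm
        rw [ih m j (by omega), mul_zero]
  ext i j
  exact key d i j (by omega)

theorem Unitriangular.isStrict_aeval {d : ℕ} {Y : Matrix (Fin d) (Fin d) ℤ}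
    (hY : Unitriangular.IsStrict Y) {Q : ℤ[X]} (hQ : X ∣ Q) :
    Unitriangular.IsStrict (aeval Y Q) := by
  obtain ⟨S, rfl⟩ := hQ
  have hYB : Y.BlockTriangular id := fun i j hij => hY i j (le_of_lt hij)
  have hS : (aeval Y S).BlockTriangular id := by
    induction S using Polynomial.induction_on with
    | C a => rw [aeval_C]; exact Matrix.blockTriangular_algebraMap a
    | add P Q hP hQ => rw [map_add]; exact hP.add hQ
    | monomial n a _ =>
      rw [map_mul, aeval_C, map_pow, aeval_X]
      exact (Matrix.blockTriangular_algebraMap a).mul (hYB.pow _)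
  intro i j hij
  rw [map_mul, aeval_X, Matrix.mul_apply]
  refine Finset.sum_eq_zero fun m _ => ?_
  by_cases hm : m ≤ i
  · rw [hY i m hm, zero_mul]
  · rw [hS (show j < m from hij.trans_lt (not_le.1 hm)), mul_zero]

/-- Integral unitriangular matrices sufficiently congruent to `1` have integral `n`-th roots. -/
theorem Unitriangular.exists_root {p n : ℕ} (hp : p.Prime) (hn : ¬ p ∣ n) (d : ℕ) :
    ∃ c : ℕ, ¬ p ∣ c ∧ ∀ g : Unitriangular d ℤ,
      (∀ i j, (c : ℤ) ∣ (mat g - 1) i j) → ∃ y : Unitriangular d ℤ, y ^ n = g := by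
  obtain ⟨c, Q, hc, hXQ, Z, hZ⟩ := exists_polynomial_root p n hp hn d
  refine ⟨c, hc, fun g hg => ?_⟩
  have hc0 : (c : ℤ) ≠ 0 := by
    rintro h
    exact hc (by rw [Nat.cast_eq_zero.1 h]; exact dvd_zero _)
  choose Y hY using hg
  have hYs : IsStrict (Matrix.of Y) := fun i j hij => by
    have h1 := hY i j
    rw [isStrict_mat_sub_one g i j hij] at h1
    exact (mul_eq_zero.1 h1.symm).resolve_left hc0
  refine ⟨ofStrict _ (isStrict_aeval hYs hXQ), mat_injective ?_⟩
  rw [mat_pow, mat_ofStrict]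
  have h1 := congrArg (aeval (Matrix.of Y)) hZ
  simp only [map_sub, map_pow, map_add, map_one, map_mul, aeval_X, aeval_C] at h1
  rw [pow_succ (Matrix.of Y), isStrict_pow_eq_zero hYs, zero_mul, zero_mul, sub_eq_zero] at h1
  rw [h1]
  have h2 : algebraMap ℤ (Matrix (Fin d) (Fin d) ℤ) c * Matrix.of Y = mat g - 1 := by
    ext i j
    rw [← Algebra.smul_def, Matrix.smul_apply, hY]
    rfl
  rw [h2, add_sub_cancel]

end Roots

section Lifting

variable {p n : ℕ} {A : Type*} [Group A]

/-- Unitriangular matrices modulo `p` lift to integral ones congruent to `1` modulo `c`. -/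
theorem Unitriangular.exists_lift_zmod {c : ℕ} (hp : p.Prime) (hc : ¬ p ∣ c) {d : ℕ}
    (g : Unitriangular d (ZMod p)) :
    ∃ G : Unitriangular d ℤ, map (Int.castRingHom (ZMod p)) G = g ∧
      map (Int.castRingHom (ZMod c)) G = 1 := by
  have hcop : IsCoprime (c : ℤ) p := by
    rw [Nat.isCoprime_iff_coprime, Nat.coprime_comm, hp.coprime_iff_not_dvd]
    exact hc
  obtain ⟨s, t, hst⟩ := hcop
  have hs : ((s * c : ℤ) : ZMod p) = 1 := by
    have := congrArg (Int.cast : ℤ → ZMod p) hst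
    simpa using this
  let l : Fin d → Fin d → ℤ := fun i j => if j ≤ i then 0 else (ZMod.cast (mat g i j) : ℤ)
  have hX : IsStrict (Matrix.of fun i j => s * c * l i j) := fun i j hij => by simp [l, hij]
  have hmat : ∀ i j, mat (ofStrict _ hX) i j =
      (1 : Matrix (Fin d) (Fin d) ℤ) i j + s * c * l i j := fun _ _ => rfl
  refine ⟨ofStrict _ hX, ?_, ?_⟩
  · apply mat_injective
    ext i j
    rw [mat_map, hmat, map_add]
    by_cases hij : j ≤ i
    · rw [mat_of_le g hij]
      simp only [l]
      rw [if_pos hij, mul_zero, map_zero, add_zero, Matrix.one_apply, Matrix.one_apply]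
      split_ifs <;> simp
    · simp only [l]
      rw [if_neg hij, Matrix.one_apply_ne (not_le.1 hij).ne, map_zero, zero_add, eq_intCast, Int.cast_mul, hs,
        one_mul, ZMod.intCast_cast, ZMod.cast_id', id]
  · apply mat_injective
    ext i j
    rw [mat_map, hmat, map_add, mat_one, Matrix.one_apply,
      Matrix.one_apply]
    split_ifs <;> simp

theorem Unitriangular.dvd_of_map_eq_one {c d : ℕ} {g : Unitriangular d ℤ}
    (h : map (Int.castRingHom (ZMod c)) g = 1) (i j : Fin d) : (c : ℤ) ∣ (mat g - 1) i j := by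
  have h1 := congrFun (congrFun (congrArg mat h) i) j
  rw [← map_one (map (Int.castRingHom (ZMod c))), mat_map, mat_map] at h1
  have h2 := (ZMod.intCast_eq_intCast_iff_dvd_sub _ _ _).1 h1.symm
  exact h2

/-- Let `A` be free and let the image of `h` in a finite `p`-group be given a root of degree `n`
prime to `p`. Then the situation lifts to unitriangular integral matrices: lift the generators to
matrices congruent to `1` modulo a suitable number prime to `p`, so that the image of `h` has an `n`-th
root. Roots of degree prime to `p` being unique in finite `p`-groups, it lifts the given one. -/
theorem exists_unitriangular_lift [IsFreeGroup A] (hp : p.Prime) (hn : ¬ p ∣ n) (h : A) {Γ : Type*}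
    [Group Γ] [Finite Γ] (hΓ : IsPGroup p Γ) (ψ : A →* Γ) (y : Γ) (hy : y ^ n = ψ h) :
    ∃ (d : ℕ) (θ : A →* Unitriangular d ℤ) (Y : Unitriangular d ℤ) (ρ : Γ →* Unitriangular d (ZMod p)),
      Function.Injective ρ ∧ Y ^ n = θ h ∧
      (∀ a, Unitriangular.map (Int.castRingHom (ZMod p)) (θ a) = ρ (ψ a)) ∧
      Unitriangular.map (Int.castRingHom (ZMod p)) Y = ρ y := by
  have := Fact.mk hp
  obtain ⟨d, ρ, hρ⟩ := hΓ.exists_injective_unitriangular hp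
  obtain ⟨c, hc, hroot⟩ := Unitriangular.exists_root hp hn d
  choose l hl hl' using fun g : Unitriangular d (ZMod p) =>
    Unitriangular.exists_lift_zmod (c := c) hp hc g
  let θ : A →* Unitriangular d ℤ := IsFreeGroup.lift fun i => l (ρ (ψ (IsFreeGroup.of i)))
  have h1 : (Unitriangular.map (Int.castRingHom (ZMod p))).comp θ = ρ.comp ψ :=
    IsFreeGroup.ext_hom fun i => by simp [θ, IsFreeGroup.lift_of, hl]
  have h2 : (Unitriangular.map (Int.castRingHom (ZMod c))).comp θ = 1 :=
    IsFreeGroup.ext_hom fun i => by simp [θ, IsFreeGroup.lift_of, hl']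
  obtain ⟨Y, hY⟩ := hroot (θ h) (Unitriangular.dvd_of_map_eq_one (DFunLike.congr_fun h2 h))
  refine ⟨d, θ, Y, ρ, hρ, hY, DFunLike.congr_fun h1, ?_⟩
  apply ((Unitriangular.isPGroup_zmod p d).powEquiv' hn).injective
  rw [IsPGroup.powEquiv_apply, IsPGroup.powEquiv_apply, ← map_pow, hY, ← map_pow, hy]
  exact DFunLike.congr_fun h1 h

end Lifting

/-! ### Adjoining a root -/

section AdjoinRoot

variable {p n : ℕ} {A : Type*} [Group A]

/-- The group obtained from `A` by adjoining an `n`-th root of `h`. -/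
def RootExtension (h : A) (n : ℕ) := Monoid.Coprod A (Multiplicative ℤ) ⧸ Subgroup.normalClosure
  {(Monoid.Coprod.inl h * (Monoid.Coprod.inr (Multiplicative.ofAdd (n : ℤ)))⁻¹ :
    Monoid.Coprod A (Multiplicative ℤ))}

namespace RootExtension

variable {h : A}

instance : Group (RootExtension h n) := inferInstanceAs (Group (_ ⧸ Subgroup.normalClosure
  {(Monoid.Coprod.inl h * (Monoid.Coprod.inr (Multiplicative.ofAdd (n : ℤ)))⁻¹ :
    Monoid.Coprod A (Multiplicative ℤ))}))

/-- The canonical map from `A`. -/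
def of : A →* RootExtension h n := (QuotientGroup.mk' _).comp Monoid.Coprod.inl

/-- The powers of the adjoined root. -/
def powRoot : Multiplicative ℤ →* RootExtension h n := (QuotientGroup.mk' _).comp Monoid.Coprod.inr

/-- The adjoined root. -/
def root : RootExtension h n := powRoot (Multiplicative.ofAdd 1)

theorem powRoot_apply (k : ℤ) : (powRoot (Multiplicative.ofAdd k) : RootExtension h n) = root ^ k := by
  rw [root, ← map_zpow, ← ofAdd_zsmul, smul_eq_mul, mul_one]

theorem of_eq_powRoot : (of h : RootExtension h n) = powRoot (Multiplicative.ofAdd (n : ℤ)) := by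
  rw [← mul_inv_eq_one]
  exact (QuotientGroup.eq_one_iff (Monoid.Coprod.inl h *
    (Monoid.Coprod.inr (Multiplicative.ofAdd (n : ℤ)))⁻¹ : Monoid.Coprod A (Multiplicative ℤ))).2
    (Subgroup.subset_normalClosure rfl)

theorem root_pow : (root : RootExtension h n) ^ n = of h := by
  rw [of_eq_powRoot, powRoot_apply, zpow_natCast]

/-- The universal property. -/
theorem exists_lift {Q : Type*} [Group Q] (α : A →* Q) (y : Q) (hy : y ^ n = α h) :
    ∃ Φ : RootExtension h n →* Q, (∀ a, Φ (of a) = α a) ∧ Φ root = y := by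
  have hker : Subgroup.normalClosure
      {(Monoid.Coprod.inl h * (Monoid.Coprod.inr (Multiplicative.ofAdd (n : ℤ)))⁻¹ :
        Monoid.Coprod A (Multiplicative ℤ))} ≤ (Monoid.Coprod.lift α (zpowersHom Q y)).ker := by
    rw [← Subgroup.normalClosure_subset_iff]
    · rintro _ rfl
      simp [MonoidHom.mem_ker, ← hy]
  refine ⟨QuotientGroup.lift _ (Monoid.Coprod.lift α (zpowersHom Q y)) hker, fun a => ?_, ?_⟩
  · show Monoid.Coprod.lift α (zpowersHom Q y) (Monoid.Coprod.inl a) = _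
    simp
  · show Monoid.Coprod.lift α (zpowersHom Q y) (Monoid.Coprod.inr _) = _
    simp

theorem closure_eq_top :
    Subgroup.closure (Set.range (of : A →* RootExtension h n) ∪ {root}) = ⊤ := by
  have h1 : (Subgroup.closure (Set.range (of : A →* RootExtension h n) ∪ {root})).comap
      (QuotientGroup.mk' _) = ⊤ := by
    rw [eq_top_iff, ← Monoid.Coprod.range_inl_sup_range_inr, sup_le_iff]
    constructor
    · rintro _ ⟨a, rfl⟩
      exact Subgroup.subset_closure (Or.inl ⟨a, rfl⟩)
    · rintro _ ⟨k, rfl⟩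
      show (powRoot (Multiplicative.ofAdd k.toAdd) : RootExtension h n) ∈
        Subgroup.closure (Set.range (of : A →* RootExtension h n) ∪ {root})
      rw [powRoot_apply]
      have hr : (root : RootExtension h n) ∈
          Subgroup.closure (Set.range (of : A →* RootExtension h n) ∪ {root}) :=
        Subgroup.subset_closure (Or.inr (Set.mem_singleton _))
      exact Subgroup.zpow_mem _ hr _
  rw [eq_top_iff]
  intro x _
  obtain ⟨x, rfl⟩ := QuotientGroup.mk'_surjective _ x
  have : x ∈ (⊤ : Subgroup (Monoid.Coprod A (Multiplicative ℤ))) := Subgroup.mem_top x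
  rw [← h1] at this
  exact this

theorem isAmalgam : IsAmalgam (of : A →* RootExtension h n) powRoot h (Multiplicative.ofAdd (n : ℤ)) where
  comm := of_eq_powRoot
  closure_eq_top := by
    rw [eq_top_iff, ← closure_eq_top]
    apply Subgroup.closure_mono
    apply Set.union_subset_union_right
    rintro _ rfl
    exact ⟨_, rfl⟩
  exists_lift Q _ α β hαβ := by
    obtain ⟨Φ, h1, h2⟩ := exists_lift α (β (Multiplicative.ofAdd 1)) (n := n) (h := h) (by
      rw [hαβ, ← map_pow, ← ofAdd_nsmul]; simp)
    refine ⟨Φ, h1, fun b => ?_⟩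
    rw [← ofAdd_toAdd b, powRoot_apply, map_zpow, h2, ← map_zpow, ← ofAdd_zsmul]
    simp

end RootExtension

end AdjoinRoot

/-! ### Actions of free groups twisted along the edges with a given label -/

section EdgeTwist

open Equiv

variable {S Ω V : Type*} [Group V]

open Classical in
/-- The lift of an action `α` of a free group to twisted permutations in which the letter `ℓ` is twisted
by `τ` and the generators other than that of `ℓ` are not twisted. The twist of a word at `ω` is the
product of the values of `τ` at the edges labelled `ℓ` of the path which starts at `ω` and reads
the word from right to left. -/
noncomputable def edgeTwist (α : FreeGroup S →* Perm Ω) (ℓ : S × Bool) (τ : Ω → V) :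
    FreeGroup S →* TwistedPerm Ω V :=
  FreeGroup.lift fun s => if s = ℓ.1 then
    (if ℓ.2 then ⟨α (FreeGroup.mk [ℓ]), τ⟩ else (⟨α (FreeGroup.mk [ℓ]), τ⟩ : TwistedPerm Ω V)⁻¹)
    else ⟨α (FreeGroup.of s), fun _ => 1⟩

variable (α : FreeGroup S →* Perm Ω) (ℓ : S × Bool) (τ : Ω → V)

theorem FreeGroup.mk_singleton_eq (x : S × Bool) :
    FreeGroup.mk [x] = cond x.2 (FreeGroup.of x.1) (FreeGroup.of x.1)⁻¹ := by
  obtain ⟨s, _ | _⟩ := x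
  · rfl
  · rfl

theorem FreeGroup.mk_cons_eq (x : S × Bool) (w : List (S × Bool)) :
    FreeGroup.mk (x :: w) = FreeGroup.mk [x] * FreeGroup.mk w := by
  rw [FreeGroup.mul_mk]; rfl

theorem edgeTwist_letter : edgeTwist α ℓ τ (FreeGroup.mk [ℓ]) = ⟨α (FreeGroup.mk [ℓ]), τ⟩ := by
  rw [edgeTwist, FreeGroup.lift_mk]
  obtain ⟨s, _ | _⟩ := ℓ
  · simp
  · simp

@[simp] theorem edgeTwist_perm (g : FreeGroup S) : (edgeTwist α ℓ τ g).perm = α g := by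
  have : (TwistedPerm.permHom Ω V).comp (edgeTwist α ℓ τ) = α := by
    apply FreeGroup.ext_hom
    intro s
    show (edgeTwist α ℓ τ (FreeGroup.of s)).perm = _
    rw [edgeTwist, FreeGroup.lift_apply_of]
    split_ifs with h1 h2
    · rw [FreeGroup.mk_singleton_eq, h2, h1]; rfl
    · rw [FreeGroup.mk_singleton_eq, TwistedPerm.perm_inv]
      simp only [Bool.not_eq_true] at h2
      rw [h2, h1]
      simp
    · rfl
  exact DFunLike.congr_fun this g

theorem edgeTwist_letter_eq_or (x : S × Bool) :
    x = ℓ ∨ FreeGroup.mk [x] = (FreeGroup.mk [ℓ])⁻¹ ∧ x = (ℓ.1, !ℓ.2) ∨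
      ∀ ω, (edgeTwist α ℓ τ (FreeGroup.mk [x])).twist ω = 1 := by
  obtain ⟨s, b⟩ := x
  obtain ⟨t, c⟩ := ℓ
  by_cases hst : s = t
  · subst hst
    by_cases hbc : b = c
    · exact Or.inl (by rw [hbc])
    · refine Or.inr (Or.inl ⟨?_, ?_⟩)
      · rw [FreeGroup.mk_singleton_eq, FreeGroup.mk_singleton_eq]
        cases b <;> cases c <;> simp_all
      · cases b <;> cases c <;> simp_all
  · refine Or.inr (Or.inr fun ω => ?_)
    rw [edgeTwist, FreeGroup.lift_mk]
    cases b <;> simp [hst]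

theorem edgeTwist_letter_twist_eq_one {x : S × Bool} {ω : Ω} (h1 : τ ω = 1)
    (h2 : x = (ℓ.1, !ℓ.2) → τ (α (FreeGroup.mk [x]) ω) = 1) :
    (edgeTwist α ℓ τ (FreeGroup.mk [x])).twist ω = 1 := by
  rcases edgeTwist_letter_eq_or α ℓ τ x with rfl | ⟨h, h'⟩ | h
  · rw [edgeTwist_letter]
    exact h1
  · have h3 := h2 h'
    rw [h] at h3 ⊢
    rw [map_inv, edgeTwist_letter, TwistedPerm.twist_inv, inv_eq_one]
    rwa [map_inv] at h3
  · exact h ω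

/-- A path avoiding the support of `τ` is not twisted. -/
theorem edgeTwist_twist_eq_one (w : List (S × Bool)) (ω : Ω)
    (h : ∀ β, β <:+ w → τ (α (FreeGroup.mk β) ω) = 1) :
    (edgeTwist α ℓ τ (FreeGroup.mk w)).twist ω = 1 := by
  induction w with
  | nil =>
    rw [← FreeGroup.one_eq_mk, map_one, TwistedPerm.twist_one]
  | cons x w ih =>
    rw [FreeGroup.mk_cons_eq, map_mul, TwistedPerm.twist_mul,
      ih fun β hβ => h β (hβ.trans (List.suffix_cons x w)), mul_one, edgeTwist_perm]
    apply edgeTwist_letter_twist_eq_one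
    · exact h w (List.suffix_cons x w)
    · intro _
      rw [← Perm.mul_apply, ← map_mul, ← FreeGroup.mk_cons_eq]
      exact h _ List.suffix_rfl

/-- A cyclically reduced word ending in the letter `ℓ` is twisted by `τ`, if its path does not meet the
support of `τ` at interior vertices: the end of the path is not met by an edge labelled `ℓ⁻¹`. -/
theorem edgeTwist_twist_of_isCyclicallyReduced {w : List (S × Bool)}
    (hw : FreeGroup.IsCyclicallyReduced w) (hℓ : ℓ ∈ w.getLast?) (ω : Ω)
    (h : ∀ β, β <:+ w → β ≠ [] → β ≠ w → τ (α (FreeGroup.mk β) ω) = 1) :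
    (edgeTwist α ℓ τ (FreeGroup.mk w)).twist ω = τ ω := by
  suffices key : ∀ β, β <:+ w → β ≠ [] → (edgeTwist α ℓ τ (FreeGroup.mk β)).twist ω = τ ω from
    key w List.suffix_rfl (by rintro rfl; simp at hℓ)
  intro β
  induction β with
  | nil => intro _ h; exact absurd rfl h
  | cons x β ih =>
    intro hβ _
    have hβ' : β <:+ w := (List.suffix_cons x β).trans hβ
    rcases eq_or_ne β [] with rfl | hne
    · have hx : x = ℓ := by
        obtain ⟨t, rfl⟩ := hβ
        simpa using hℓ
      rw [hx, edgeTwist_letter]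
    · have hne' : β ≠ w := by
        rintro rfl
        have := hβ.length_le
        simp at this
      rw [FreeGroup.mk_cons_eq, map_mul, TwistedPerm.twist_mul, ih hβ' hne, edgeTwist_perm]
      rw [edgeTwist_letter_twist_eq_one α ℓ τ (h β hβ' hne hne'), one_mul]
      intro hx
      rw [← Perm.mul_apply, ← map_mul, ← FreeGroup.mk_cons_eq]
      apply h _ hβ (List.cons_ne_nil _ _)
      rintro rfl
      have := hw.2 ℓ hℓ x rfl (by rw [hx])
      rw [hx] at this
      simp at this

open Classical in
/-- If the support of `τ` meets the orbit of `ω` only in the point `y`, and is avoided by the interior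
vertices of the paths labelled `w`, then powers of `w` are twisted according to the number
of passages through `y`. -/
theorem edgeTwist_twist_pow {w : List (S × Bool)}
    (hw : FreeGroup.IsCyclicallyReduced w) (hℓ : ℓ ∈ w.getLast?) (ω y : Ω) (t : V)
    (h : ∀ β, β <:+ w → β ≠ [] → β ≠ w → ∀ j : ℕ,
      τ (α (FreeGroup.mk β) ((α (FreeGroup.mk w) ^ j) ω)) = 1)
    (hy : ∀ j : ℕ, τ ((α (FreeGroup.mk w) ^ j) ω) = if (α (FreeGroup.mk w) ^ j) ω = y then t else 1)
    (k : ℕ) : (edgeTwist α ℓ τ (FreeGroup.mk w) ^ k).twist ω =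
      t ^ Nat.count (fun j => (α (FreeGroup.mk w) ^ j) ω = y) k := by
  induction k with
  | zero => simp
  | succ k ih =>
    rw [pow_succ', TwistedPerm.twist_mul, ih, TwistedPerm.perm_pow, edgeTwist_perm,
      edgeTwist_twist_of_isCyclicallyReduced α ℓ τ hw hℓ _ fun β h1 h2 h3 => h β h1 h2 h3 k, hy k,
      Nat.count_succ]
    split_ifs
    · rw [pow_succ']
    · rw [add_zero, one_mul]

end EdgeTwist

/-! ### Counting passages, and words with exponents of bounded divisibility -/

section Counting

open Equiv

theorem Equiv.Perm.exists_period {Ω : Type*} {p K : ℕ} (hp : p.Prime) {σ : Perm Ω}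
    (hσ : σ ^ p ^ K = 1) (ω : Ω) :
    ∃ s ≤ K, ∀ i j : ℕ, (σ ^ i) ω = (σ ^ j) ω ↔ i ≡ j [MOD p ^ s] := by
  have h1 : MulAction.period σ ω ∣ p ^ K := by
    rw [← MulAction.pow_smul_eq_iff_period_dvd, hσ, one_smul]
  obtain ⟨s, hs, hs'⟩ := (Nat.dvd_prime_pow hp).1 h1
  refine ⟨s, hs, fun i j => ?_⟩
  have h2 : (σ ^ i) ω = (σ ^ j) ω ↔ (σ ^ ((j : ℤ) - i)) • ω = ω := by
    rw [Perm.smul_def, sub_eq_neg_add, zpow_add, Perm.mul_apply, zpow_neg, Perm.inv_eq_iff_eq,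
      zpow_natCast, zpow_natCast, eq_comm]
  rw [h2, MulAction.zpow_smul_eq_iff_period_dvd, hs', Nat.modEq_iff_dvd]

open Classical in
/-- If `n k` is close to an integer `e` not divisible by `n`, then the number of passages of a cycle of
`p`-power length through a point in time `k` is not divisible by a large power of `p`. -/
theorem not_dvd_count {Ω : Type*} {p B K n : ℕ} (hp : p.Prime) {e : ℤ} (he : ¬ (n : ℤ) ∣ e)
    (hB : n + e.natAbs < p ^ B) {σ : Perm Ω} (hσ : σ ^ p ^ K = 1) (ω : Ω) (δ : ℕ) (k : ℕ)
    (hk : ((p ^ (K + B) : ℕ) : ℤ) ∣ n * k - e) :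
    ¬ p ^ B ∣ Nat.count (fun j => (σ ^ j) ω = (σ ^ δ) ω) k := by
  obtain ⟨s, hs, hiff⟩ := Equiv.Perm.exists_period hp hσ ω
  simp only [hiff]
  have hq : 0 < p ^ s := pow_pos hp.pos _
  rw [Nat.count_modEq_card _ hq]
  rintro ⟨c, hc⟩
  set ε : ℕ := if δ % p ^ s < k % p ^ s then 1 else 0 with hε
  have hε1 : ε ≤ 1 := by rw [hε]; split_ifs <;> omega
  have h1 : k = p ^ s * (k / p ^ s) + k % p ^ s := (Nat.div_add_mod k (p ^ s)).symm
  have h2 : k % p ^ s < p ^ s := Nat.mod_lt _ hq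
  -- `ρ` is the difference of `k` and the number of passages times the period.
  set ρ : ℤ := (k % p ^ s : ℕ) - p ^ s * ε with hρ
  have h3 : (k : ℤ) = p ^ s * (p ^ B * c) + ρ := by
    have h4 : ((k / p ^ s : ℕ) : ℤ) + ε = p ^ B * c := by exact_mod_cast hc
    have h1' : (k : ℤ) = p ^ s * (k / p ^ s : ℕ) + (k % p ^ s : ℕ) := by exact_mod_cast h1
    rw [h1', hρ, ← h4]
    ring
  have h5 : ((p ^ (s + B) : ℕ) : ℤ) ∣ n * ρ - e := by
    have h6 : ((p ^ (s + B) : ℕ) : ℤ) ∣ n * k - e :=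
      (Int.natCast_dvd_natCast.2 (pow_dvd_pow p (by omega))).trans hk
    rw [h3] at h6
    have h7 : (n : ℤ) * ρ - e = (n * (p ^ s * (p ^ B * c) + ρ) - e) - (p ^ (s + B) : ℕ) * (n * c) := by
      push_cast; ring
    rw [h7]
    exact dvd_sub h6 (dvd_mul_right _ _)
  have h8 : ρ.natAbs ≤ p ^ s := by
    have h9 : (0 : ℤ) < p ^ s := by exact_mod_cast hq
    have h10 : ((k % p ^ s : ℕ) : ℤ) < p ^ s := by exact_mod_cast h2
    have h11 : (0 : ℤ) ≤ (k % p ^ s : ℕ) := Int.natCast_nonneg _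
    have h12 : |ρ| ≤ p ^ s := by
      rw [abs_le, hρ]
      rcases Nat.le_one_iff_eq_zero_or_eq_one.1 hε1 with h | h <;> rw [h] <;> push_cast at * <;>
        constructor <;> linarith
    have := Int.natCast_natAbs ρ ▸ h12
    exact_mod_cast this
  have h13 : (n * ρ - e).natAbs < p ^ (s + B) := by
    calc (n * ρ - e).natAbs ≤ (n * ρ).natAbs + e.natAbs := Int.natAbs_sub_le _ _
      _ = n * ρ.natAbs + e.natAbs := by rw [Int.natAbs_mul, Int.natAbs_natCast]
      _ ≤ n * p ^ s + p ^ s * e.natAbs := by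
        gcongr
        exact Nat.le_mul_of_pos_left _ hq
      _ = p ^ s * (n + e.natAbs) := by ring
      _ < p ^ s * p ^ B := by gcongr
      _ = p ^ (s + B) := (pow_add _ _ _).symm
  have h14 := Int.eq_zero_of_dvd_of_natAbs_lt_natAbs h5 (by simpa using h13)
  exact he ⟨ρ, by linarith⟩

theorem Nat.Prime.pow_dvd_or_pow_dvd {p : ℕ} (hp : p.Prime) (a b : ℕ) :
    ∀ x y : ℕ, p ^ (a + b) ∣ x * y → p ^ a ∣ x ∨ p ^ b ∣ y := by
  induction a with
  | zero => intro x y _; exact Or.inl (by simp)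
  | succ a ih =>
    intro x y h
    by_cases hx : p ∣ x
    · obtain ⟨x, rfl⟩ := hx
      rw [show a + 1 + b = (a + b) + 1 by ring, pow_succ', mul_assoc] at h
      refine (ih x y (Nat.dvd_of_mul_dvd_mul_left hp.pos h)).imp (fun h' => ?_) id
      rw [pow_succ']
      exact mul_dvd_mul_left p h'
    · refine Or.inr (((pow_dvd_pow p (by omega)).trans h |> fun h' : p ^ b ∣ x * y => ?_))
      exact (Nat.Coprime.pow_left b ((hp.coprime_iff_not_dvd).2 hx)).dvd_of_dvd_mul_left h'

theorem Nat.Prime.not_pow_dvd_prod {p : ℕ} (hp : p.Prime) {B : ℕ} (l : List ℕ)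
    (h : ∀ x ∈ l, ¬ p ^ B ∣ x) : ¬ p ^ (B * l.length + 1) ∣ l.prod := by
  induction l with
  | nil => simpa using hp.ne_one
  | cons x l ih =>
    intro hdvd
    rw [List.prod_cons, List.length_cons, show B * (l.length + 1) + 1 = B + (B * l.length + 1) by ring]
      at hdvd
    rcases hp.pow_dvd_or_pow_dvd _ _ _ _ hdvd with h' | h'
    · exact h x List.mem_cons_self h'
    · exact ih (fun y hy => h y (List.mem_cons_of_mem _ hy)) h'

/-- A word in unitriangular matrices over `ZMod (p ^ M)` whose exponents are not divisible by `p ^ B`,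
with `M` large compared to `B`, need not be trivial. -/
theorem Unitriangular.exists_prod_ne_one_zmod {p : ℕ} (hp : p.Prime) {I : Type*} (B : ℕ)
    (L : List (I × ℕ)) (hL : L ≠ []) (hc : L.IsChain fun x y => x.1 ≠ y.1)
    (h0 : ∀ x ∈ L, ¬ p ^ B ∣ x.2) {l : ℕ} (hl : L.length = l) :
    ∃ τ : I → Unitriangular (l + 1) (ZMod (p ^ (B * l + 1))),
      (L.map fun x => τ x.1 ^ x.2).prod ≠ 1 := by
  subst hl
  obtain ⟨τ, hτ⟩ := Unitriangular.exists_corner_eq_prod L.length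
    (fun i => (L.getD i (L.head hL)).1) (fun i hi => by
      rw [List.isChain_iff_getElem] at hc
      have := hc i hi
      rwa [List.getD_eq_getElem _ _ hi, List.getD_eq_getElem _ _ (Nat.lt_of_succ_lt hi)])
  refine ⟨fun i => Unitriangular.map (Int.castRingHom _) (τ i), fun h => ?_⟩
  have h1 := hτ fun i => ((L.getD i (L.head hL)).2 : ℤ)
  have h2 : ((List.range L.length).map fun i =>
      τ (L.getD i (L.head hL)).1 ^ ((L.getD i (L.head hL)).2 : ℤ)) = L.map fun x => τ x.1 ^ x.2 := by
    apply List.ext_getElem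
    · simp
    · intro i hi hi'
      simp only [List.length_map] at hi'
      rw [List.getElem_map, List.getElem_map, List.getElem_range, List.getD_eq_getElem _ _ hi',
        zpow_natCast]
  have h3 : ∏ i ∈ Finset.range L.length, ((L.getD i (L.head hL)).2 : ℤ) =
      (((L.map Prod.snd).prod : ℕ) : ℤ) := by
    rw [← Nat.cast_prod, Finset.prod_range, ← Fin.prod_univ_fun_getElem]
    congr 1
    refine Finset.prod_congr rfl fun i _ => ?_
    rw [List.getD_eq_getElem _ _ i.2]
  rw [h2, h3] at h1
  have h4 : Unitriangular.map (Int.castRingHom (ZMod (p ^ (B * L.length + 1))))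
      (L.map fun x => τ x.1 ^ x.2).prod = 1 := by
    rw [map_list_prod, List.map_map, ← h]
    congr 1
    apply List.map_congr_left
    intro x _
    simp
  have h5 := Unitriangular.dvd_of_map_eq_one h4 0 (Fin.last L.length)
  rw [Matrix.sub_apply, h1, Matrix.one_apply_ne, sub_zero] at h5
  · refine hp.not_pow_dvd_prod (B := B) (L.map Prod.snd) (fun x hx => ?_) ?_
    · obtain ⟨y, hy, rfl⟩ := List.mem_map.1 hx
      exact h0 y hy
    · rw [List.length_map]
      exact_mod_cast h5
  · rw [Ne, Fin.ext_iff]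
    simpa [eq_comm] using List.length_pos_iff.2 hL |>.ne'

/-- The pigeonhole principle: `J` conditions, each violated by at most one of `0, …, J`, are
satisfied by one of these numbers. -/
theorem exists_le_forall_not {ι : Type*} (J : ℕ) (E : List ι) (P : ι → ℕ → Prop)
    (hE : ∀ e ∈ E, ∀ i j, i < j → j ≤ J → P e i → ¬ P e j) (h : E.length ≤ J) :
    ∃ j ≤ J, ∀ e ∈ E, ¬ P e j := by
  by_contra hcon
  push Not at hcon
  choose! f hf hPf using hcon
  have key : ∀ j ≤ J, ∃ i < E.length, ∃ h : i < E.length, P E[i] j := by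
    intro j hj
    obtain ⟨i, hi, hi'⟩ := List.getElem_of_mem (hf j hj)
    exact ⟨i, hi, hi, hi' ▸ hPf j hj⟩
  choose! g hg hg' hPg using key
  obtain ⟨i, hi, j, hj, hij, hgij⟩ := Finset.exists_ne_map_eq_of_card_lt_of_maps_to
    (s := Finset.range (J + 1)) (t := Finset.range E.length) (f := g) (by simpa using by omega)
    (fun j hj => by simpa using hg j (by simpa [Nat.lt_succ_iff] using hj))
  simp only [Finset.mem_range, Nat.lt_succ_iff] at hi hj
  rcases lt_or_gt_of_ne hij with hlt | hlt
  · refine hE _ (List.getElem_mem (hg i hi)) i j hlt hj (hPg i hi) ?_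
    have := hPg j hj
    simpa only [hgij] using this
  · refine hE _ (List.getElem_mem (hg j hj)) j i hlt hi (hPg j hj) ?_
    have := hPg i hi
    simpa only [hgij] using this

end Counting

/-! ### Separating reduced words after adjoining a root -/

section RootSeparation

open Equiv

variable {p : ℕ} {S : Type*}

theorem IsFreeGroup.isResiduallyP {A : Type*} [Group A] [IsFreeGroup A] (hp : p.Prime) :
    IsResiduallyP p A :=
  isResiduallyP_of_unitriangular hp fun _ h => IsFreeGroup.exists_unitriangular_ne_one h

theorem IsFreeGroup.closureLeRoots {A : Type*} [Group A] [IsFreeGroup A] (hp : p.Prime) :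
    ClosureLeRoots p A :=
  closureLeRoots_of_unitriangular hp fun _ h => IsFreeGroup.exists_unitriangular_ne_one h

theorem FreeGroup.mk_pow_eq (w : List (S × Bool)) (k : ℕ) :
    FreeGroup.mk w ^ k = FreeGroup.mk (List.replicate k w).flatten := by
  induction k with
  | zero => rfl
  | succ k ih => rw [pow_succ', ih, FreeGroup.mul_mk, List.replicate_succ, List.flatten_cons]

/-- Proper suffixes of a cyclically reduced word are not powers of it. -/
theorem FreeGroup.mk_suffix_not_mem_zpowers {w β : List (S × Bool)} (hw : IsCyclicallyReduced w)
    (hβ : β <:+ w) (h0 : β ≠ []) (h1 : β ≠ w) :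
    FreeGroup.mk β ∉ Subgroup.zpowers (FreeGroup.mk w) := by
  classical
  have hnorm : ∀ k : ℕ, (FreeGroup.mk w ^ k).norm = k * w.length := by
    intro k
    rw [mk_pow_eq, norm, toWord_mk, ((hw.flatten_replicate k).isReduced).reduce_eq]
    simp
  have hβn : (FreeGroup.mk β).norm = β.length := by
    rw [norm, toWord_mk, (hw.isReduced.infix hβ.isInfix).reduce_eq]
  have hlt : β.length < w.length :=
    lt_of_le_of_ne hβ.length_le fun h => h1 (hβ.eq_of_length h)
  have hpos : 0 < β.length := List.length_pos_iff.2 h0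
  have key : ∀ k : ℕ, β.length ≠ k * w.length := by
    intro k hk
    rcases k with _ | k
    · omega
    · rw [hk, Nat.succ_mul] at hlt
      omega
  rintro ⟨t, ht⟩
  simp only at ht
  obtain ⟨k, rfl | rfl⟩ := t.eq_nat_or_neg
  · apply key k
    rw [← hβn, ← ht, zpow_natCast, hnorm]
  · apply key k
    rw [← hβn, ← ht, zpow_neg, norm_inv_eq, zpow_natCast, hnorm]

/-- The case of `exists_common_action` with trivial `B`. -/
theorem exists_action (hp : p.Prime) {A : Type*} [Group A] (hA : IsResiduallyP p A) {N : Subgroup A}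
    (hN : IsPOpen p N) :
    ∃ (Ω : Type) (_ : Finite Ω) (_ : Nonempty Ω) (Γ : Subgroup (Perm Ω)) (α : A →* Perm Ω),
      IsPGroup p Γ ∧ (∀ g, α g ∈ Γ) ∧ ∀ g ω, α g ω = ω → g ∈ N := by
  have hU : IsResiduallyP p Unit := fun g hg => absurd (Subsingleton.elim g 1) hg
  obtain ⟨Ω, h1, h2, Γ, α, -, h3, h4, -, -, h5, -⟩ := exists_common_action hp hA hU
    (u := (1 : A)) (v := (1 : Unit)) (Or.inr ⟨rfl, rfl⟩) hN isPOpen_top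
  exact ⟨Ω, h1, h2, Γ, α, h3, h4, h5⟩

/-- The position reached from `ω` by a word alternating between elements of `A` and powers of `σ`. -/
def altPos {A B Ω : Type*} [Group A] (α : A →* Perm Ω) (σ : Perm Ω) (κ : B → ℕ) (ω : Ω)
    (L : List (A × B)) : Ω := (L.map fun x => α x.1 * σ ^ κ x.2).prod ω

open Classical in
/-- The orbits of `σ` through which a word passes, together with the numbers of passages through
the selected points `y`. -/
noncomputable def crossWord {A B : Type*} {Ω : Type} [Group A] (α : A →* Perm Ω) (σ : Perm Ω)
    (κ : B → ℕ) (ω : Ω) (y : CycleSpace σ → Ω) : List (A × B) → List (CycleSpace σ × ℕ)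
  | [] => []
  | x :: L => (Quotient.mk _ (altPos α σ κ ω L), Nat.count
      (fun j => (σ ^ j) (altPos α σ κ ω L) = y (Quotient.mk _ (altPos α σ κ ω L))) (κ x.2)) ::
      crossWord α σ κ ω y L

section CrossWord

variable {A B : Type*} {Ω : Type} [Group A] (α : A →* Perm Ω) (σ : Perm Ω)
    (κ : B → ℕ) (ω : Ω) (y : CycleSpace σ → Ω)

theorem altPos_cons (x : A × B) (L : List (A × B)) :
    altPos α σ κ ω (x :: L) = α x.1 ((σ ^ κ x.2) (altPos α σ κ ω L)) := by
  simp [altPos]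

theorem crossWord_length (L : List (A × B)) : (crossWord α σ κ ω y L).length = L.length := by
  induction L with
  | nil => rfl
  | cons x L ih => rw [crossWord, List.length_cons, ih, List.length_cons]

open Classical in
theorem mem_crossWord {L : List (A × B)} {z : CycleSpace σ × ℕ} (hz : z ∈ crossWord α σ κ ω y L) :
    ∃ x L', x :: L' <:+ L ∧ z.2 = Nat.count
      (fun j => (σ ^ j) (altPos α σ κ ω L') = y (Quotient.mk _ (altPos α σ κ ω L'))) (κ x.2) := by
  induction L with
  | nil => simp [crossWord] at hz
  | cons x L ih =>
    rw [crossWord] at hz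
    rcases List.mem_cons.1 hz with rfl | hz
    · exact ⟨x, L, List.suffix_rfl, rfl⟩
    · obtain ⟨x', L', h, h'⟩ := ih hz
      exact ⟨x', L', h.trans (List.suffix_cons _ _), h'⟩

theorem crossWord_isChain (L : List (A × B)) (h : ∀ x ∈ L, ∀ ω, ∀ j : ℤ, α x.1 ω ≠ (σ ^ j) ω) :
    (crossWord α σ κ ω y L).IsChain fun x y => x.1 ≠ y.1 := by
  induction L with
  | nil => simp [crossWord]
  | cons x L ih =>
    rw [crossWord, List.isChain_cons]
    refine ⟨fun z hz => ?_, ih fun x hx => h x (List.mem_cons_of_mem _ hx)⟩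
    rcases L with _ | ⟨x', L⟩
    · simp [crossWord] at hz
    rw [crossWord] at hz
    simp only [List.head?_cons, Option.mem_def, Option.some.injEq] at hz
    subst hz
    intro h'
    simp only at h'
    rw [altPos_cons] at h'
    obtain ⟨j, hj⟩ := cycleSpace_mk_eq.1 h'.symm
    apply h x' (by simp) ((σ ^ κ x'.2) (altPos α σ κ ω L)) (j - κ x'.2)
    rw [← hj, ← zpow_natCast, ← Perm.mul_apply, ← zpow_add, sub_add_cancel]

/-- If elements of `A` are not twisted along the path of the word and the powers of `σ` are twisted according
to the passages through the selected points, then the twist of the word is read off from the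
orbits visited and the numbers of passages. -/
theorem twist_altProd_eq_crossWord {G V : Type*} [Group B] [Group G] [Group V] {iA : A →* G}
    {iB : B →* G} {Φ : G →* TwistedPerm Ω V} {t : CycleSpace σ → V} (L : List (A × B))
    (hA : ∀ a, (Φ (iA a)).perm = α a) (hB : ∀ b, (Φ (iB b)).perm = σ ^ κ b)
    (h1 : ∀ x L', x :: L' <:+ L → (Φ (iA x.1)).twist ((σ ^ κ x.2) (altPos α σ κ ω L')) = 1)
    (h2 : ∀ x L', x :: L' <:+ L → ∀ z ∈ (crossWord α σ κ ω y (x :: L')).head?,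
      (Φ (iB x.2)).twist (altPos α σ κ ω L') = t z.1 ^ z.2) :
    (Φ (altProd iA iB L)).perm ω = altPos α σ κ ω L ∧
    (Φ (altProd iA iB L)).twist ω = ((crossWord α σ κ ω y L).map fun z => t z.1 ^ z.2).prod := by
  induction L with
  | nil => simp [crossWord, altPos]
  | cons x L ih =>
    obtain ⟨ih1, ih2⟩ := ih (fun x' L' h => h1 x' L' (h.trans (List.suffix_cons _ _)))
      (fun x' L' h => h2 x' L' (h.trans (List.suffix_cons _ _)))
    constructor
    · rw [altProd_cons, map_mul, map_mul, TwistedPerm.perm_mul, TwistedPerm.perm_mul, Perm.mul_apply,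
        ih1, altPos_cons, hA, hB, Perm.mul_apply]
    · rw [altProd_cons, map_mul, map_mul, TwistedPerm.twist_mul, TwistedPerm.twist_mul, ih1, ih2, hB,
        h1 x L List.suffix_rfl, one_mul, crossWord, List.map_cons, List.prod_cons,
        h2 x L List.suffix_rfl _ (by rw [crossWord]; rfl)]

end CrossWord

end RootSeparation

section RootSeparation

open Equiv RootExtension

variable {p : ℕ} {S : Type*}

/-- An open subgroup in which finitely many instances of malnormality of `⟨h⟩` are visible. -/
theorem exists_isPOpen_malnormal (hp : p.Prime) {w : List (S × Bool)}
    (hw : FreeGroup.IsCyclicallyReduced w) (hh : FreeGroup.mk w ≠ 1)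
    (hmax : IsMaximalCyclicSubgroup (Subgroup.zpowers (FreeGroup.mk w))) (lA : List (FreeGroup S))
    (hlA : ∀ a ∈ lA, a ∉ Subgroup.zpowers (FreeGroup.mk w)) (J : ℕ) :
    ∃ N, IsPOpen p N ∧ (∀ a ∈ lA, ∀ i : ℤ, a⁻¹ * FreeGroup.mk w ^ i ∉ N) ∧
      (∀ j : ℕ, 0 < j → j ≤ J → FreeGroup.mk w ^ j ∉ N) ∧
      ∀ β, β <:+ w → β ≠ [] → β ≠ w → ∀ j : ℕ, 0 < j → j ≤ J → ∀ i : ℤ,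
        ((FreeGroup.mk β)⁻¹ * FreeGroup.mk w ^ j * FreeGroup.mk β)⁻¹ * FreeGroup.mk w ^ i ∉ N := by
  set h := FreeGroup.mk w
  have hcl : IsPClosedZPowers p h := by
    have := hmax.isPClosedZPowers hp 0
    rwa [pow_zero, pow_one] at this
  obtain ⟨N₁, hN₁, h1⟩ := exists_isPOpen_forall (p := p) lA
    (fun a N => ∀ i : ℤ, a⁻¹ * h ^ i ∉ N) (fun a M N hMN h j hj => h j (hMN hj))
    (fun a ha => exists_isPOpen_of_not_inPClosure hcl (hlA a ha))
  obtain ⟨N₂, hN₂, h2⟩ := exists_isPOpen_forall (p := p) (List.range (J + 1))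
    (fun j N => 0 < j → h ^ j ∉ N) (fun j M N hMN h hj hjM => h hj (hMN hjM))
    (fun j _ => by
      rcases Nat.eq_zero_or_pos j with rfl | hj
      · exact ⟨⊤, isPOpen_top, fun h => absurd h (lt_irrefl 0)⟩
      · obtain ⟨N, hN, hjN⟩ := IsFreeGroup.isResiduallyP hp _ (IsFreeGroup.pow_ne_one hh hj.ne')
        exact ⟨N, hN, fun _ => hjN⟩)
  obtain ⟨N₃, hN₃, h3⟩ := exists_isPOpen_forall (p := p) (w.tails.product (List.range (J + 1)))
    (fun x N => x.1 ≠ [] → x.1 ≠ w → 0 < x.2 → ∀ i : ℤ,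
      ((FreeGroup.mk x.1)⁻¹ * h ^ x.2 * FreeGroup.mk x.1)⁻¹ * h ^ i ∉ N)
    (fun x M N hMN h e1 e2 e3 i hi => h e1 e2 e3 i (hMN hi))
    (fun x hx => by
      by_cases hx' : x.1 ≠ [] ∧ x.1 ≠ w ∧ 0 < x.2
      · obtain ⟨e1, e2, e3⟩ := hx'
        have hs : x.1 <:+ w := (List.mem_tails _ _).1 (List.mem_product.1 hx).1
        obtain ⟨N, hN, h'⟩ := exists_isPOpen_of_not_inPClosure hcl
          (g := (FreeGroup.mk x.1)⁻¹ * h ^ x.2 * FreeGroup.mk x.1) (fun hmem => by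
            apply FreeGroup.mk_suffix_not_mem_zpowers hw hs e1 e2
            rw [← inv_mem_iff]
            apply hmax.mem_of_conj (n := x.2) (by exact_mod_cast e3.ne')
            rwa [zpow_natCast, inv_inv])
        exact ⟨N, hN, fun _ _ _ => h'⟩
      · exact ⟨⊤, isPOpen_top, fun e1 e2 e3 => absurd ⟨e1, e2, e3⟩ hx'⟩)
  refine ⟨N₁ ⊓ (N₂ ⊓ N₃), hN₁.inf (hN₂.inf hN₃), fun a ha i hi => h1 a ha i hi.1,
    fun j hj hj' hmem => h2 j (by simpa [Nat.lt_succ_iff] using hj') hj hmem.2.1,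
    fun β hβ e1 e2 j hj hj' i hmem => h3 (β, j) ?_ e1 e2 hj i hmem.2.2⟩
  exact List.mem_product.2 ⟨(List.mem_tails _ _).2 hβ, by simpa [Nat.lt_succ_iff] using hj'⟩

/-- In each orbit of `h` there is a point which is avoided by given finite families of paths, and by
the interior vertices of the paths labelled by powers of `h` in finitely many given orbits. By
malnormality, each family rules out at most one of the first `J + 1` points of the orbit. -/
theorem exists_private_point {w : List (S × Bool)} {Ω : Type} (α : FreeGroup S →* Perm Ω)
    {N : Subgroup (FreeGroup S)} (hα : ∀ g ω, α g ω = ω → g ∈ N) {J : ℕ}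
    (h2 : ∀ j : ℕ, 0 < j → j ≤ J → FreeGroup.mk w ^ j ∉ N)
    (h3 : ∀ β, β <:+ w → β ≠ [] → β ≠ w → ∀ j : ℕ, 0 < j → j ≤ J → ∀ i : ℤ,
        ((FreeGroup.mk β)⁻¹ * FreeGroup.mk w ^ j * FreeGroup.mk β)⁻¹ * FreeGroup.mk w ^ i ∉ N)
    (E : List (List (S × Bool) × Ω)) (Z : List Ω) (hJ : E.length + Z.length ≤ J) (u : Ω) :
    ∃ j : ℕ, (∀ x ∈ E, x.1 <:+ w → x.1 ≠ [] → x.1 ≠ w → ∀ i : ℕ,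
      α (FreeGroup.mk x.1) ((α (FreeGroup.mk w) ^ i) x.2) ≠ (α (FreeGroup.mk w) ^ j) u) ∧
      ∀ z ∈ Z, z ≠ (α (FreeGroup.mk w) ^ j) u := by
  set h := FreeGroup.mk w
  obtain ⟨j, -, hj⟩ := exists_le_forall_not J
    (E.map (fun x (j : ℕ) => x.1 <:+ w ∧ x.1 ≠ [] ∧ x.1 ≠ w ∧ ∃ i : ℕ,
      α (FreeGroup.mk x.1) ((α h ^ i) x.2) = (α h ^ j) u) ++
      Z.map (fun z (j : ℕ) => z = (α h ^ j) u)) (fun P => P) (by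
    intro P hP i j hij hj hi hj'
    obtain ⟨d, rfl⟩ := Nat.exists_eq_add_of_le hij.le
    have hd : 0 < d := by omega
    rcases List.mem_append.1 hP with hP | hP
    · obtain ⟨x, -, rfl⟩ := List.mem_map.1 hP
      obtain ⟨hs, e1, e2, i₁, hi₁⟩ := hi
      obtain ⟨-, -, -, i₂, hi₂⟩ := hj'
      refine h3 x.1 hs e1 e2 d hd (by omega) ((i₂ : ℤ) - i₁) (hα _ ((α h ^ i₁) x.2) ?_)
      rw [add_comm, pow_add, Perm.mul_apply, ← hi₁] at hi₂
      simp only [map_mul, map_inv, map_zpow, map_pow, Perm.mul_apply]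
      rw [← Perm.mul_apply (α h ^ ((i₂ : ℤ) - i₁)), ← zpow_natCast (α h) i₁, ← zpow_add, sub_add_cancel,
        Perm.inv_eq_iff_eq, zpow_natCast, zpow_natCast, Perm.mul_apply, Perm.mul_apply, ← hi₂,
        ← Perm.mul_apply, inv_mul_cancel, Perm.one_apply]
    · obtain ⟨z, -, rfl⟩ := List.mem_map.1 hP
      refine h2 d hd (by omega) (hα _ ((α h ^ i) u) ?_)
      rw [add_comm, pow_add, Perm.mul_apply] at hj'
      rw [map_pow, ← hj', hi]) (by simpa using hJ)
  refine ⟨j, fun x hx e1 e2 e3 i hi => hj _ (List.mem_append_left _ (List.mem_map_of_mem hx))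
    ⟨e1, e2, e3, i, hi⟩, fun z hz => hj _ (List.mem_append_right _ (List.mem_map_of_mem hz))⟩

open Classical in
/-- Reduced words are nontrivial in a finite `p`-quotient after adjoining a root. Starting from an
action of the free group on `Ω`, select a point in every orbit of `h` visited by the word, and twist the
letter `ℓ` at the selected points only. Then `h` is twisted when it passes through a selected point, the
factors from the free group are not twisted, and the twist of the word becomes a word in unitriangular
matrices, whose exponents are not divisible by a fixed power of `p`. -/
theorem RootExtension.exists_isPOpen_of_isCyclicallyReduced (hp : p.Prime) {w : List (S × Bool)}
    (hw : FreeGroup.IsCyclicallyReduced w) (hh : FreeGroup.mk w ≠ 1)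
    (hmax : IsMaximalCyclicSubgroup (Subgroup.zpowers (FreeGroup.mk w))) {n : ℕ} (hn : ¬ p ∣ n)
    (L : List (FreeGroup S × Multiplicative ℤ)) (hL0 : L ≠ [])
    (hL : IsReducedList (FreeGroup.mk w) (Multiplicative.ofAdd (n : ℤ)) L) :
    ∃ N : Subgroup (RootExtension (FreeGroup.mk w) n), IsPOpen p N ∧ altProd of powRoot L ∉ N := by
  set h := FreeGroup.mk w with hh_def
  obtain ⟨ℓ, hℓ⟩ : ∃ ℓ, ℓ ∈ w.getLast? := by
    rcases List.eq_nil_or_concat w with h0 | ⟨w', x, hx⟩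
    · rw [hh_def, h0] at hh
      exact absurd rfl hh
    · exact ⟨x, by rw [hx]; simp⟩
  -- The paths which have to avoid the selected points: their number does not depend on the action.
  set D : List (List (FreeGroup S × Multiplicative ℤ) × List (S × Bool)) := L.tails.product w.tails
  set D' : List (List (FreeGroup S × Multiplicative ℤ) × (FreeGroup S × Multiplicative ℤ) ×
    List (S × Bool)) := L.tails.product (L.product (L.flatMap fun x => x.1.toWord.tails))
  obtain ⟨N, hN, hN1, hN2, hN3⟩ := exists_isPOpen_malnormal hp hw hh hmax (L.map Prod.fst)
    (fun a ha => by
      obtain ⟨x, hx, rfl⟩ := List.mem_map.1 ha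
      exact (hL x hx).1) (D.length + D'.length)
  obtain ⟨Ω, _, ⟨ω⟩, Γ, α, hΓ, hαΓ, hα⟩ := exists_action hp (IsFreeGroup.isResiduallyP hp) hN
  set σ := α h
  obtain ⟨K, hK⟩ := hΓ.exists_uniform_pow hp
  have hσK : σ ^ p ^ K = 1 := congrArg Subtype.val (hK ⟨σ, hαΓ h⟩)
  -- `p ^ B` exceeds the exponents occurring, `K` bounds the periods of `h` on `Ω` and `M` the exponent of
  -- the group of twists; the order of the twisted `h` divides `P = p ^ (K + B + M)`.
  obtain ⟨B, hB⟩ : ∃ B : ℕ, ∀ x ∈ L, n + (Multiplicative.toAdd x.2).natAbs < p ^ B := by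
    refine ⟨n + (L.map fun x => (Multiplicative.toAdd x.2).natAbs).sum, fun x hx => ?_⟩
    refine lt_of_le_of_lt ?_ (Nat.lt_pow_self hp.one_lt)
    have := List.single_le_sum (l := L.map fun x => (Multiplicative.toAdd x.2).natAbs)
      (fun _ _ => Nat.zero_le _) _ (List.mem_map_of_mem hx)
    omega
  have : NeZero (p ^ (B * L.length + 1)) := ⟨pow_ne_zero _ hp.ne_zero⟩
  have hV := Unitriangular.isPGroup_zmod_pow (d := L.length + 1) p (B * L.length + 1)
  obtain ⟨M, hM⟩ := hV.exists_uniform_pow hp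
  set P : ℕ := p ^ (K + B + M)
  have hP : 0 < P := pow_pos hp.pos _
  obtain ⟨T, hT⟩ : ∃ T : ℕ, n * T ≡ 1 [MOD P] := by
    obtain ⟨T, hT⟩ := Nat.exists_mul_mod_eq_one_of_coprime
      (k := P * p) (n := n) (((hp.coprime_iff_not_dvd.2 hn).symm.pow_right _).mul_right
        (hp.coprime_iff_not_dvd.2 hn).symm)
      (lt_of_lt_of_le hp.one_lt (Nat.le_mul_of_pos_left _ hP))
    have h1 : n * T ≡ 1 [MOD P * p] := by
      rw [Nat.ModEq, hT.2, Nat.mod_eq_of_lt (lt_of_lt_of_le hp.one_lt (Nat.le_mul_of_pos_left _ hP))]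
    exact ⟨T, h1.of_mul_right p⟩
  -- The root acts as the power `T` of `h`, hence its `e`-th power as a power `κ e` of `h`.
  set κ : Multiplicative ℤ → ℕ := fun b => (T * Multiplicative.toAdd b % P).toNat with hκ_def
  have hκ : ∀ b, (κ b : ℤ) = T * Multiplicative.toAdd b % P := fun b =>
    Int.toNat_of_nonneg (Int.emod_nonneg _ (by exact_mod_cast hP.ne'))
  have hκ' : ∀ b, (P : ℤ) ∣ n * κ b - Multiplicative.toAdd b := by
    intro b
    have h1 : (P : ℤ) ∣ n * T - 1 := by
      have := (Nat.modEq_iff_dvd.1 hT.symm)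
      exact_mod_cast this
    have h2 : (P : ℤ) ∣ T * Multiplicative.toAdd b - κ b := by
      rw [hκ]
      exact Int.dvd_self_sub_emod
    have h3 : (n * κ b - Multiplicative.toAdd b : ℤ) = (n * T - 1) * Multiplicative.toAdd b -
        n * (T * Multiplicative.toAdd b - κ b) := by ring
    rw [h3]
    exact dvd_sub (h1.mul_right _) (h2.mul_left _)
  -- The selected points.
  let pos : List (FreeGroup S × Multiplicative ℤ) → Ω := altPos α σ κ ω
  have hsel : ∀ c : CycleSpace σ, (∃ L', L' <:+ L ∧ Quotient.mk _ (pos L') = c) → ∃ y : Ω,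
      Quotient.mk _ y = c ∧
      (∀ L', L' <:+ L → ∀ β, β <:+ w → β ≠ [] → β ≠ w → ∀ i : ℕ,
        α (FreeGroup.mk β) ((σ ^ i) (pos L')) ≠ y) ∧
      ∀ L', L' <:+ L → ∀ x ∈ L, ∀ γ, γ <:+ x.1.toWord →
        α (FreeGroup.mk γ) ((σ ^ κ x.2) (pos L')) ≠ y := by
    rintro c ⟨L₀, hL₀, rfl⟩
    obtain ⟨j, hj1, hj2⟩ := exists_private_point α hα hN2 hN3
      (D.map fun x => (x.2, pos x.1))
      (D'.map fun x => α (FreeGroup.mk x.2.2) ((σ ^ κ x.2.1.2) (pos x.1))) (by simp) (pos L₀)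
    refine ⟨(σ ^ j) (pos L₀), ?_, fun L' hL' β hβ e1 e2 i => ?_, fun L' hL' x hx γ hγ => ?_⟩
    · exact (cycleSpace_mk_eq.2 ⟨j, by rw [zpow_natCast]⟩).symm
    · exact hj1 (β, pos L') (List.mem_map.2 ⟨(L', β), List.mem_product.2
        ⟨(List.mem_tails _ _).2 hL', (List.mem_tails _ _).2 hβ⟩, rfl⟩) hβ e1 e2 i
    · exact hj2 _ (List.mem_map.2 ⟨(L', x, γ), List.mem_product.2
        ⟨(List.mem_tails _ _).2 hL', List.mem_product.2 ⟨hx, List.mem_flatMap.2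
          ⟨x, hx, (List.mem_tails _ _).2 hγ⟩⟩⟩, rfl⟩)
  have : Nonempty Ω := ⟨ω⟩
  choose! y hy1 hy2 hy3 using hsel
  have hvis : ∀ x L', x :: L' <:+ L → L' <:+ L := fun x L' h => (List.suffix_cons x L').trans h
  have hmem : ∀ x L', x :: L' <:+ L → x ∈ L := fun x L' h => h.subset List.mem_cons_self
  obtain ⟨t, ht⟩ := Unitriangular.exists_prod_ne_one_zmod hp B (crossWord α σ κ ω y L)
    (by
      rw [← List.length_pos_iff, crossWord_length]
      exact List.length_pos_iff.2 hL0)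
    (crossWord_isChain α σ κ ω y L fun x hx ω' j h' => by
      refine hN1 x.1 (List.mem_map_of_mem hx) j (hα _ ω' ?_)
      rw [map_mul, Perm.mul_apply, map_zpow, ← h', ← Perm.mul_apply, ← map_mul, inv_mul_cancel, map_one,
        Perm.one_apply])
    (fun z hz => by
      obtain ⟨x, L', hxL, hz2⟩ := mem_crossWord α σ κ ω y hz
      have hc := hy1 (Quotient.mk _ (pos L')) ⟨L', hvis _ _ hxL, rfl⟩
      obtain ⟨j, hj⟩ := cycleSpace_mk_eq.1 hc.symm
      obtain ⟨δ, hδ⟩ : ∃ δ : ℕ, (σ ^ δ) (pos L') = (σ ^ j) (pos L') := by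
        have h0 : (0 : ℤ) < (p ^ K : ℕ) := by exact_mod_cast pow_pos hp.pos K
        refine ⟨(j % (p ^ K : ℕ)).toNat, ?_⟩
        rw [← zpow_natCast, Int.toNat_of_nonneg (Int.emod_nonneg _ h0.ne')]
        conv_rhs => rw [← Int.emod_add_mul_ediv j (p ^ K : ℕ), zpow_add, zpow_mul, zpow_natCast σ, hσK,
          one_zpow, mul_one]
      rw [hz2]
      have hx := hL x (hmem _ _ hxL)
      have := not_dvd_count hp (B := B) (K := K) (n := n) (e := Multiplicative.toAdd x.2)
        (fun ⟨s, hs⟩ => hx.2 ⟨s, by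
          apply Multiplicative.toAdd.injective
          simp [hs, mul_comm]⟩) (hB x (hmem _ _ hxL)) hσK (pos L') δ (κ x.2)
        ((Int.natCast_dvd_natCast.2 (pow_dvd_pow p (by omega))).trans (hκ' x.2))
      rw [hδ, hj] at this
      exact this)
    (crossWord_length α σ κ ω y L)
  -- The twist: `t` at the selected points of the orbits visited by the word, trivial elsewhere.
  let τ : Ω → Unitriangular (L.length + 1) (ZMod (p ^ (B * L.length + 1))) := fun z =>
    if (∃ L', L' <:+ L ∧ Quotient.mk _ (pos L') = (Quotient.mk _ z : CycleSpace σ)) ∧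
      z = y (Quotient.mk _ z) then t (Quotient.mk _ z) else 1
  let E := edgeTwist α ℓ τ
  have hEP : E h ^ P = 1 := by
    have h1 : E h ^ (p ^ K * p ^ M) = 1 :=
      TwistedPerm.pow_mul_eq_one (by rw [edgeTwist_perm]; exact hσK) hM
    have h2 : P = p ^ K * p ^ M * p ^ B := by simp only [P]; rw [pow_add, pow_add]; ring
    rw [h2, pow_mul, h1, one_pow]
  obtain ⟨Φ, hΦ1, hΦ2⟩ := RootExtension.exists_lift (h := h) (n := n) E (E h ^ T) (by
    rw [← pow_mul, mul_comm T n]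
    have h1 := pow_eq_pow_mod (n * T) hEP
    rw [h1, hT, ← pow_eq_pow_mod 1 hEP, pow_one])
  have hΦB : ∀ b, Φ (powRoot b) = E h ^ κ b := by
    intro b
    rw [← ofAdd_toAdd b, powRoot_apply, map_zpow, hΦ2, ← zpow_natCast, ← zpow_mul, ← zpow_natCast,
      hκ, ofAdd_toAdd]
    conv_lhs => rw [← Int.emod_add_mul_ediv (T * Multiplicative.toAdd b) P, zpow_add, zpow_mul,
      zpow_natCast (E h), hEP, one_zpow, mul_one]
  have hτ2 : ∀ L', L' <:+ L → ∀ β, β <:+ w → β ≠ [] → β ≠ w → ∀ i : ℕ,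
      τ (α (FreeGroup.mk β) ((σ ^ i) (pos L'))) = 1 := by
    intro L' hL' β hβ e1 e2 i
    apply if_neg
    rintro ⟨hv, hz⟩
    exact hy2 _ hv L' hL' β hβ e1 e2 i hz
  obtain ⟨hperm, htwist⟩ := twist_altProd_eq_crossWord α σ κ ω y (Φ := Φ) (t := t) L
    (fun a => by rw [hΦ1, edgeTwist_perm]) (fun b => by rw [hΦB, TwistedPerm.perm_pow, edgeTwist_perm])
    (fun x L' hxL => by
      rw [hΦ1, ← FreeGroup.mk_toWord (x := x.1)]
      apply edgeTwist_twist_eq_one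
      intro γ hγ
      apply if_neg
      rintro ⟨hv, hz⟩
      exact hy3 _ hv L' (hvis _ _ hxL) x (hmem _ _ hxL) γ hγ hz)
    (fun x L' hxL z hz => by
      rw [crossWord] at hz
      simp only [List.head?_cons, Option.mem_def, Option.some.injEq] at hz
      subst hz
      rw [hΦB]
      refine edgeTwist_twist_pow α ℓ τ hw hℓ _ _ _ (fun β hβ e1 e2 j =>
        hτ2 L' (hvis _ _ hxL) β hβ e1 e2 j) (fun j => ?_) _
      have ho : (Quotient.mk _ ((σ ^ j) (pos L')) : CycleSpace σ) = Quotient.mk _ (pos L') :=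
        (cycleSpace_mk_eq.2 ⟨j, by rw [zpow_natCast]⟩).symm
      show τ ((σ ^ j) (pos L')) = _
      simp only [τ]
      rw [ho]
      have hv : ∃ L'', L'' <:+ L ∧ (Quotient.mk _ (pos L'') : CycleSpace σ) = Quotient.mk _ (pos L') :=
        ⟨L', hvis _ _ hxL, rfl⟩
      simp only [hv, true_and]
      rfl)
  have hpermΓ : ∀ g, (Φ g).perm ∈ Γ := RootExtension.isAmalgam.perm_mem
    (fun a => by rw [hΦ1, edgeTwist_perm]; exact hαΓ a)
    (fun b => by rw [hΦB, TwistedPerm.perm_pow, edgeTwist_perm]; exact Γ.pow_mem (hαΓ h) _)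
  refine ⟨Φ.ker, TwistedPerm.isPOpen_ker hp hV hΓ Φ hpermΓ, fun hker => ht ?_⟩
  rw [← htwist, MonoidHom.mem_ker.1 hker, TwistedPerm.twist_one]

end RootSeparation

/-! ### Root extensions of free groups -/

section RootExtensionProperties

open RootExtension

variable {p n : ℕ} {A : Type*} [Group A]

theorem IsMaximalCyclicSubgroup.map_mulEquiv {A' : Type*} [Group A'] (e : A ≃* A') {h : A}
    (hh : IsMaximalCyclicSubgroup (Subgroup.zpowers h)) :
    IsMaximalCyclicSubgroup (Subgroup.zpowers (e h)) := by
  refine ⟨show IsCyclic (Subgroup.zpowers (e h)) from inferInstance, fun D hD hle => ?_⟩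
  obtain ⟨d, rfl⟩ := (Subgroup.isCyclic_iff_exists_zpowers_eq_top D).1 hD
  rw [Subgroup.zpowers_le]
  obtain ⟨j, hj⟩ : e h ∈ Subgroup.zpowers d := hle (Subgroup.mem_zpowers _)
  have h1 : h ∈ Subgroup.zpowers (e.symm d) := ⟨j, by
    simp only at hj ⊢
    rw [← map_zpow, hj, e.symm_apply_apply]⟩
  obtain ⟨i, hi⟩ := hh.mem_of_mem_zpowers h1 (Subgroup.mem_zpowers _)
  exact ⟨i, by simp only at hi ⊢; rw [← map_zpow, hi, e.apply_symm_apply]⟩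

/-- Every element of a free group is given by a cyclically reduced word in suitable free generators. -/
theorem IsFreeGroup.exists_isCyclicallyReduced [IsFreeGroup A] (h : A) :
    ∃ (e : A ≃* FreeGroup (IsFreeGroup.Generators A)) (w : List (IsFreeGroup.Generators A × Bool)),
      FreeGroup.IsCyclicallyReduced w ∧ e h = FreeGroup.mk w := by
  classical
  set e₀ := IsFreeGroup.toFreeGroup A
  set C := FreeGroup.mk (FreeGroup.reduceCyclically.conjugator (e₀ h).toWord)
  have h1 : e₀ h = C * FreeGroup.mk (FreeGroup.reduceCyclically (e₀ h).toWord) * C⁻¹ := by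
    conv_lhs => rw [← FreeGroup.mk_toWord (x := e₀ h),
      ← FreeGroup.reduceCyclically.conj_conjugator_reduceCyclically (e₀ h).toWord]
    rw [FreeGroup.inv_mk, FreeGroup.mul_mk, FreeGroup.mul_mk]
  refine ⟨e₀.trans (MulAut.conj C⁻¹), FreeGroup.reduceCyclically (e₀ h).toWord,
    FreeGroup.reduceCyclically.isCyclicallyReduced FreeGroup.isReduced_toWord, ?_⟩
  have h2 : C⁻¹ * e₀ h * C⁻¹⁻¹ = C⁻¹ * (C * FreeGroup.mk (FreeGroup.reduceCyclically
      (e₀ h).toWord) * C⁻¹) * C⁻¹⁻¹ := congrArg (fun x => C⁻¹ * x * C⁻¹⁻¹) h1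
  exact h2.trans (by group)

theorem RootExtension.hom_ext {h : A} {Q : Type*} [Group Q] {Φ Ψ : RootExtension h n →* Q}
    (h1 : ∀ a, Φ (of a) = Ψ (of a)) (h2 : Φ root = Ψ root) : Φ = Ψ := by
  have := MonoidHom.eqOn_closure (f := Φ) (g := Ψ)
    (s := Set.range (of : A →* RootExtension h n) ∪ {root}) (by
      rintro _ (⟨a, rfl⟩ | rfl)
      · exact h1 a
      · exact h2)
  rw [RootExtension.closure_eq_top] at this
  ext x
  exact this trivial

theorem RootExtension.exists_isPOpen_of_isReducedList [IsFreeGroup A] (hp : p.Prime) {h : A}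
    (hh : h ≠ 1) (hmax : IsMaximalCyclicSubgroup (Subgroup.zpowers h)) (hn : ¬ p ∣ n)
    (L : List (A × Multiplicative ℤ)) (hL0 : L ≠ [])
    (hL : IsReducedList h (Multiplicative.ofAdd (n : ℤ)) L) :
    ∃ N : Subgroup (RootExtension h n), IsPOpen p N ∧ altProd of powRoot L ∉ N := by
  obtain ⟨e, w, hw, hew⟩ := IsFreeGroup.exists_isCyclicallyReduced h
  obtain ⟨N, hN, hLN⟩ := RootExtension.exists_isPOpen_of_isCyclicallyReduced hp hw
    (by rw [← hew]; simpa using hh) (by rw [← hew]; exact hmax.map_mulEquiv e) hn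
    (L.map fun x => (e x.1, x.2)) (by simpa using hL0) (by
      intro y hy
      obtain ⟨x, hx, rfl⟩ := List.mem_map.1 hy
      refine ⟨fun ⟨j, hj⟩ => (hL x hx).1 ⟨j, e.injective ?_⟩, (hL x hx).2⟩
      simp only at hj ⊢
      rw [map_zpow, hew, hj])
  obtain ⟨Φ, h1, h2⟩ := RootExtension.exists_lift (h := h) (n := n)
    ((of : _ →* RootExtension (FreeGroup.mk w) n).comp e.toMonoidHom) root (by
      rw [root_pow, ← hew]; rfl)
  refine ⟨N.comap Φ, hN.comap Φ, fun hmem => hLN ?_⟩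
  have h3 : ∀ b, Φ (powRoot b) = powRoot b := fun b => by
    rw [← ofAdd_toAdd b, powRoot_apply, powRoot_apply, map_zpow, h2]
  have h4 : Φ (altProd of powRoot L) = altProd of powRoot (L.map fun x => (e x.1, x.2)) := by
    rw [altProd, altProd, map_list_prod, List.map_map, List.map_map]
    congr 1
    apply List.map_congr_left
    intro x _
    simp [h1, h3]
  rwa [← h4]

/-- In a finite `p`-group every element has an `n`-th root, so that the `p`-quotients of `A` extend to the
root extension. -/
theorem RootExtension.exists_isPOpen_of [IsFreeGroup A] (hp : p.Prime) {h : A} (hn : ¬ p ∣ n) {a : A}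
    (ha : a ≠ 1) : ∃ N : Subgroup (RootExtension h n), IsPOpen p N ∧ of a ∉ N := by
  have := Fact.mk hp
  obtain ⟨N, hN, haN⟩ := IsFreeGroup.isResiduallyP hp a ha
  have := hN.normal
  have := hN.finiteIndex
  obtain ⟨y, hy⟩ := (hN.isPGroup_quotient.powEquiv' hn).surjective (h : A ⧸ N)
  obtain ⟨Φ, h1, -⟩ := RootExtension.exists_lift (h := h) (n := n) (QuotientGroup.mk' N) y hy
  refine ⟨_, isPOpen_ker hp hN.isPGroup_quotient Φ, fun hmem => haN ?_⟩
  rw [MonoidHom.mem_ker, h1] at hmem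
  exact (QuotientGroup.eq_one_iff a).1 hmem

theorem RootExtension.of_ne_one [IsFreeGroup A] (hp : p.Prime) {h : A} (hn : ¬ p ∣ n) {a : A}
    (ha : a ≠ 1) : (of a : RootExtension h n) ≠ 1 := by
  obtain ⟨N, -, hN⟩ := RootExtension.exists_isPOpen_of (h := h) hp hn ha
  rintro h1
  exact hN (h1 ▸ one_mem N)

theorem RootExtension.root_zpow_ne_one [IsFreeGroup A] (hp : p.Prime) {h : A} (hh : h ≠ 1)
    (hn : ¬ p ∣ n) (e : ℤ) (he : e ≠ 0) : (root : RootExtension h n) ^ e ≠ 1 := by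
  intro h1
  apply RootExtension.of_ne_one (h := h) hp hn (IsFreeGroup.zpow_ne_one hh he)
  rw [map_zpow, ← root_pow, ← zpow_natCast, ← zpow_mul, mul_comm, zpow_mul, h1, one_zpow]

theorem RootExtension.isResiduallyP [IsFreeGroup A] (hp : p.Prime) {h : A} (hh : h ≠ 1)
    (hmax : IsMaximalCyclicSubgroup (Subgroup.zpowers h)) (hn : ¬ p ∣ n) :
    IsResiduallyP p (RootExtension h n) := by
  intro g hg
  obtain ⟨c, hc⟩ := RootExtension.isAmalgam.exists_conj g
  apply IsResiduallyP.of_conj (c := c)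
  have hg' : c * g * c⁻¹ ≠ 1 := by
    rw [Ne, conj_eq_one_iff]; exact hg
  rcases hc with ⟨a, ha⟩ | ⟨b, hb⟩ | ⟨L, hL0, hL, h'⟩
  · rw [ha] at hg' ⊢
    exact RootExtension.exists_isPOpen_of hp hn (by rintro rfl; exact hg' (map_one _))
  · rw [hb] at hg' ⊢
    rw [← ofAdd_toAdd b, powRoot_apply] at hg' ⊢
    have he : Multiplicative.toAdd b ≠ 0 := by
      intro h0
      rw [h0, zpow_zero] at hg'
      exact hg' rfl
    obtain ⟨N, hN, hmem⟩ := RootExtension.exists_isPOpen_of (h := h) hp hn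
      (IsFreeGroup.zpow_ne_one hh he)
    refine ⟨N, hN, fun h1 => hmem ?_⟩
    rw [map_zpow, ← root_pow, ← zpow_natCast, ← zpow_mul, mul_comm, zpow_mul]
    exact N.zpow_mem h1 _
  · rw [h']
    exact RootExtension.exists_isPOpen_of_isReducedList hp hh hmax hn L hL0 hL

/-- The group obtained from a free group by adjoining a root of degree prime to `p` of a generator of a
maximal cyclic subgroup is residually a group of integral unitriangular matrices. -/
theorem RootExtension.exists_unitriangular_ne_one [IsFreeGroup A] (hp : p.Prime) {h : A} (hh : h ≠ 1)
    (hmax : IsMaximalCyclicSubgroup (Subgroup.zpowers h)) (hn : ¬ p ∣ n) (g : RootExtension h n)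
    (hg : g ≠ 1) : ∃ (d : ℕ) (θ : RootExtension h n →* Unitriangular d ℤ), θ g ≠ 1 := by
  obtain ⟨N, hN, hgN⟩ := RootExtension.isResiduallyP hp hh hmax hn g hg
  have := hN.normal
  have := hN.finiteIndex
  obtain ⟨d, θ, Y, ρ, hρ, hY, h1, h2⟩ := exists_unitriangular_lift hp hn h hN.isPGroup_quotient
    ((QuotientGroup.mk' N).comp of) (QuotientGroup.mk' N root) (by
      rw [← map_pow, root_pow]; rfl)
  obtain ⟨Θ, hΘ1, hΘ2⟩ := RootExtension.exists_lift θ Y hY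
  have h3 : (Unitriangular.map (Int.castRingHom (ZMod p))).comp Θ = ρ.comp (QuotientGroup.mk' N) := by
    apply RootExtension.hom_ext
    · intro a
      rw [MonoidHom.comp_apply, hΘ1, h1]; rfl
    · rw [MonoidHom.comp_apply, hΘ2, h2]; rfl
  refine ⟨d, Θ, fun h4 => hgN ((QuotientGroup.eq_one_iff g).1 (hρ ?_))⟩
  have h5 := DFunLike.congr_fun h3 g
  rw [MonoidHom.comp_apply, h4, map_one] at h5
  rw [map_one]
  exact h5.symm

/-- The commutator of a reduced product with an element `x` of a factor is again a reduced
product. -/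
theorem exists_altProd_eq_commutator {A B G : Type*} [Group A] [Group B] [Group G] (iA : A →* G)
    (iB : B →* G) {u : A} {v : B} {x : B} (hx : x ∉ Subgroup.zpowers v) (L : List (B × A))
    (hL : IsReducedList v u L) : ∀ (a : A) (y : B), a ∉ Subgroup.zpowers u → y ∉ Subgroup.zpowers v →
    ∃ L' : List (A × B), L' ≠ [] ∧ IsReducedList u v L' ∧
      iA a * altProd iB iA L * iB x * (iA a * altProd iB iA L)⁻¹ * iB y = altProd iA iB L' := by
  induction L with
  | nil =>
    intro a y ha hy
    refine ⟨[(a, x), (a⁻¹, y)], by simp, ?_, by simp [mul_assoc]⟩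
    intro z hz
    simp only [List.mem_cons, List.not_mem_nil, or_false] at hz
    rcases hz with rfl | rfl
    · exact ⟨ha, hx⟩
    · exact ⟨by rwa [inv_mem_iff], hy⟩
  | cons z L ih =>
    intro a y ha hy
    have hz := hL z List.mem_cons_self
    obtain ⟨L', -, hL', h'⟩ := ih hL.tail z.2 z.1⁻¹ hz.2 (by rw [inv_mem_iff]; exact hz.1)
    refine ⟨(a, z.1) :: (L' ++ [(a⁻¹, y)]), by simp, ?_, ?_⟩
    · refine IsReducedList.cons (fun t ht => ?_) ha hz.1
      rcases List.mem_append.1 ht with ht | ht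
      · exact hL' t ht
      · rw [List.mem_singleton.1 ht]
        exact ⟨by rw [inv_mem_iff]; exact ha, hy⟩
    · rw [altProd_cons, altProd_cons, altProd_append, ← h']
      simp only [altProd_cons, altProd_nil, map_inv, mul_one]
      group

/-- The adjoined root generates a closed subgroup: this subgroup is its own centralizer, because the
commutator of the root with an element outside it is a nontrivial reduced product. -/
theorem RootExtension.isPClosedZPowers_root [IsFreeGroup A] (hp : p.Prime) {h : A} (hh : h ≠ 1)
    (hmax : IsMaximalCyclicSubgroup (Subgroup.zpowers h)) (hn : ¬ p ∣ n) (hn1 : n ≠ 1) :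
    IsPClosedZPowers p (root : RootExtension h n) := by
  intro g hg
  have hcomm := hg.commute (RootExtension.isResiduallyP hp hh hmax hn)
  rcases RootExtension.isAmalgam.symm.exists_expression g with
    ⟨b, rfl⟩ | ⟨b, a, L, b', ha, hL, rfl⟩
  · exact ⟨Multiplicative.toAdd b, by simp only; rw [← powRoot_apply, ofAdd_toAdd]⟩
  exfalso
  -- The root itself is not in the amalgamated subgroup, as `n ≠ 1` (and `n ≠ 0`, because `p ∤ n`).
  have hx : (Multiplicative.ofAdd (1 : ℤ)) ∉ Subgroup.zpowers (Multiplicative.ofAdd (n : ℤ)) := by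
    rintro ⟨j, hj⟩
    have h1 : j * n = 1 := by
      simpa using congrArg Multiplicative.toAdd hj
    rcases Int.eq_one_or_neg_one_of_mul_eq_one' h1 with h2 | h2 <;> omega
  obtain ⟨L', hL0, hL', h'⟩ := exists_altProd_eq_commutator (of : A →* RootExtension h n) powRoot hx L
    hL a (Multiplicative.ofAdd (1 : ℤ))⁻¹ ha (by rwa [inv_mem_iff])
  obtain ⟨N, -, hN⟩ := RootExtension.exists_isPOpen_of_isReducedList hp hh hmax hn L' hL0 hL'
  apply hN
  set W : RootExtension h n := of a * altProd powRoot of L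
  have hcb : ∀ b, Commute (powRoot b : RootExtension h n) root := fun b =>
    (Commute.all b (Multiplicative.ofAdd 1)).map powRoot
  have hW : Commute W root := by
    have h1 : W = (powRoot b)⁻¹ * (powRoot b * of a * altProd powRoot of L * powRoot b') *
        (powRoot b')⁻¹ := by
      simp only [W]; group
    rw [h1]
    exact ((hcb b).inv_left.mul_left hcomm).mul_left (hcb b').inv_left
  rw [← h', map_inv]
  have h2 : W * root * W⁻¹ * root⁻¹ = 1 := by
    rw [hW.eq]; group
  exact h2 ▸ one_mem N

end RootExtensionProperties

/-! ### The amalgamated product of two free groups -/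

section Final

variable {p : ℕ} {A B G : Type*} [Group A] [Group B] [Group G]

theorem IsResiduallyP.isPClosedZPowers_one (hA : IsResiduallyP p A) : IsPClosedZPowers p (1 : A) := by
  intro g hg
  by_contra hne
  obtain ⟨N, hN, hgN⟩ := hA g (by rintro rfl; exact hne (one_mem _))
  obtain ⟨j, hj⟩ := hg N hN
  rw [one_zpow, mul_one, inv_mem_iff] at hj
  exact hgN hj

theorem isAmalgam_amalgamatedProduct (a : A) (b : B)
    (φ : Subgroup.zpowers a ≃* Subgroup.zpowers b) :
    ∃ (iA : A →* AmalgamatedProduct (Subgroup.zpowers a) (Subgroup.zpowers b) φ)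
      (iB : B →* AmalgamatedProduct (Subgroup.zpowers a) (Subgroup.zpowers b) φ),
      IsAmalgam iA iB a (φ ⟨a, Subgroup.mem_zpowers a⟩ : B) := by
  let R : Set (Monoid.Coprod A B) := Set.range fun h : Subgroup.zpowers a =>
    (Monoid.Coprod.inl (h : A) * (Monoid.Coprod.inr (φ h : B))⁻¹ : Monoid.Coprod A B)
  let π : Monoid.Coprod A B →* AmalgamatedProduct (Subgroup.zpowers a) (Subgroup.zpowers b) φ :=
    QuotientGroup.mk' (Subgroup.normalClosure R)
  have hπ : Function.Surjective π := QuotientGroup.mk'_surjective _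
  refine ⟨π.comp Monoid.Coprod.inl, π.comp Monoid.Coprod.inr, ?_, ?_, ?_⟩
  · rw [← mul_inv_eq_one]
    exact (QuotientGroup.eq_one_iff (Monoid.Coprod.inl a * (Monoid.Coprod.inr
      (φ ⟨a, Subgroup.mem_zpowers a⟩ : B))⁻¹ : Monoid.Coprod A B)).2
      (Subgroup.subset_normalClosure ⟨⟨a, Subgroup.mem_zpowers a⟩, rfl⟩)
  · have h1 : (Subgroup.closure (Set.range (π.comp Monoid.Coprod.inl) ∪
        Set.range (π.comp Monoid.Coprod.inr))).comap π = ⊤ := by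
      rw [eq_top_iff, ← Monoid.Coprod.range_inl_sup_range_inr, sup_le_iff]
      constructor
      · rintro _ ⟨x, rfl⟩
        exact Subgroup.subset_closure (Or.inl ⟨x, rfl⟩)
      · rintro _ ⟨x, rfl⟩
        exact Subgroup.subset_closure (Or.inr ⟨x, rfl⟩)
    rw [eq_top_iff]
    intro x _
    obtain ⟨x, rfl⟩ := hπ x
    have : x ∈ (⊤ : Subgroup (Monoid.Coprod A B)) := Subgroup.mem_top x
    rw [← h1] at this
    exact this
  · intro Q _ α β hαβ
    have hker : Subgroup.normalClosure R ≤ (Monoid.Coprod.lift α β).ker := by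
      rw [← Subgroup.normalClosure_subset_iff]
      rintro _ ⟨⟨_, j, rfl⟩, rfl⟩
      have h1 : (⟨a ^ j, ⟨j, rfl⟩⟩ : Subgroup.zpowers a) = ⟨a, Subgroup.mem_zpowers a⟩ ^ j :=
        Subtype.ext (by simp)
      show Monoid.Coprod.lift α β _ = 1
      rw [map_mul, map_inv, Monoid.Coprod.lift_apply_inl, Monoid.Coprod.lift_apply_inr, mul_inv_eq_one]
      show α (a ^ j) = β (φ ⟨a ^ j, ⟨j, rfl⟩⟩ : B)
      rw [h1, map_zpow φ, Subgroup.coe_zpow, map_zpow, map_zpow, hαβ]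
    refine ⟨QuotientGroup.lift _ (Monoid.Coprod.lift α β) hker, fun a => ?_, fun b => ?_⟩
    · exact Monoid.Coprod.lift_apply_inl α β a
    · exact Monoid.Coprod.lift_apply_inr α β b

/-- Splitting off the prime-to-`p` part of an amalgamation `h = k' ^ n`: first adjoin an `n`-th root
to `h`, then identify the root with `k'`. -/
theorem IsAmalgam.exists_rootExtension {iA : A →* G} {iB : B →* G} {h : A} {k' : B} {n : ℕ}
    (hG : IsAmalgam iA iB h (k' ^ n)) :
    ∃ j : RootExtension h n →* G, IsAmalgam j iB RootExtension.root k' := by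
  obtain ⟨j, h1, h2⟩ := RootExtension.exists_lift (h := h) (n := n) iA (iB k')
    (by rw [← map_pow, hG.comm])
  refine ⟨j, h2, ?_, fun Q _ α β hαβ => ?_⟩
  · rw [eq_top_iff, ← hG.closure_eq_top]
    apply Subgroup.closure_mono
    apply Set.union_subset_union_left
    rintro _ ⟨a, rfl⟩
    exact ⟨_, h1 a⟩
  · obtain ⟨Φ, h3, h4⟩ := hG.exists_lift Q (α.comp RootExtension.of) β (by
      rw [MonoidHom.comp_apply, ← RootExtension.root_pow, map_pow, hαβ, map_pow])
    have h5 : Φ.comp j = α := by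
      apply RootExtension.hom_ext
      · intro a
        rw [MonoidHom.comp_apply, h1, h3]; rfl
      · rw [MonoidHom.comp_apply, h2, h4, hαβ]
    exact ⟨Φ, fun a => DFunLike.congr_fun h5 a, h4⟩

/-- An isomorphism of cyclic groups `⟨a⟩ ≃ ⟨k ^ n⟩` maps `a` to `k ^ n` or its inverse. -/
theorem exists_maximal_pow_eq [IsFreeGroup B] {a : A} {k : B}
    (hk : IsMaximalCyclicSubgroup (Subgroup.zpowers k))
    {n : ℕ} (φ : Subgroup.zpowers a ≃* Subgroup.zpowers (k ^ n)) :
    ∃ k' : B, IsMaximalCyclicSubgroup (Subgroup.zpowers k') ∧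
      (φ ⟨a, Subgroup.mem_zpowers a⟩ : B) = k' ^ n := by
  set v := φ ⟨a, Subgroup.mem_zpowers a⟩
  obtain ⟨r, hr⟩ := v.2
  simp only at hr
  have h2 : ∃ s : ℤ, (v : B) ^ s = k ^ n := by
    obtain ⟨⟨_, s, rfl⟩, hx⟩ := φ.surjective ⟨k ^ n, Subgroup.mem_zpowers _⟩
    refine ⟨s, ?_⟩
    have h1 : (⟨a ^ s, ⟨s, rfl⟩⟩ : Subgroup.zpowers a) = ⟨a, Subgroup.mem_zpowers a⟩ ^ s :=
      Subtype.ext (by simp)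
    have h3 := congrArg Subtype.val hx
    simp only at h3
    refine Eq.trans ?_ h3
    show ((φ ⟨a, Subgroup.mem_zpowers a⟩ : Subgroup.zpowers (k ^ n)) : B) ^ s = _
    rw [← Subgroup.coe_zpow, ← map_zpow, ← h1]
  obtain ⟨s, hs⟩ := h2
  by_cases hkn : k ^ n = 1
  · refine ⟨k, hk, ?_⟩
    rw [← hr, hkn, one_zpow]
  · have h4 : r * s = 1 := by
      apply IsFreeGroup.zpow_injective hkn
      simp only
      rw [zpow_mul, hr, hs, zpow_one]
    rcases Int.eq_one_or_neg_one_of_mul_eq_one h4 with h5 | h5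
    · exact ⟨k, hk, by rw [← hr, h5, zpow_one]⟩
    · exact ⟨k⁻¹, by rwa [Subgroup.zpowers_inv], by rw [← hr, h5, zpow_neg, zpow_one, inv_pow]⟩

theorem IsPPrimeIsolated.mem_of_pow_mem {F : Subgroup G} (hF : IsPPrimeIsolated p F) :
    ∀ (a : ℕ), ¬ p ∣ a → ∀ g : G, g ^ a ∈ F → g ∈ F := by
  intro a
  induction a using Nat.strong_induction_on with
  | _ a ih =>
  intro ha g hg
  by_cases ha1 : a = 1
  · rwa [ha1, pow_one] at hg
  · obtain ⟨q, hq, b, rfl⟩ := Nat.exists_prime_and_dvd ha1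
    have hb0 : 0 < b := Nat.pos_of_ne_zero (by rintro rfl; exact ha (by simp))
    have hqp : q ≠ p := by rintro rfl; exact ha (dvd_mul_right _ _)
    refine hF g q hq hqp (ih b (lt_mul_of_one_lt_left hb0 hq.one_lt)
      (fun h => ha (h.mul_left q)) _ ?_)
    rwa [← pow_mul]

theorem IsPSeparable.of_closureLeRoots (hG : ClosureLeRoots p G) {F : Subgroup G} (hc : IsCyclic F)
    (hF : IsPPrimeIsolated p F) : IsPSeparable p F := by
  obtain ⟨f, rfl⟩ := (Subgroup.isCyclic_iff_exists_zpowers_eq_top F).1 hc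
  intro g hg
  have hcl : ¬ InPClosure p f g := fun h => by
    obtain ⟨a, ha, hmem⟩ := hG f g h
    exact hg (hF.mem_of_pow_mem a ha g hmem)
  simp only [InPClosure, not_forall, not_exists] at hcl
  obtain ⟨N, hN, hgN⟩ := hcl
  have := hN.normal
  have := hN.finiteIndex
  refine ⟨G ⧸ N, inferInstance, QuotientGroup.mk' N, inferInstance, hN.isPGroup_quotient,
    QuotientGroup.mk'_surjective N, ?_⟩
  rintro ⟨_, ⟨j, rfl⟩, hj⟩
  exact hgN j (QuotientGroup.eq.1 hj.symm)

variable [IsFreeGroup A] [IsFreeGroup B]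

theorem IsAmalgam.properties_of_isFreeGroup (hp : p.Prime) {iA : A →* G} {iB : B →* G} {u : A} {v : B}
    (hG : IsAmalgam iA iB u v) (huv : SameOrder u v) (hu : IsPClosedZPowers p u)
    (hv : IsPClosedZPowers p v) : IsResiduallyP p G ∧ ClosureLeRoots p G :=
  ⟨hG.isResiduallyP hp (IsFreeGroup.isResiduallyP hp) (IsFreeGroup.isResiduallyP hp) huv hu hv,
    hG.closureLeRoots hp (IsFreeGroup.isResiduallyP hp) (IsFreeGroup.isResiduallyP hp) huv hu hv
      (IsFreeGroup.closureLeRoots hp) (IsFreeGroup.closureLeRoots hp)⟩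

/-- With `n = p ^ s * n'` and `n'` prime to `p`, the group is obtained by adjoining an `n'`-th root to `h` and
identifying this root with `k ^ p ^ s`. -/
theorem IsAmalgam.properties_of_maximal_left (hp : p.Prime) {iA : A →* G} {iB : B →* G} {h : A} {k : B}
    (hh : IsMaximalCyclicSubgroup (Subgroup.zpowers h))
    (hk : IsMaximalCyclicSubgroup (Subgroup.zpowers k)) {n : ℕ} (hG : IsAmalgam iA iB h (k ^ n))
    (hh1 : h ≠ 1) (hkn : k ^ n ≠ 1) : IsResiduallyP p G ∧ ClosureLeRoots p G := by
  have hk1 : k ≠ 1 := by rintro rfl; exact hkn (one_pow n)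
  have hn0 : n ≠ 0 := by rintro rfl; exact hkn (pow_zero k)
  obtain ⟨s, n', hn', rfl⟩ := Nat.exists_eq_pow_mul_and_not_dvd hn0 p hp.ne_one
  rw [pow_mul] at hG
  have hks : k ^ p ^ s ≠ 1 := IsFreeGroup.pow_ne_one hk1 (pow_ne_zero _ hp.ne_zero)
  have hkcl := hk.isPClosedZPowers hp s
  by_cases hn1 : n' = 1
  · subst hn1
    rw [pow_one] at hG
    have hcl := hh.isPClosedZPowers hp 0
    rw [pow_zero, pow_one] at hcl
    exact hG.properties_of_isFreeGroup hp
      (Or.inl ⟨fun _ h => IsFreeGroup.zpow_ne_one hh1 h, fun _ h => IsFreeGroup.zpow_ne_one hks h⟩)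
      hcl hkcl
  · obtain ⟨j, hj⟩ := hG.exists_rootExtension
    have hU := RootExtension.exists_unitriangular_ne_one hp hh1 hh hn'
    have huv : SameOrder (RootExtension.root : RootExtension h n') (k ^ p ^ s) :=
      Or.inl ⟨RootExtension.root_zpow_ne_one hp hh1 hn', fun _ h => IsFreeGroup.zpow_ne_one hks h⟩
    have hcl := RootExtension.isPClosedZPowers_root hp hh1 hh hn' hn1
    exact ⟨hj.isResiduallyP hp (isResiduallyP_of_unitriangular hp hU) (IsFreeGroup.isResiduallyP hp)
        huv hcl hkcl,
      hj.closureLeRoots hp (isResiduallyP_of_unitriangular hp hU) (IsFreeGroup.isResiduallyP hp)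
        huv hcl hkcl (closureLeRoots_of_unitriangular hp hU) (IsFreeGroup.closureLeRoots hp)⟩

theorem IsAmalgam.properties (hp : p.Prime) {iA : A →* G} {iB : B →* G} {h : A} {k : B}
    (hh : IsMaximalCyclicSubgroup (Subgroup.zpowers h))
    (hk : IsMaximalCyclicSubgroup (Subgroup.zpowers k)) {m n : ℕ}
    (hG : IsAmalgam iA iB (h ^ m) (k ^ n)) (htriv : h ^ m = 1 ↔ k ^ n = 1)
    (hmn : m = 1 ∨ n = 1 ∨ ((∃ i : ℕ, m = p ^ i) ∧ (∃ j : ℕ, n = p ^ j))) :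
    IsResiduallyP p G ∧ ClosureLeRoots p G := by
  -- If the amalgamated subgroups are trivial (for instance `m = 0`), then `G` is a free product.
  by_cases hm1 : h ^ m = 1
  · have hn1 := htriv.1 hm1
    rw [hm1, hn1] at hG
    exact hG.properties_of_isFreeGroup hp (Or.inr ⟨rfl, rfl⟩)
      (IsFreeGroup.isResiduallyP hp).isPClosedZPowers_one
      (IsFreeGroup.isResiduallyP hp).isPClosedZPowers_one
  · have hn1 : k ^ n ≠ 1 := fun h' => hm1 (htriv.2 h')
    rcases hmn with rfl | rfl | ⟨⟨i, rfl⟩, ⟨j, rfl⟩⟩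
    · rw [pow_one] at hG hm1
      exact hG.properties_of_maximal_left hp hh hk hm1 hn1
    · rw [pow_one] at hG hn1
      exact hG.symm.properties_of_maximal_left hp hk hh hn1 hm1
    · exact hG.properties_of_isFreeGroup hp
        (Or.inl ⟨fun _ h => IsFreeGroup.zpow_ne_one hm1 h, fun _ h => IsFreeGroup.zpow_ne_one hn1 h⟩)
        (hh.isPClosedZPowers hp i) (hk.isPClosedZPowers hp j)

end Final

theorem corollary2p5 {A : Type*} {B : Type*} [Group A] [Group B] [IsFreeGroup A] [IsFreeGroup B]
    (p : ℕ) (hp : p.Prime) (h : A) (k : B)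
    (hh : IsMaximalCyclicSubgroup (Subgroup.zpowers h))
    (hk : IsMaximalCyclicSubgroup (Subgroup.zpowers k))
    (m n : ℕ)
    (φ : Subgroup.zpowers (h ^ m) ≃* Subgroup.zpowers (k ^ n))
    (hmn : m = 1 ∨ n = 1 ∨ ((∃ i : ℕ, m = p ^ i) ∧ (∃ j : ℕ, n = p ^ j))) :
    ∀ F : Subgroup (AmalgamatedProduct (Subgroup.zpowers (h ^ m)) (Subgroup.zpowers (k ^ n)) φ),
      IsCyclic F → IsPPrimeIsolated p F → IsPSeparable p F := by
  obtain ⟨iA, iB, hG⟩ := isAmalgam_amalgamatedProduct (h ^ m) (k ^ n) φ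
  obtain ⟨k', hk', hv⟩ := exists_maximal_pow_eq hk φ
  have htriv : h ^ m = 1 ↔ k' ^ n = 1 := by
    rw [← hv, OneMemClass.coe_eq_one, EmbeddingLike.map_eq_one_iff, Subgroup.mk_eq_one]
  rw [hv] at hG
  intro F hc hF
  exact IsPSeparable.of_closureLeRoots (hG.properties hp hh hk' htriv hmn).2 hc hF
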